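/- Let $\eta>0$, $p>3$, $0\le q<p$, $C\in\mathbb R$, and let $\Phi(\xi)=-|\xi|^p+\Phi_1(\xi)$ with $\Phi_1:\mathbb R\to\mathbb R$ measurable and $|\Phi_1(\xi)|\le C(1+|\xi|^q)$ for all $\xi\in\mathbb R$. Let $L$ be defined by $\widehat{Lf}(\xi)=-\Phi(\xi)\widehat f(\xi)$, where $\widehat f(\xi)=\int_{\mathbb R} e^{-ix\xi}f(x)\,dx$. For $s\in\mathbb R$ let $H^s(\mathbb R)$ be the $L^2$-based Sobolev space of complex-valued tempered distributions, let $H^\infty=\bigcap_\sigma H^\sigma$ with the topology given by all the norms $\|\cdot\|_{H^\sigma}$, and for $0<T\le1$ put $$\|f\|_{X_T^s}=\sup_{t\in[0,T]}\big\{\|f(t)\|_{H^s}+t^{|s|/p}\|f(t)\|_{L^2}\big\}$$ (with $\|g\|_{L^2}=\infty$ if $g\notin L^2$, and $0\cdot\infty=0$). Consider the initial value problem $$v_t+v_{xxx}+\eta Lv+(v^2)_x=0,\qquad v(0)=v_0 .\tag{1}$$ A solution of (1) in $C([0,T];H^s(\mathbb R))$ is a $v\in C([0,T];H^s(\mathbb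 R))$ with $v(0)=v_0$ such that $v(t)\in L^2(\mathbb R)$ for $0<t\le T$, with $\sup_{\varepsilon\le t\le T}\|v(t)\|_{L^2}<\infty$ for every $\varepsilon\in(0,T]$ (so that $v^2$ makes sense; this is automatic if $s\ge0$), and such that the equation holds in the sense of distributions: for every Schwartz function $\psi$ and all $0<a\le b\le T$, $$\langle v(b),\psi\rangle-\langle v(a),\psi\rangle+\int_a^b\big\langle v_{xxx}(\tau)+\eta Lv(\tau)+(v(\tau)^2)_x,\psi\big\rangle\,d\tau=0 .$$ Theorem 1.1. Let $s>-\frac p2$. For every $R>0$ there is a time $T\in(0,1]$, depending only on $R$ (and on $\eta,\Phi,p,s$), such that for every $v_0\in H^s(\mathbb R)$ with $\|v_0\|_{H^s}<R$ the problem (1) has exactly one solution $v$ in $C([0,T];H^s(\mathbb R))$. This solution belongs to $X_T^s$ and to $C((0,T];H^\infty(\mathbb R))$. If $\Phi$ is even and $v_0$ is real-valued, then $v(t)$ is real-valued for all $t\in[0,T]$. Moreover the map $v_0\mapsto v$ is smooth ($C^\infty$ in the Fréchet sense, over $\mathbb C$ and hence over $\mathbb R$) from the ball $\{v_0\in H^s(\mathbb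 R):\|v_0\|_{H^s}<R\}$ to $C([0,T];H^s(\mathbb R))\cap X_T^s$. -/

import Mathlib

open MeasureTheory Set TemperedDistribution
open scoped SchwartzMap FourierTransform ContDiff

noncomputable section

namespace DissipativeKdV

/-! ### The Sobolev space `H^s(ℝ)` as a normed space of tempered distributions -/

/-- The tempered distributions `f` with `(1 + ξ²)^(s/2) 𝓕 f ∈ L²`, as a linear subspace. -/
def sobolevSubmodule (s : ℝ) : Submodule ℂ 𝓢'(ℝ, ℂ) where
  carrier := {f | MemSobolev s 2 f}
  add_mem' hf hg := MemSobolev.add hf hg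
  zero_mem' := memSobolev_fun_zero ℝ ℂ s 2
  smul_mem' c _ hf := MemSobolev.smul c hf

/-- The space `H^s(ℝ)` of complex-valued tempered distributions (a type of its own, because it
carries the Sobolev norm and not the topology of `𝓢'`). -/
def Hs (s : ℝ) : Type := sobolevSubmodule s

instance (s : ℝ) : AddCommGroup (Hs s) := inferInstanceAs (AddCommGroup (sobolevSubmodule s))

instance (s : ℝ) : Module ℂ (Hs s) := inferInstanceAs (Module ℂ (sobolevSubmodule s))

/-- The inclusion `H^s(ℝ) ⊆ 𝓢'(ℝ)`. -/
def Hs.toDist {s : ℝ} : Hs s →ₗ[ℂ] 𝓢'(ℝ, ℂ) := (sobolevSubmodule s).subtype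

theorem Hs.toDist_injective {s : ℝ} : Function.Injective (Hs.toDist (s := s)) :=
  (sobolevSubmodule s).injective_subtype

theorem l2_toTemperedDistribution_injective {g h : Lp ℂ 2 (volume : Measure ℝ)}
    (H : (g : 𝓢'(ℝ, ℂ)) = h) : g = h := by
  have hker := Lp.ker_toTemperedDistributionCLM_eq_bot (E := ℝ) (F := ℂ)
    (μ := (volume : Measure ℝ)) (p := 2)
  have : Function.Injective (Lp.toTemperedDistributionCLM ℂ (volume : Measure ℝ) 2) :=
    LinearMap.ker_eq_bot.mp hker
  exact this H

theorem Hs.exists_bessel {s : ℝ} (f : Hs s) : ∃ g : Lp ℂ 2 (volume : Measure ℝ),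
    besselPotential ℝ ℂ s (Hs.toDist f) = g := f.2

theorem Hs.bessel_unique {s : ℝ} (f : Hs s) {g : Lp ℂ 2 (volume : Measure ℝ)}
    (hg : besselPotential ℝ ℂ s (Hs.toDist f) = g) : (Hs.exists_bessel f).choose = g :=
  l2_toTemperedDistribution_injective ((Hs.exists_bessel f).choose_spec.symm.trans hg)

/-- For `f ∈ H^s`, the `L²` function whose Fourier transform is `(1 + ξ²)^(s/2) 𝓕 f`. -/
def Hs.bessel {s : ℝ} : Hs s →ₗ[ℂ] Lp ℂ 2 (volume : Measure ℝ) where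
  toFun f := (Hs.exists_bessel f).choose
  map_add' f g := by
    apply Hs.bessel_unique
    rw [map_add, map_add]
    refine (congrArg₂ (· + ·) (Hs.exists_bessel f).choose_spec
      (Hs.exists_bessel g).choose_spec).trans ?_
    exact (map_add (Lp.toTemperedDistributionCLM ℂ volume 2) _ _).symm
  map_smul' c f := by
    apply Hs.bessel_unique
    rw [map_smul, map_smul]
    refine (congrArg (c • ·) (Hs.exists_bessel f).choose_spec).trans ?_
    exact (map_smul (Lp.toTemperedDistributionCLM ℂ volume 2) c _).symm

theorem Hs.bessel_spec {s : ℝ} (f : Hs s) :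
    besselPotential ℝ ℂ s (Hs.toDist f) = Hs.bessel f := (Hs.exists_bessel f).choose_spec

theorem Hs.bessel_injective {s : ℝ} : Function.Injective (Hs.bessel (s := s)) := by
  intro f g h
  apply Hs.toDist_injective
  have h1 : besselPotential ℝ ℂ s (Hs.toDist f) = besselPotential ℝ ℂ s (Hs.toDist g) := by
    rw [Hs.bessel_spec, Hs.bessel_spec, h]
  have h2 := congrArg (besselPotential ℝ ℂ (-s)) h1
  simpa using h2

/-- The norm of `H^s` is `‖f‖_{H^s} = ‖(1 + ξ²)^(s/2) 𝓕 f‖_{L²}` (by Plancherel). -/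
instance (s : ℝ) : NormedAddCommGroup (Hs s) :=
  NormedAddCommGroup.induced (Hs s) (Lp ℂ 2 (volume : Measure ℝ)) Hs.bessel Hs.bessel_injective

instance (s : ℝ) : NormedSpace ℂ (Hs s) :=
  NormedSpace.induced ℂ (Hs s) (Lp ℂ 2 (volume : Measure ℝ)) Hs.bessel

/-- The Fourier transform `∫ e^{-2πi x ξ} f(x) dx` of `f ∈ H^s`, which is a function (defined
almost everywhere). -/
def Hs.hat {s : ℝ} (f : Hs s) (ξ : ℝ) : ℂ :=
  (((1 + ξ ^ 2) ^ (-s / 2) : ℝ) : ℂ) * (𝓕 (Hs.bessel f) : Lp ℂ 2 (volume : Measure ℝ)) ξ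

/-- The `L²` norm of a tempered distribution; `∞` when it is not in `L²`. -/
def l2ENorm (f : 𝓢'(ℝ, ℂ)) : ENNReal :=
  ⨅ (g : Lp ℂ 2 (volume : Measure ℝ)) (_ : f = g), ‖g‖ₑ

/-- A tempered distribution is real-valued when it is real on real test functions. -/
def IsRealValued (f : 𝓢'(ℝ, ℂ)) : Prop :=
  ∀ ψ : 𝓢(ℝ, ℂ), (∀ x, (ψ x).im = 0) → (f ψ).im = 0

/-! ### The space `C([0,T]; H^s) ∩ X_T^s` -/

/-- `‖f‖_{X_T^s} = sup_{t ∈ [0,T]} (‖f(t)‖_{H^s} + t^{|s|/p} ‖f(t)‖_{L²})`, with values in `[0,∞]`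
and with `0 · ∞ = 0` at `t = 0`. -/
def xENorm (p s T : ℝ) (f : C(Icc (0 : ℝ) T, Hs s)) : ENNReal :=
  ⨆ t : Icc (0 : ℝ) T,
    (‖f t‖ₑ + ENNReal.ofReal ((t : ℝ) ^ (|s| / p)) * l2ENorm (Hs.toDist (f t)))

theorem l2ENorm_add_le (f g : 𝓢'(ℝ, ℂ)) : l2ENorm (f + g) ≤ l2ENorm f + l2ENorm g := by
  unfold l2ENorm
  simp only [ENNReal.iInf_add, ENNReal.add_iInf]
  refine le_iInf fun a => le_iInf fun ha => le_iInf fun b => le_iInf fun hb => ?_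
  refine (iInf₂_le (b + a) ?_).trans (enorm_add_le b a)
  rw [ha, hb, ← Lp.toTemperedDistributionCLM_apply, ← Lp.toTemperedDistributionCLM_apply,
    ← Lp.toTemperedDistributionCLM_apply, map_add]

theorem l2ENorm_zero : l2ENorm 0 = 0 := by
  refine le_antisymm ((iInf₂_le 0 ?_).trans (by simp)) bot_le
  rw [← Lp.toTemperedDistributionCLM_apply, map_zero]

theorem l2ENorm_smul_le (c : ℂ) (f : 𝓢'(ℝ, ℂ)) : l2ENorm (c • f) ≤ ‖c‖ₑ * l2ENorm f := by
  rcases eq_or_ne c 0 with rfl | hc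
  · have h : (0 : ℂ) • f = 0 := by
      ext
      simp
    rw [h, l2ENorm_zero]
    exact bot_le
  have h0 : ‖c‖ₑ ≠ 0 := by simpa using hc
  have h : ‖c‖ₑ * l2ENorm f =
      ⨅ (g : Lp ℂ 2 (volume : Measure ℝ)) (_ : f = g), ‖c‖ₑ * ‖g‖ₑ := by
    unfold l2ENorm
    simp only [ENNReal.mul_iInf_of_ne h0 enorm_ne_top]
  rw [h]
  refine le_iInf fun a => le_iInf fun ha => ?_
  refine (iInf₂_le (c • a) ?_).trans (enorm_smul c a).le
  rw [ha, ← Lp.toTemperedDistributionCLM_apply, ← Lp.toTemperedDistributionCLM_apply, map_smul]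

theorem xENorm_add_le (p s T : ℝ) (f g : C(Icc (0 : ℝ) T, Hs s)) :
    xENorm p s T (f + g) ≤ xENorm p s T f + xENorm p s T g := by
  refine iSup_le fun t => ?_
  refine le_trans ?_ (add_le_add (le_iSup (fun t : Icc (0 : ℝ) T => (‖f t‖ₑ +
    ENNReal.ofReal ((t : ℝ) ^ (|s| / p)) * l2ENorm (Hs.toDist (f t)))) t)
    (le_iSup (fun t : Icc (0 : ℝ) T => (‖g t‖ₑ +
    ENNReal.ofReal ((t : ℝ) ^ (|s| / p)) * l2ENorm (Hs.toDist (g t)))) t))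
  rw [ContinuousMap.add_apply, map_add, add_add_add_comm, ← mul_add]
  gcongr
  · exact enorm_add_le _ _
  · exact l2ENorm_add_le _ _

theorem xENorm_smul_le (p s T : ℝ) (c : ℂ) (f : C(Icc (0 : ℝ) T, Hs s)) :
    xENorm p s T (c • f) ≤ ‖c‖ₑ * xENorm p s T f := by
  refine iSup_le fun t => ?_
  refine le_trans ?_ (mul_le_mul_right (le_iSup (fun t : Icc (0 : ℝ) T => (‖f t‖ₑ +
    ENNReal.ofReal ((t : ℝ) ^ (|s| / p)) * l2ENorm (Hs.toDist (f t)))) t) _)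
  rw [ContinuousMap.smul_apply, map_smul, mul_add, mul_left_comm]
  gcongr
  · exact (enorm_smul _ _).le
  · exact l2ENorm_smul_le _ _

theorem xENorm_zero (p s T : ℝ) : xENorm p s T 0 = 0 := by
  simp [xENorm, l2ENorm_zero]

/-- The functions of `C([0,T]; H^s)` with finite `X_T^s` norm, as a linear subspace. -/
def xSubmodule (p s T : ℝ) : Submodule ℂ C(Icc (0 : ℝ) T, Hs s) where
  carrier := {f | xENorm p s T f < ⊤}
  add_mem' {f g} hf hg := (xENorm_add_le p s T f g).trans_lt (ENNReal.add_lt_top.2 ⟨hf, hg⟩)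
  zero_mem' := by simp [xENorm_zero]
  smul_mem' c f hf :=
    (xENorm_smul_le p s T c f).trans_lt (ENNReal.mul_lt_top enorm_lt_top hf)

/-- The normed space `C([0,T]; H^s) ∩ X_T^s`. Its norm is the `X_T^s` norm, which dominates the norm
of `C([0,T]; H^s)`. -/
def XT (p s T : ℝ) : Type := xSubmodule p s T

instance (p s T : ℝ) : AddCommGroup (XT p s T) :=
  inferInstanceAs (AddCommGroup (xSubmodule p s T))

instance (p s T : ℝ) : Module ℂ (XT p s T) := inferInstanceAs (Module ℂ (xSubmodule p s T))

/-- The inclusion into `C([0,T]; H^s)`. -/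
def XT.toC {p s T : ℝ} : XT p s T →ₗ[ℂ] C(Icc (0 : ℝ) T, Hs s) := (xSubmodule p s T).subtype

instance (p s T : ℝ) : Norm (XT p s T) := ⟨fun f => (xENorm p s T (XT.toC f)).toReal⟩

theorem XT.ne_top {p s T : ℝ} (f : XT p s T) : xENorm p s T (XT.toC f) ≠ ⊤ := f.2.ne

theorem XT.norm_smul_le {p s T : ℝ} (c : ℂ) (f : XT p s T) : ‖c • f‖ ≤ ‖c‖ * ‖f‖ := by
  have h := ENNReal.toReal_mono (ENNReal.mul_ne_top enorm_ne_top f.ne_top)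
    (xENorm_smul_le p s T c (XT.toC f))
  rw [ENNReal.toReal_mul, toReal_enorm] at h
  exact h

theorem XT.core (p s T : ℝ) : NormedSpace.Core ℂ (XT p s T) where
  norm_nonneg _ := ENNReal.toReal_nonneg
  norm_smul c f := by
    refine le_antisymm (XT.norm_smul_le c f) ?_
    rcases eq_or_ne c 0 with rfl | hc
    · rw [norm_zero, zero_mul]
      exact ENNReal.toReal_nonneg
    have h := XT.norm_smul_le c⁻¹ (c • f)
    rw [inv_smul_smul₀ hc, norm_inv] at h
    have hc' : 0 < ‖c‖ := norm_pos_iff.2 hc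
    calc ‖c‖ * ‖f‖ ≤ ‖c‖ * (‖c‖⁻¹ * ‖c • f‖) := by gcongr
      _ = ‖c • f‖ := by field_simp
  norm_triangle f g := by
    have h := ENNReal.toReal_mono (ENNReal.add_ne_top.2 ⟨f.ne_top, g.ne_top⟩)
      (xENorm_add_le p s T (XT.toC f) (XT.toC g))
    rw [ENNReal.toReal_add f.ne_top g.ne_top] at h
    exact h
  norm_eq_zero_iff f := by
    constructor
    · intro h
      have h0 : xENorm p s T (XT.toC f) = 0 :=
        ((ENNReal.toReal_eq_zero_iff _).1 h).resolve_right f.ne_top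
      have h1 : XT.toC f = 0 := by
        ext1 t
        have h2 := ENNReal.iSup_eq_zero.1 h0 t
        simpa using (add_eq_zero.1 h2).1
      exact (xSubmodule p s T).injective_subtype h1
    · rintro rfl
      change (xENorm p s T (XT.toC (0 : XT p s T))).toReal = 0
      rw [map_zero, xENorm_zero, ENNReal.toReal_zero]

instance (p s T : ℝ) : NormedAddCommGroup (XT p s T) :=
  NormedAddCommGroup.ofCore (XT.core p s T)

instance (p s T : ℝ) : NormedSpace ℂ (XT p s T) :=
  NormedSpace.ofCore (XT.core p s T)

/-! ### The initial value problem -/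

/-- The pairing `⟨L f, ψ⟩`, where `L` is the Fourier multiplier with symbol `-Φ`. The symbol is a
function of the frequency in the convention `f̂(ξ) = ∫ e^{-i x ξ} f(x) dx`, whence the argument
`2πξ`; and `⟨L f, ψ⟩ = ⟨𝓕 (L f), 𝓕⁻ ψ⟩`. -/
def pairL (Φ : ℝ → ℝ) {s : ℝ} (f : Hs s) (ψ : 𝓢(ℝ, ℂ)) : ℂ :=
  ∫ ξ : ℝ, (-(Φ (2 * Real.pi * ξ) : ℂ)) * f.hat ξ * (𝓕⁻ ψ) ξ

/-- The pairing `⟨∂ₓ³ f, ψ⟩`. -/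
def pairDxxx (f : 𝓢'(ℝ, ℂ)) (ψ : 𝓢(ℝ, ℂ)) : ℂ :=
  derivCLM ℂ (derivCLM ℂ (derivCLM ℂ f)) ψ

/-- The pairing `⟨∂ₓ(u²), ψ⟩` for `u ∈ L²`. -/
def pairDxSq (u : Lp ℂ 2 (volume : Measure ℝ)) (ψ : 𝓢(ℝ, ℂ)) : ℂ :=
  -∫ x : ℝ, (u x) ^ 2 * deriv ψ x

/-- `v ∈ C([0,T]; H^s)` solves `v_t + v_xxx + η L v + (v²)_x = 0`, `v(0) = v₀`. In order that `v²` make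
sense, `v(t)` is required to be a function `u(t) ∈ L²(ℝ)` for `0 < t ≤ T`, bounded in `L²` away from
`t = 0`; this is automatic when `s ≥ 0`. The equation is understood in the sense of distributions,
integrated in time. -/
structure IsSolution (η : ℝ) (Φ : ℝ → ℝ) (s T : ℝ) (v₀ : Hs s) (v : ℝ → Hs s) : Prop where
  continuousOn : ContinuousOn v (Icc 0 T)
  initial : v 0 = v₀
  equation : ∃ u : ℝ → Lp ℂ 2 (volume : Measure ℝ),
    (∀ t ∈ Ioc 0 T, Hs.toDist (v t) = u t) ∧
    (∀ ε ∈ Ioc 0 T, ∃ M : ℝ, ∀ t ∈ Icc ε T, ‖u t‖ ≤ M) ∧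
    ∀ ψ : 𝓢(ℝ, ℂ), ∀ a b : ℝ, 0 < a → a ≤ b → b ≤ T →
      IntervalIntegrable
        (fun τ => pairDxxx (Hs.toDist (v τ)) ψ + η * pairL Φ (v τ) ψ + pairDxSq (u τ) ψ)
        volume a b ∧
      (Hs.toDist (v b) ψ - Hs.toDist (v a) ψ) +
        ∫ τ in a..b, (pairDxxx (Hs.toDist (v τ)) ψ + η * pairL Φ (v τ) ψ + pairDxSq (u τ) ψ) = 0

/-- `v ∈ C((0,T]; H^∞)`: for every `σ`, `v` is continuous on `(0,T]` with values in `H^σ`. -/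
def SmoothAfterZero {s : ℝ} (T : ℝ) (v : ℝ → Hs s) : Prop :=
  ∀ σ : ℝ, ∃ w : ℝ → Hs σ, ContinuousOn w (Ioc 0 T) ∧
    ∀ t ∈ Ioc 0 T, Hs.toDist (w t) = Hs.toDist (v t)

end DissipativeKdV

end

/-!
On the Fourier side `H^s` is `L²`: `coord s` sends `f` to `(1 + ξ²)^(s/2) 𝓕 f`, and derivatives,
the linear flow and the inclusions of the Sobolev spaces become multiplication operators. The
symbol `m(ξ) = -(2πiξ)³ + η Φ(2πξ)` of the linear part satisfies `Re m(ξ) ≤ M - c (1 + ξ²)^(p/2)`,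
as the term `Φ₁` of lower order and the purely imaginary dispersive term do not matter. Hence the
semigroup `e^{rm}` gains `γ` derivatives at the cost of a factor `r^(-γ/p)`
(`DissSymbol.exists_jb_mul_exp_le`). Dissipation is all that is used; dispersion plays no role.

The quadratic term only needs the crude product estimate `H^σ × H^σ → H^(σ-κ)` for `σ ≥ 0` and
`κ > 1/2` (`prodOp`). As `v(τ)` has size `τ^(-|s|/p)` in `L²` when `s < 0`, the Duhamel
term is an integral of a product of powers of `t - τ` and of `τ`. The assumptions `s > -p/2` and
`p > 3` say that these powers are integrable, for a suitable `κ` (`exists_exponents`). The Duhamel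
term is then a bounded bilinear operator `B` on the complete space `XT`, of norm
`O(T^(1-γ))` with `γ < 1` (`Exponents.exists_bilinear`), and for small `T` the integral equation
`V + B(V, V) = e^{tm} v₀` has a unique small solution by contraction. The derivative of the left
side in `V` is invertible there, so the inverse function theorem makes the solution a smooth
function of `v₀` (`contDiffOn_quadSol`, `Exponents.exists_solutionMap`).

The integral equation and the weak equation are equivalent. In one direction this is
differentiation under the pairing with a test function (`DissSymbol.weak_of_duhamel`,
`IsMild.isSolution`). In the other one, a weak solution is compared with the Duhamel formula after
truncation to bounded frequencies, where the generator is a bounded operator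
(`DissSymbol.duhamel_of_weak`, `IsSolution.duhamel_eq`).

A solution in `C([0,T]; H^s)` is not assumed to lie in `XT`, so the contraction does not give
uniqueness directly. On `[t₀, T]` with `t₀ > 0`, however, the solution `w` is bounded in `L²`, and so
it agrees there with the constructed solution issued from `w(t₀)`: the difference of two bounded
solutions of the integral equation vanishes on successive short intervals of a common length
(`Exponents.eq_zero_of_duhamel`, `IsSolution.eq_mild`). Letting `t₀ → 0`, the continuity of `w` and
of the solution map identifies `w` with the solution issued from `v₀`
(`IsSolution.eq_solutionMap`).

Restarting at positive times also gives smoothness: since `p > 3`, a bound in `H^σ` away from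
`t = 0` improves to one in `H^(σ+1)` (`IsSolution.boundedAwayFromZero_add_one`), and boundedness in
every `H^σ` together with continuity in `H^s` gives continuity in every `H^σ` by interpolation
(`continuousOn_of_boundedAwayFromZero`). Finally, for even `Φ` the conjugate of a solution
is a solution issued from the conjugate datum, so real data have real solutions by uniqueness
(`Exponents.conjReflect_solution`).
-/

noncomputable section

namespace DissipativeKdV

open Filter Topology

/-! ### Weights and bounded Fourier multipliers on `L²` -/

section

/-- The space `L²(ℝ)`, in which all elements of Sobolev spaces are represented on the Fourier
side. -/
abbrev L2R := Lp ℂ 2 (volume : Measure ℝ)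

/-- The weight `(1 + ξ²)^(r/2)`. -/
def jb (r ξ : ℝ) : ℝ := (1 + ξ ^ 2) ^ (r / 2)

theorem jb_pos (r ξ : ℝ) : 0 < jb r ξ := by unfold jb; positivity

theorem jb_add (r r' ξ : ℝ) : jb (r + r') ξ = jb r ξ * jb r' ξ := by
  unfold jb
  rw [add_div, Real.rpow_add (by positivity)]

@[simp] theorem jb_zero (ξ : ℝ) : jb 0 ξ = 1 := by simp [jb]

theorem jb_mono {r r' : ℝ} (h : r ≤ r') (ξ : ℝ) : jb r ξ ≤ jb r' ξ := by
  unfold jb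
  exact Real.rpow_le_rpow_of_exponent_le (by nlinarith [sq_nonneg ξ]) (by linarith)

theorem jb_le_one {r : ℝ} (h : r ≤ 0) (ξ : ℝ) : jb r ξ ≤ 1 := by
  simpa using jb_mono h ξ

theorem one_le_jb {r : ℝ} (h : 0 ≤ r) (ξ : ℝ) : 1 ≤ jb r ξ := by
  simpa using jb_mono h ξ

theorem jb_mul_neg (r ξ : ℝ) : jb r ξ * jb (-r) ξ = 1 := by
  rw [← jb_add, add_neg_cancel, jb_zero]

theorem jb_rpow (r x ξ : ℝ) : jb r ξ ^ x = jb (r * x) ξ := by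
  unfold jb
  rw [← Real.rpow_mul (by positivity)]
  ring_nf

@[simp] theorem jb_neg_arg (r ξ : ℝ) : jb r (-ξ) = jb r ξ := by simp [jb]

theorem continuous_jb (r : ℝ) : Continuous (jb r) := by
  unfold jb
  exact Continuous.rpow_const (by fun_prop) fun ξ => Or.inl (by positivity)

@[fun_prop] theorem measurable_jb (r : ℝ) : Measurable (jb r) := (continuous_jb r).measurable

theorem abs_le_jb_one (ξ : ℝ) : |ξ| ≤ jb 1 ξ := by
  unfold jb
  rw [← Real.sqrt_eq_rpow, ← Real.sqrt_sq_eq_abs]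
  exact Real.sqrt_le_sqrt (by linarith)

theorem abs_rpow_le_jb {q : ℝ} (hq : 0 ≤ q) (ξ : ℝ) : |ξ| ^ q ≤ jb q ξ := by
  have h := Real.rpow_le_rpow (abs_nonneg ξ) (abs_le_jb_one ξ) hq
  rwa [jb_rpow, one_mul] at h

/-- Peetre's inequality. -/
theorem jb_peetre {r : ℝ} (hr : 0 ≤ r) (ξ ζ : ℝ) :
    jb r ξ ≤ 2 ^ (r / 2) * (jb r (ξ - ζ) * jb r ζ) := by
  unfold jb
  rw [← Real.mul_rpow (by positivity) (by positivity),
    ← Real.mul_rpow (by positivity) (by positivity)]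
  refine Real.rpow_le_rpow (by positivity) ?_ (by linarith)
  nlinarith [sq_nonneg (ξ - ζ - ζ), sq_nonneg ((ξ - ζ) * ζ)]

theorem memLp_jb {r : ℝ} (hr : r < -(1 / 2)) :
    MemLp (jb r) 2 (volume : Measure ℝ) := by
  rw [memLp_two_iff_integrable_sq (continuous_jb r).aestronglyMeasurable]
  have h := integrable_rpow_neg_one_add_norm_sq (E := ℝ) (μ := volume) (r := -(2 * r))
    (by simp; linarith)
  refine h.congr (ae_of_all _ fun ξ => ?_)
  change (1 + ‖ξ‖ ^ 2) ^ (-(-(2 * r)) / 2) = jb r ξ ^ 2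
  rw [Real.norm_eq_abs, sq_abs, ← Real.rpow_natCast (jb r ξ), jb_rpow, jb]
  congr 1
  push_cast
  ring

/-- A bounded measurable function, the symbol of a bounded multiplier on `L²`. -/
structure IsSymbol (φ : ℝ → ℂ) : Prop where
  meas : Measurable φ
  bdd : ∃ C, ∀ ξ, ‖φ ξ‖ ≤ C

theorem IsSymbol.memLp {φ : ℝ → ℂ} (h : IsSymbol φ) : MemLp φ ⊤ (volume : Measure ℝ) := by
  obtain ⟨C, hC⟩ := h.bdd
  exact memLp_top_of_bound h.meas.aestronglyMeasurable C (ae_of_all _ hC)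

theorem IsSymbol.mul {φ ψ : ℝ → ℂ} (h : IsSymbol φ) (h' : IsSymbol ψ) :
    IsSymbol fun ξ => φ ξ * ψ ξ := by
  obtain ⟨C, hC⟩ := h.bdd
  obtain ⟨C', hC'⟩ := h'.bdd
  refine ⟨h.meas.mul h'.meas, C * C', fun ξ => ?_⟩
  rw [norm_mul]
  exact mul_le_mul (hC ξ) (hC' ξ) (norm_nonneg _) ((norm_nonneg _).trans (hC ξ))

open Classical in
/-- Multiplication by `φ` on `L²(ℝ)`; zero when `φ` is not a bounded measurable function. -/
def mulOp (φ : ℝ → ℂ) : L2R →L[ℂ] L2R :=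
  if h : IsSymbol φ then
    (ContinuousLinearMap.mul ℂ ℂ).holderL volume ⊤ 2 2 (h.memLp.toLp φ)
  else 0

theorem coeFn_mulOp {φ : ℝ → ℂ} (h : IsSymbol φ) (a : L2R) :
    mulOp φ a =ᵐ[volume] fun ξ => φ ξ * a ξ := by
  rw [mulOp, dif_pos h]
  have h1 := (ContinuousLinearMap.mul ℂ ℂ).coeFn_holder (r := 2) (h.memLp.toLp φ) a
  filter_upwards [h1, h.memLp.coeFn_toLp] with ξ h2 h3
  refine h2.trans ?_
  rw [h3]
  rfl

theorem norm_mulOp_apply_le {φ : ℝ → ℂ} (hm : Measurable φ) {C : ℝ} (hC : ∀ ξ, ‖φ ξ‖ ≤ C)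
    (a : L2R) : ‖mulOp φ a‖ ≤ C * ‖a‖ := by
  refine Lp.norm_le_mul_norm_of_ae_le_mul ?_
  filter_upwards [coeFn_mulOp ⟨hm, C, hC⟩ a] with ξ h
  rw [h, norm_mul]
  gcongr
  exact hC ξ

attribute [irreducible] mulOp

theorem mulOp_mulOp {φ ψ : ℝ → ℂ} (h : IsSymbol φ) (h' : IsSymbol ψ) (a : L2R) :
    mulOp φ (mulOp ψ a) = mulOp (fun ξ => φ ξ * ψ ξ) a := by
  refine Lp.ext ?_
  filter_upwards [coeFn_mulOp h (mulOp ψ a), coeFn_mulOp h' a, coeFn_mulOp (h.mul h') a]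
    with ξ h1 h2 h3
  rw [h1, h2, h3, mul_assoc]

theorem mulOp_one (a : L2R) : mulOp (fun _ => 1) a = a := by
  refine Lp.ext ?_
  filter_upwards [coeFn_mulOp (φ := fun _ => 1) ⟨measurable_const, 1, by simp⟩ a] with ξ h
  rw [h, one_mul]

theorem norm_sq_eq_integral (a : L2R) : ‖a‖ ^ 2 = ∫ ξ, ‖a ξ‖ ^ 2 := by
  have h2 := @inner_self_eq_norm_sq ℂ L2R _ _ _ a
  rw [L2.inner_def] at h2
  rw [← h2]
  have : ∀ ξ, inner ℂ (a ξ) (a ξ) = ((‖a ξ‖ ^ 2 : ℝ) : ℂ) := fun ξ => by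
    rw [inner_self_eq_norm_sq_to_K]; norm_cast
  simp_rw [this]
  rw [integral_complex_ofReal]
  simp

/-- Multiplication operators whose symbols are uniformly bounded and converge pointwise converge
strongly. -/
theorem tendsto_mulOp {ι : Type*} {l : Filter ι} [l.IsCountablyGenerated] {φ : ι → ℝ → ℂ}
    {φ₀ : ℝ → ℂ} {C : ℝ} (hm : ∀ᶠ i in l, Measurable (φ i))
    (hC : ∀ᶠ i in l, ∀ ξ, ‖φ i ξ‖ ≤ C) (h₀ : Measurable φ₀) (hC₀ : ∀ ξ, ‖φ₀ ξ‖ ≤ C)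
    (hφ : ∀ ξ, Tendsto (fun i => φ i ξ) l (𝓝 (φ₀ ξ))) (a : L2R) :
    Tendsto (fun i => mulOp (φ i) a) l (𝓝 (mulOp φ₀ a)) := by
  rw [tendsto_iff_norm_sub_tendsto_zero]
  have hsq : Tendsto (fun i => ‖mulOp (φ i) a - mulOp φ₀ a‖ ^ 2) l (𝓝 0) := by
    have h1 : Tendsto (fun i => ∫ ξ, ‖(φ i ξ - φ₀ ξ) * a ξ‖ ^ 2) l
        (𝓝 (∫ _ : ℝ, (0 : ℝ))) := by
      refine tendsto_integral_filter_of_dominated_convergence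
        (fun ξ => (2 * C) ^ 2 * ‖a ξ‖ ^ 2) ?_ ?_ ?_ ?_
      · filter_upwards [hm] with i hi
        exact ((((hi.sub h₀).aestronglyMeasurable).mul (Lp.aestronglyMeasurable a)).norm.pow 2)
      · filter_upwards [hC] with i hi
        refine ae_of_all _ fun ξ => ?_
        rw [norm_pow, norm_norm, norm_mul, mul_pow]
        gcongr
        refine (norm_sub_le _ _).trans ?_
        linarith [hi ξ, hC₀ ξ]
      · refine Integrable.const_mul ?_ _
        exact (memLp_two_iff_integrable_sq_norm (Lp.aestronglyMeasurable a)).1 (Lp.memLp a)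
      · refine ae_of_all _ fun ξ => ?_
        have h2 : Tendsto (fun i => (φ i ξ - φ₀ ξ) * a ξ) l (𝓝 ((φ₀ ξ - φ₀ ξ) * a ξ)) :=
          ((hφ ξ).sub_const _).mul_const _
        simpa using (h2.norm.pow 2)
    rw [integral_zero] at h1
    refine h1.congr' ?_
    filter_upwards [hm, hC] with i hi hi'
    rw [norm_sq_eq_integral]
    refine integral_congr_ae ?_
    filter_upwards [Lp.coeFn_sub (mulOp (φ i) a) (mulOp φ₀ a), coeFn_mulOp ⟨hi, C, hi'⟩ a,
      coeFn_mulOp ⟨h₀, C, hC₀⟩ a] with ξ h3 h4 h5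
    rw [h3, Pi.sub_apply, h4, h5, sub_mul]
  have h2 := hsq.sqrt
  rw [Real.sqrt_zero] at h2
  refine h2.congr fun i => ?_
  rw [Real.sqrt_sq (norm_nonneg _)]

/-- The bilinear pairing `∫ a b` on `L²(ℝ)`. -/
def pair : L2R →L[ℂ] L2R →L[ℂ] ℂ := (ContinuousLinearMap.mul ℂ ℂ).lpPairing volume 2 2

theorem pair_apply (a b : L2R) : pair a b = ∫ ξ, a ξ * b ξ :=
  (ContinuousLinearMap.mul ℂ ℂ).lpPairing_eq_integral a b

attribute [irreducible] pair

theorem pair_mulOp {φ : ℝ → ℂ} (h : IsSymbol φ) (a b : L2R) :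
    pair (mulOp φ a) b = pair a (mulOp φ b) := by
  rw [pair_apply, pair_apply]
  refine integral_congr_ae ?_
  filter_upwards [coeFn_mulOp h a, coeFn_mulOp h b] with ξ h1 h2
  rw [h1, h2]
  ring

/-! ### The smoothing operators -/

/-- Multiplication by `(1 + ξ²)^(-r/2)`, for `r ≥ 0`. Its range consists of the functions which are
`r` orders smoother. -/
def smoothing (r : ℝ) : L2R →L[ℂ] L2R := mulOp fun ξ => (jb (-r) ξ : ℂ)

theorem isSymbol_jb {r : ℝ} (hr : r ≤ 0) : IsSymbol fun ξ => (jb r ξ : ℂ) := by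
  refine ⟨by fun_prop, 1, fun ξ => ?_⟩
  rw [Complex.norm_real, Real.norm_of_nonneg (jb_pos r ξ).le]
  exact jb_le_one hr ξ

theorem coeFn_smoothing {r : ℝ} (hr : 0 ≤ r) (a : L2R) :
    smoothing r a =ᵐ[volume] fun ξ => (jb (-r) ξ : ℂ) * a ξ :=
  coeFn_mulOp (isSymbol_jb (by linarith)) a

theorem norm_smoothing_le {r : ℝ} (hr : 0 ≤ r) (a : L2R) : ‖smoothing r a‖ ≤ ‖a‖ := by
  have h := norm_mulOp_apply_le (φ := fun ξ => (jb (-r) ξ : ℂ)) (by fun_prop) (C := 1)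
    (fun ξ => by
      rw [Complex.norm_real, Real.norm_of_nonneg (jb_pos _ ξ).le]
      exact jb_le_one (by linarith) ξ) a
  simpa [smoothing] using h

theorem smoothing_injective {r : ℝ} (hr : 0 ≤ r) : Function.Injective (smoothing r) := by
  intro a b h
  refine Lp.ext ?_
  have h0 := coeFn_smoothing hr a
  rw [h] at h0
  filter_upwards [h0, coeFn_smoothing hr b] with ξ h1 h2
  have h3 : (jb (-r) ξ : ℂ) ≠ 0 := by exact_mod_cast (jb_pos (-r) ξ).ne'
  exact mul_left_cancel₀ h3 (h1.symm.trans h2)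

theorem smoothing_smoothing {r r' : ℝ} (hr : 0 ≤ r) (hr' : 0 ≤ r') (a : L2R) :
    smoothing r (smoothing r' a) = smoothing (r + r') a := by
  rw [smoothing, smoothing, mulOp_mulOp (isSymbol_jb (by linarith)) (isSymbol_jb (by linarith)),
    smoothing]
  congr 2
  ext ξ
  rw [neg_add, jb_add]
  push_cast
  ring

@[simp] theorem smoothing_zero (a : L2R) : smoothing 0 a = a := by
  simp [smoothing, mulOp_one]

/-- Interpolation between three equidistant Sobolev exponents. -/
theorem norm_smoothing_sq_le {r : ℝ} (hr : 0 ≤ r) (b : L2R) :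
    ‖smoothing r b‖ ^ 2 ≤ ‖b‖ * ‖smoothing r (smoothing r b)‖ := by
  have h : inner ℂ (smoothing r b) (smoothing r b) = inner ℂ b (smoothing r (smoothing r b)) := by
    rw [L2.inner_def, L2.inner_def]
    refine integral_congr_ae ?_
    filter_upwards [coeFn_smoothing hr b, coeFn_smoothing hr (smoothing r b)] with ξ h1 h2
    rw [h2, h1]
    simp only [RCLike.inner_apply, map_mul, Complex.conj_ofReal]
    ring
  have h2 := norm_inner_le_norm (𝕜 := ℂ) b (smoothing r (smoothing r b))
  rw [← h, inner_self_eq_norm_sq_to_K] at h2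
  simpa using h2

end

/-! ### The dissipative semigroup -/

section

/-- A measurable function `m` of polynomial growth whose real part is at most
`M - c (1 + ξ²)^(p/2)` for some `c > 0`: the symbol of the generator of a semigroup that gains
smoothness like the heat flow of `|∂ₓ|^p`. -/
structure DissSymbol (m : ℝ → ℂ) (p : ℝ) : Prop where
  meas : Measurable m
  re_le : ∃ c > 0, ∃ M ≥ 0, ∀ ξ, (m ξ).re ≤ M - c * jb p ξ
  growth : ∃ C N, ∀ ξ, ‖m ξ‖ ≤ C * jb N ξ

theorem exists_rpow_mul_exp_neg_le {a c : ℝ} (ha : 0 ≤ a) (hc : 0 < c) :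
    ∃ C, 0 ≤ C ∧ ∀ x, 0 ≤ x → x ^ a * Real.exp (-(c * x)) ≤ C := by
  set n := ⌈a⌉₊ with hn
  refine ⟨1 + n.factorial / c ^ n, by positivity, fun x hx => ?_⟩
  have h1 : x ^ a ≤ 1 + x ^ n := by
    rcases le_total x 1 with h | h
    · have := Real.rpow_le_one hx h ha
      have h' : 0 ≤ x ^ n := by positivity
      linarith
    · have := Real.rpow_le_rpow_of_exponent_le h (Nat.le_ceil a)
      rw [Real.rpow_natCast] at this
      linarith
  have h2 : x ^ n ≤ n.factorial / c ^ n * Real.exp (c * x) := by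
    have h3 := Real.pow_div_factorial_le_exp (c * x) (by positivity) n
    rw [mul_pow, div_le_iff₀ (by positivity)] at h3
    rw [div_mul_eq_mul_div, le_div_iff₀ (by positivity)]
    linarith
  have h4 : Real.exp (-(c * x)) ≤ 1 := Real.exp_le_one_iff.2 (by nlinarith)
  have h5 : Real.exp (c * x) * Real.exp (-(c * x)) = 1 := by
    rw [← Real.exp_add, add_neg_cancel, Real.exp_zero]
  calc x ^ a * Real.exp (-(c * x)) ≤ (1 + x ^ n) * Real.exp (-(c * x)) := by gcongr
    _ = Real.exp (-(c * x)) + x ^ n * Real.exp (-(c * x)) := by ring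
    _ ≤ 1 + (n.factorial / c ^ n * Real.exp (c * x)) * Real.exp (-(c * x)) := by gcongr
    _ = 1 + n.factorial / c ^ n := by rw [mul_assoc, h5, mul_one]

variable {m : ℝ → ℂ} {p : ℝ}

/-- The parabolic smoothing bound: `γ` orders of smoothness cost `r^(-γ/p)`. -/
theorem DissSymbol.exists_jb_mul_exp_le (h : DissSymbol m p) (hp : 0 < p) {γ : ℝ} (hγ : 0 ≤ γ) :
    ∃ C : ℝ, 0 ≤ C ∧ ∀ r : ℝ, 0 < r → r ≤ 1 → ∀ ξ,
      jb γ ξ * ‖Complex.exp (r * m ξ)‖ ≤ C * r ^ (-(γ / p)) := by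
  obtain ⟨c, hc, M, hM, hm⟩ := h.re_le
  obtain ⟨C, hC0, hC⟩ := exists_rpow_mul_exp_neg_le (a := γ / p) (by positivity) hc
  refine ⟨C * Real.exp M, by positivity, fun r hr hr1 ξ => ?_⟩
  have h1 : ‖Complex.exp (r * m ξ)‖ ≤ Real.exp M * Real.exp (-(c * (r * jb p ξ))) := by
    rw [Complex.norm_exp, ← Real.exp_add]
    refine Real.exp_le_exp.2 ?_
    simp only [Complex.mul_re, Complex.ofReal_re, Complex.ofReal_im, zero_mul, sub_zero]
    nlinarith [mul_le_mul_of_nonneg_left (hm ξ) hr.le, mul_le_mul_of_nonneg_right hr1 hM]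
  have h2 : jb γ ξ = r ^ (-(γ / p)) * (r * jb p ξ) ^ (γ / p) := by
    rw [Real.mul_rpow hr.le (jb_pos _ _).le, ← mul_assoc, ← Real.rpow_add hr, jb_rpow]
    rw [neg_add_cancel, Real.rpow_zero, one_mul]
    congr 1
    field_simp
  have h3 := hC (r * jb p ξ) (mul_nonneg hr.le (jb_pos _ _).le)
  have h4 : 0 ≤ r ^ (-(γ / p)) := by positivity
  calc jb γ ξ * ‖Complex.exp (r * m ξ)‖
      ≤ jb γ ξ * (Real.exp M * Real.exp (-(c * (r * jb p ξ)))) :=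
        mul_le_mul_of_nonneg_left h1 (jb_pos _ _).le
    _ = ((r * jb p ξ) ^ (γ / p) * Real.exp (-(c * (r * jb p ξ)))) *
          (Real.exp M * r ^ (-(γ / p))) := by rw [h2]; ring
    _ ≤ C * (Real.exp M * r ^ (-(γ / p))) := by gcongr
    _ = C * Real.exp M * r ^ (-(γ / p)) := by ring

/-- The symbol `(1 + ξ²)^(ρ/2) e^{r m(ξ)}`. -/
def eSym (m : ℝ → ℂ) (ρ r ξ : ℝ) : ℂ := (jb ρ ξ : ℂ) * Complex.exp (r * m ξ)

/-- The symbol of `∂ₓ`. -/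
def dSym (ξ : ℝ) : ℂ := 2 * Real.pi * Complex.I * ξ

/-- The symbol `(1 + ξ²)^(ρ/2) (2πiξ) e^{r m(ξ)}`. -/
def kSym (m : ℝ → ℂ) (ρ r ξ : ℝ) : ℂ := dSym ξ * eSym m ρ r ξ

/-- The semigroup at time `r`, followed by `ρ` derivatives. -/
def semi (m : ℝ → ℂ) (ρ r : ℝ) : L2R →L[ℂ] L2R := mulOp (eSym m ρ r)

/-- The semigroup at time `r`, followed by `∂ₓ` and `ρ` further derivatives. -/
def dsemi (m : ℝ → ℂ) (ρ r : ℝ) : L2R →L[ℂ] L2R := mulOp (kSym m ρ r)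

@[fun_prop] theorem measurable_dSym : Measurable dSym := by unfold dSym; fun_prop

theorem norm_dSym_le (ξ : ℝ) : ‖dSym ξ‖ ≤ 2 * Real.pi * jb 1 ξ := by
  have : ‖dSym ξ‖ = 2 * Real.pi * |ξ| := by
    simp [dSym, abs_of_pos Real.pi_pos]
  rw [this]
  have := abs_le_jb_one ξ
  gcongr

theorem DissSymbol.measurable_eSym (h : DissSymbol m p) (ρ r : ℝ) : Measurable (eSym m ρ r) := by
  have := h.meas
  unfold eSym
  fun_prop

theorem DissSymbol.measurable_kSym (h : DissSymbol m p) (ρ r : ℝ) : Measurable (kSym m ρ r) := by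
  have := h.measurable_eSym ρ r
  unfold kSym
  fun_prop

theorem norm_eSym (m : ℝ → ℂ) (ρ r ξ : ℝ) :
    ‖eSym m ρ r ξ‖ = jb ρ ξ * ‖Complex.exp (r * m ξ)‖ := by
  rw [eSym, norm_mul, Complex.norm_real, Real.norm_of_nonneg (jb_pos _ _).le]

theorem DissSymbol.exists_eSym_le (h : DissSymbol m p) (hp : 0 < p) (ρ : ℝ) {γ : ℝ}
    (hγ : 0 ≤ γ) (hργ : ρ ≤ γ) :
    ∃ C : ℝ, 0 ≤ C ∧ ∀ r : ℝ, 0 < r → r ≤ 1 → ∀ ξ, ‖eSym m ρ r ξ‖ ≤ C * r ^ (-(γ / p)) := by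
  obtain ⟨C, hC0, hC⟩ := h.exists_jb_mul_exp_le hp hγ
  refine ⟨C, hC0, fun r hr hr1 ξ => ?_⟩
  rw [norm_eSym]
  refine le_trans ?_ (hC r hr hr1 ξ)
  gcongr
  exact jb_mono hργ ξ

theorem DissSymbol.exists_kSym_le (h : DissSymbol m p) (hp : 0 < p) (ρ : ℝ) {γ : ℝ}
    (hγ : 0 ≤ γ) (hργ : 1 + ρ ≤ γ) :
    ∃ C : ℝ, 0 ≤ C ∧ ∀ r : ℝ, 0 < r → r ≤ 1 → ∀ ξ, ‖kSym m ρ r ξ‖ ≤ C * r ^ (-(γ / p)) := by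
  obtain ⟨C, hC0, hC⟩ := h.exists_eSym_le hp (1 + ρ) hγ hργ
  refine ⟨2 * Real.pi * C, by positivity, fun r hr hr1 ξ => ?_⟩
  rw [kSym, norm_mul]
  have h1 := hC r hr hr1 ξ
  rw [norm_eSym, jb_add] at h1
  rw [norm_eSym]
  have h2 := mul_le_mul_of_nonneg_right (norm_dSym_le ξ)
    (mul_nonneg (jb_pos ρ ξ).le (norm_nonneg (Complex.exp (r * m ξ))))
  refine h2.trans ?_
  nlinarith [Real.pi_pos, mul_le_mul_of_nonneg_left h1 Real.pi_pos.le]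

theorem DissSymbol.exists_exp_le (h : DissSymbol m p) :
    ∃ C : ℝ, 0 ≤ C ∧ ∀ r : ℝ, 0 ≤ r → r ≤ 1 → ∀ ξ, ‖eSym m 0 r ξ‖ ≤ C := by
  obtain ⟨c, hc, M, hM, hm⟩ := h.re_le
  refine ⟨Real.exp M, by positivity, fun r hr hr1 ξ => ?_⟩
  rw [norm_eSym, jb_zero, one_mul, Complex.norm_exp]
  refine Real.exp_le_exp.2 ?_
  simp only [Complex.mul_re, Complex.ofReal_re, Complex.ofReal_im, zero_mul, sub_zero]
  have := mul_pos hc (jb_pos p ξ)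
  nlinarith [mul_le_mul_of_nonneg_left (hm ξ) hr, mul_le_mul_of_nonneg_right hr1 hM,
    mul_nonneg hr this.le]

theorem DissSymbol.isSymbol_eSym (h : DissSymbol m p) (hp : 0 < p) (ρ : ℝ) {r : ℝ} (hr : 0 < r)
    (hr1 : r ≤ 1) : IsSymbol (eSym m ρ r) := by
  obtain ⟨C, -, hC⟩ := h.exists_eSym_le hp ρ (abs_nonneg ρ) (le_abs_self ρ)
  exact ⟨h.measurable_eSym ρ r, _, hC r hr hr1⟩

theorem DissSymbol.isSymbol_exp (h : DissSymbol m p) {r : ℝ} (hr : 0 ≤ r)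
    (hr1 : r ≤ 1) : IsSymbol (eSym m 0 r) := by
  obtain ⟨C, -, hC⟩ := h.exists_exp_le
  exact ⟨h.measurable_eSym 0 r, _, hC r hr hr1⟩

theorem DissSymbol.isSymbol_kSym (h : DissSymbol m p) (hp : 0 < p) (ρ : ℝ) {r : ℝ} (hr : 0 < r)
    (hr1 : r ≤ 1) : IsSymbol (kSym m ρ r) := by
  obtain ⟨C, -, hC⟩ := h.exists_kSym_le hp ρ (abs_nonneg (1 + ρ)) (le_abs_self _)
  exact ⟨h.measurable_kSym ρ r, _, hC r hr hr1⟩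

theorem DissSymbol.exists_norm_semi_le (h : DissSymbol m p) (hp : 0 < p) (ρ : ℝ) {γ : ℝ}
    (hγ : 0 ≤ γ) (hργ : ρ ≤ γ) :
    ∃ C : ℝ, 0 ≤ C ∧ ∀ r : ℝ, 0 < r → r ≤ 1 → ∀ a, ‖semi m ρ r a‖ ≤ C * r ^ (-(γ / p)) * ‖a‖ := by
  obtain ⟨C, hC0, hC⟩ := h.exists_eSym_le hp ρ hγ hργ
  exact ⟨C, hC0, fun r hr hr1 a => norm_mulOp_apply_le (h.measurable_eSym ρ r) (hC r hr hr1) a⟩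

theorem DissSymbol.exists_norm_dsemi_le (h : DissSymbol m p) (hp : 0 < p) (ρ : ℝ) {γ : ℝ}
    (hγ : 0 ≤ γ) (hργ : 1 + ρ ≤ γ) :
    ∃ C : ℝ, 0 ≤ C ∧ ∀ r : ℝ, 0 < r → r ≤ 1 → ∀ a, ‖dsemi m ρ r a‖ ≤ C * r ^ (-(γ / p)) * ‖a‖ := by
  obtain ⟨C, hC0, hC⟩ := h.exists_kSym_le hp ρ hγ hργ
  exact ⟨C, hC0, fun r hr hr1 a => norm_mulOp_apply_le (h.measurable_kSym ρ r) (hC r hr hr1) a⟩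

theorem DissSymbol.exists_norm_exp_le (h : DissSymbol m p) :
    ∃ C : ℝ, 0 ≤ C ∧ ∀ r : ℝ, 0 ≤ r → r ≤ 1 → ∀ a, ‖semi m 0 r a‖ ≤ C * ‖a‖ := by
  obtain ⟨C, hC0, hC⟩ := h.exists_exp_le
  exact ⟨C, hC0, fun r hr hr1 a => norm_mulOp_apply_le (h.measurable_eSym 0 r) (hC r hr hr1) a⟩

theorem DissSymbol.semi_zero (a : L2R) : semi m 0 0 a = a := by
  have : eSym m 0 0 = fun _ => 1 := by
    ext ξ
    simp [eSym]
  rw [semi, this, mulOp_one]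

theorem DissSymbol.smoothing_semi (h : DissSymbol m p) (hp : 0 < p) {θ : ℝ} (hθ : 0 ≤ θ) (ρ : ℝ)
    {r : ℝ} (hr : 0 < r) (hr1 : r ≤ 1) (a : L2R) :
    smoothing θ (semi m ρ r a) = semi m (ρ - θ) r a := by
  rw [semi, smoothing, mulOp_mulOp (isSymbol_jb (by linarith)) (h.isSymbol_eSym hp ρ hr hr1), semi]
  congr 2
  ext ξ
  rw [eSym, eSym, sub_eq_add_neg, jb_add]
  push_cast
  ring

theorem DissSymbol.smoothing_dsemi (h : DissSymbol m p) (hp : 0 < p) {θ : ℝ} (hθ : 0 ≤ θ) (ρ : ℝ)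
    {r : ℝ} (hr : 0 < r) (hr1 : r ≤ 1) (a : L2R) :
    smoothing θ (dsemi m ρ r a) = dsemi m (ρ - θ) r a := by
  rw [dsemi, smoothing, mulOp_mulOp (isSymbol_jb (by linarith)) (h.isSymbol_kSym hp ρ hr hr1),
    dsemi]
  congr 2
  ext ξ
  rw [kSym, kSym, eSym, eSym, sub_eq_add_neg, jb_add]
  push_cast
  ring

theorem continuous_eSym_time (m : ℝ → ℂ) (ρ ξ : ℝ) : Continuous fun r => eSym m ρ r ξ := by
  unfold eSym
  fun_prop

/-- A uniformly bounded, strongly continuous family of operators acts jointly continuously. -/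
theorem continuous_apply_of_strong {A : ℝ → L2R →L[ℂ] L2R} {C : ℝ}
    (hC : ∀ r a, ‖A r a‖ ≤ C * ‖a‖) (hA : ∀ a, Continuous fun r => A r a) :
    Continuous fun x : ℝ × L2R => A x.1 x.2 := by
  rw [continuous_iff_continuousAt]
  rintro ⟨r₀, a₀⟩
  rw [ContinuousAt, tendsto_iff_norm_sub_tendsto_zero]
  have h1 : Tendsto (fun x : ℝ × L2R => C * ‖x.2 - a₀‖ + ‖A x.1 a₀ - A r₀ a₀‖) (𝓝 (r₀, a₀))
      (𝓝 (C * ‖a₀ - a₀‖ + ‖A r₀ a₀ - A r₀ a₀‖)) := by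
    have h2 : Continuous fun x : ℝ × L2R => C * ‖x.2 - a₀‖ + ‖A x.1 a₀ - A r₀ a₀‖ := by
      have := (hA a₀).comp (continuous_fst (X := ℝ) (Y := L2R))
      exact (continuous_const.mul (continuous_snd.sub continuous_const).norm).add
        (this.sub continuous_const).norm
    exact h2.tendsto (r₀, a₀)
  simp only [sub_self, norm_zero, mul_zero, add_zero] at h1
  refine squeeze_zero (fun _ => norm_nonneg _) (fun x => ?_) h1
  have : A x.1 x.2 - A r₀ a₀ = A x.1 (x.2 - a₀) + (A x.1 a₀ - A r₀ a₀) := by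
    rw [map_sub]; abel
  rw [this]
  exact (norm_add_le _ _).trans (by gcongr; exact hC _ _)

/-- Clamping of a time to `[ε, 1]`. -/
def clamp (ε r : ℝ) : ℝ := max ε (min r 1)

theorem continuous_clamp (ε : ℝ) : Continuous (clamp ε) := by unfold clamp; fun_prop

theorem le_clamp (ε r : ℝ) : ε ≤ clamp ε r := le_max_left _ _

theorem clamp_le_one {ε : ℝ} (hε : ε ≤ 1) (r : ℝ) : clamp ε r ≤ 1 :=
  max_le hε (min_le_right _ _)

theorem clamp_of_mem {ε r : ℝ} (h : ε ≤ r) (h1 : r ≤ 1) : clamp ε r = r := by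
  rw [clamp, min_eq_left h1, max_eq_right h]

theorem DissSymbol.continuous_dsemi_clamp (h : DissSymbol m p) (hp : 0 < p) (ρ : ℝ) {ε : ℝ}
    (hε : 0 < ε) (hε1 : ε ≤ 1) :
    Continuous fun x : ℝ × L2R => dsemi m ρ (clamp ε x.1) x.2 := by
  obtain ⟨C, hC0, hC⟩ := h.exists_kSym_le hp ρ (abs_nonneg (1 + ρ)) (le_abs_self _)
  have hb : ∀ r ξ, ‖kSym m ρ (clamp ε r) ξ‖ ≤ C * ε ^ (-(|1 + ρ| / p)) := fun r ξ => by
    refine (hC _ (hε.trans_le (le_clamp ε r)) (clamp_le_one hε1 r) ξ).trans ?_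
    refine mul_le_mul_of_nonneg_left ?_ hC0
    exact Real.rpow_le_rpow_of_nonpos hε (le_clamp ε r) (by
      have : 0 ≤ |1 + ρ| / p := by positivity
      linarith)
  refine continuous_apply_of_strong (A := fun r => dsemi m ρ (clamp ε r))
    (C := C * ε ^ (-(|1 + ρ| / p)))
    (fun r a => norm_mulOp_apply_le (h.measurable_kSym _ _) (hb r) a) fun a => ?_
  rw [continuous_iff_continuousAt]
  intro r₀
  refine tendsto_mulOp (Eventually.of_forall fun r => h.measurable_kSym _ _)
    (Eventually.of_forall hb) (h.measurable_kSym _ _) (hb r₀) (fun ξ => ?_) a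
  exact (continuous_const.mul
    ((continuous_eSym_time m ρ ξ).comp (continuous_clamp ε))).tendsto r₀

theorem DissSymbol.continuous_semi_clamp (h : DissSymbol m p) :
    Continuous fun x : ℝ × L2R => semi m 0 (clamp 0 x.1) x.2 := by
  obtain ⟨C, hC0, hC⟩ := h.exists_exp_le
  have hb : ∀ r ξ, ‖eSym m 0 (clamp 0 r) ξ‖ ≤ C := fun r ξ =>
    hC _ (le_clamp 0 r) (clamp_le_one zero_le_one r) ξ
  refine continuous_apply_of_strong (A := fun r => semi m 0 (clamp 0 r))
    (fun r a => norm_mulOp_apply_le (h.measurable_eSym _ _) (hb r) a) fun a => ?_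
  rw [continuous_iff_continuousAt]
  intro r₀
  refine tendsto_mulOp (Eventually.of_forall fun r => h.measurable_eSym _ _)
    (Eventually.of_forall hb) (h.measurable_eSym _ _) (hb r₀) (fun ξ => ?_) a
  exact ((continuous_eSym_time m 0 ξ).comp (continuous_clamp 0)).tendsto r₀

theorem DissSymbol.continuousOn_semi (h : DissSymbol m p) (a : L2R) :
    ContinuousOn (fun r => semi m 0 r a) (Icc 0 1) := by
  have h1 : Continuous fun r : ℝ => semi m 0 (clamp 0 r) a :=
    h.continuous_semi_clamp.comp (continuous_id.prodMk continuous_const)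
  refine h1.continuousOn.congr fun r hr => ?_
  simp only [clamp_of_mem hr.1 hr.2]

/-! ### The Duhamel integral -/

/-- The kernel `(t - τ)^(-γ) + τ^(-γ)`, which dominates all products of powers of `t - τ` and `τ`
below. -/
def ker (γ t τ : ℝ) : ℝ := (t - τ) ^ (-γ) + τ ^ (-γ)

theorem intervalIntegrable_ker {γ : ℝ} (hγ : γ < 1) (t : ℝ) :
    IntervalIntegrable (ker γ t) volume 0 t := by
  have h1 : IntervalIntegrable (fun τ : ℝ => τ ^ (-γ)) volume 0 t :=
    intervalIntegral.intervalIntegrable_rpow' (by linarith)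
  have h2 := (h1.comp_sub_left t).symm
  simp only [sub_zero, sub_self] at h2
  exact h2.add h1

theorem integral_ker {γ : ℝ} (hγ : γ < 1) (t : ℝ) :
    ∫ τ in (0 : ℝ)..t, ker γ t τ = 2 * t ^ (1 - γ) / (1 - γ) := by
  have h1 : IntervalIntegrable (fun τ : ℝ => τ ^ (-γ)) volume 0 t :=
    intervalIntegral.intervalIntegrable_rpow' (by linarith)
  have h2 := (h1.comp_sub_left t).symm
  simp only [sub_zero, sub_self] at h2
  have h3 : ∫ τ in (0 : ℝ)..t, τ ^ (-γ) = t ^ (1 - γ) / (1 - γ) := by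
    rw [integral_rpow (Or.inl (by linarith)), Real.zero_rpow (by linarith), sub_zero,
      show -γ + 1 = 1 - γ by ring]
  have h4 := intervalIntegral.integral_comp_sub_left (a := 0) (b := t)
    (fun τ : ℝ => τ ^ (-γ)) t
  simp only [sub_zero, sub_self] at h4
  have h5 : ∫ τ in (0 : ℝ)..t, ker γ t τ =
      (∫ τ in (0 : ℝ)..t, (t - τ) ^ (-γ)) + ∫ τ in (0 : ℝ)..t, τ ^ (-γ) :=
    intervalIntegral.integral_add h2 h1
  rw [h5, h4, h3]
  ring

theorem rpow_mul_rpow_le_ker {a b γ t τ : ℝ} (ha : 0 ≤ a) (hb : 0 ≤ b) (hγ : a + b ≤ γ)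
    (hτ : 0 < τ) (hτt : τ < t) (ht : t ≤ 1) :
    (t - τ) ^ (-a) * τ ^ (-b) ≤ ker γ t τ := by
  have hr : 0 < t - τ := by linarith
  have h0 : 0 ≤ (t - τ) ^ (-γ) := by positivity
  have h0' : 0 ≤ τ ^ (-γ) := by positivity
  unfold ker
  rcases le_total τ (t - τ) with hle | hle
  · have h1 : (t - τ) ^ (-a) ≤ τ ^ (-a) := Real.rpow_le_rpow_of_nonpos hτ hle (by linarith)
    calc (t - τ) ^ (-a) * τ ^ (-b) ≤ τ ^ (-a) * τ ^ (-b) := by gcongr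
      _ = τ ^ (-a + -b) := (Real.rpow_add hτ _ _).symm
      _ ≤ τ ^ (-γ) := Real.rpow_le_rpow_of_exponent_ge hτ (by linarith) (by linarith)
      _ ≤ _ := by linarith
  · have h1 : τ ^ (-b) ≤ (t - τ) ^ (-b) := Real.rpow_le_rpow_of_nonpos hr hle (by linarith)
    calc (t - τ) ^ (-a) * τ ^ (-b) ≤ (t - τ) ^ (-a) * (t - τ) ^ (-b) := by gcongr
      _ = (t - τ) ^ (-a + -b) := (Real.rpow_add hr _ _).symm
      _ ≤ (t - τ) ^ (-γ) := Real.rpow_le_rpow_of_exponent_ge hr (by linarith) (by linarith)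
      _ ≤ _ := by linarith

/-- A measurable forcing on `(0, T]` which is `O(τ^(-b))`. -/
structure Forcing (T b A : ℝ) (g : ℝ → L2R) : Prop where
  meas : AEStronglyMeasurable g (volume.restrict (Ioc 0 T))
  le : ∀ τ ∈ Ioc 0 T, ‖g τ‖ ≤ A * τ ^ (-b)

/-- The Duhamel integral `∫₀ᵗ (1 + ξ²)^(ρ/2) (2πiξ) e^{(t-τ) m(ξ)} g(τ) dτ` on the Fourier side. The
real number `ρ`, of either sign, is the difference of the Sobolev exponents of the result and of
`g`. -/
def duhamel (m : ℝ → ℂ) (ρ : ℝ) (g : ℝ → L2R) (t : ℝ) : L2R :=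
  ∫ τ in (0 : ℝ)..t, dsemi m ρ (t - τ) (g τ)

variable {T b A : ℝ} {g : ℝ → L2R}

theorem Forcing.mono {T' : ℝ} (hg : Forcing T b A g) (h : T' ≤ T) : Forcing T' b A g :=
  ⟨hg.meas.mono_measure (Measure.restrict_mono (Ioc_subset_Ioc_right h) le_rfl),
    fun τ hτ => hg.le τ ⟨hτ.1, hτ.2.trans h⟩⟩

theorem Forcing.intervalIntegrable (hg : Forcing T b A g) (hT : 0 ≤ T) (hb : b < 1) :
    IntervalIntegrable g volume 0 T := by
  rw [intervalIntegrable_iff_integrableOn_Ioc_of_le hT]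
  have h1 : IntegrableOn (fun τ : ℝ => A * τ ^ (-b)) (Ioc 0 T) := by
    rw [← intervalIntegrable_iff_integrableOn_Ioc_of_le hT]
    exact (intervalIntegral.intervalIntegrable_rpow' (by linarith)).const_mul A
  refine Integrable.mono' h1 hg.meas ?_
  exact (ae_restrict_iff' measurableSet_Ioc).2 (ae_of_all _ hg.le)

theorem DissSymbol.aestronglyMeasurable_dsemi_clamp (h : DissSymbol m p) (hp : 0 < p) (ρ : ℝ)
    (hg : Forcing T b A g) {ε : ℝ} (hε : 0 < ε) (hε1 : ε ≤ 1) (t : ℝ) :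
    AEStronglyMeasurable (fun τ => dsemi m ρ (clamp ε (t - τ)) (g τ))
      (volume.restrict (Ioc 0 T)) := by
  have h1 : AEStronglyMeasurable (fun τ : ℝ => t - τ) (volume.restrict (Ioc 0 T)) := by fun_prop
  exact Continuous.comp_aestronglyMeasurable (f := fun τ => (t - τ, g τ))
    (h.continuous_dsemi_clamp hp ρ hε hε1) (h1.prodMk hg.meas)

theorem DissSymbol.aestronglyMeasurable_dsemi (h : DissSymbol m p) (hp : 0 < p) (ρ : ℝ)
    {t : ℝ} (hg : Forcing t b A g) (ht : t ≤ 1) :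
    AEStronglyMeasurable (fun τ => dsemi m ρ (t - τ) (g τ)) (volume.restrict (Ioc 0 t)) := by
  have hlim : Tendsto (fun n : ℕ => 1 / ((n : ℝ) + 1)) atTop (𝓝 0) :=
    tendsto_one_div_add_atTop_nhds_zero_nat
  refine aestronglyMeasurable_of_tendsto_ae (u := atTop)
    (f := fun (n : ℕ) τ => dsemi m ρ (clamp (1 / ((n : ℝ) + 1)) (t - τ)) (g τ))
    (fun n => h.aestronglyMeasurable_dsemi_clamp hp ρ hg (by positivity) (by
      rw [div_le_one (by positivity)]
      linarith [Nat.cast_nonneg (α := ℝ) n]) t) ?_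
  have hne : ∀ᵐ τ ∂(volume.restrict (Ioc 0 t)), τ ≠ t :=
    ae_restrict_of_ae (Measure.ae_ne volume t)
  filter_upwards [hne, ae_restrict_mem measurableSet_Ioc] with τ h1 h2
  have hr : 0 < t - τ := sub_pos.2 (lt_of_le_of_ne h2.2 h1)
  refine Tendsto.congr' ?_ tendsto_const_nhds
  filter_upwards [hlim.eventually (eventually_lt_nhds hr)] with n hn
  rw [clamp_of_mem hn.le (by linarith [h2.1])]

/-- Integrability of the Duhamel integrand, together with the resulting bound. -/
theorem DissSymbol.intervalIntegrable_duhamel (h : DissSymbol m p) (hp : 0 < p) {ρ t : ℝ}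
    (hg : Forcing t b A g) (ht0 : 0 ≤ t) (ht : t ≤ 1) {γ D : ℝ} (hγ : γ < 1)
    (hD : ∀ τ, 0 < τ → τ < t → ‖dsemi m ρ (t - τ) (g τ)‖ ≤ D * ker γ t τ) :
    IntervalIntegrable (fun τ => dsemi m ρ (t - τ) (g τ)) volume 0 t ∧
    ‖duhamel m ρ g t‖ ≤ D * (2 * t ^ (1 - γ) / (1 - γ)) := by
  have hk := (intervalIntegrable_ker hγ t).const_mul D
  have hne : ∀ᵐ τ ∂(volume.restrict (Ioc 0 t)), τ ≠ t :=
    ae_restrict_of_ae (Measure.ae_ne volume t)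
  have hle : ∀ᵐ τ ∂(volume.restrict (Ioc 0 t)), ‖dsemi m ρ (t - τ) (g τ)‖ ≤ D * ker γ t τ := by
    filter_upwards [hne, ae_restrict_mem measurableSet_Ioc] with τ h1 h2
    exact hD τ h2.1 (lt_of_le_of_ne h2.2 h1)
  constructor
  · rw [intervalIntegrable_iff_integrableOn_Ioc_of_le ht0] at hk ⊢
    exact Integrable.mono' hk (h.aestronglyMeasurable_dsemi hp ρ hg ht) hle
  · rw [← integral_ker hγ, ← intervalIntegral.integral_const_mul]
    refine intervalIntegral.norm_integral_le_of_norm_le ht0 ?_ hk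
    exact (ae_restrict_iff' measurableSet_Ioc).1 hle

theorem DissSymbol.exists_dsemi_forcing_le (h : DissSymbol m p) (hp : 0 < p) {ρ γ' : ℝ}
    (hγ' : 0 ≤ γ') (hργ : 1 + ρ ≤ γ') (hb : 0 ≤ b) {γ : ℝ}
    (hγb : γ' / p + b ≤ γ) :
    ∃ C, 0 ≤ C ∧ ∀ {t A : ℝ} {g : ℝ → L2R}, 0 ≤ A → t ≤ 1 → Forcing t b A g →
      ∀ τ, 0 < τ → τ < t → ‖dsemi m ρ (t - τ) (g τ)‖ ≤ C * A * ker γ t τ := by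
  obtain ⟨C, hC0, hC⟩ := h.exists_norm_dsemi_le hp ρ hγ' hργ
  refine ⟨C, hC0, fun {t A g} hA ht hg τ hτ hτt => ?_⟩
  have hr : 0 < t - τ := by linarith
  have h1 := hC (t - τ) hr (by linarith) (g τ)
  have h2 := hg.le τ ⟨hτ, hτt.le⟩
  have h3 := rpow_mul_rpow_le_ker (a := γ' / p) (by positivity) hb hγb hτ hτt ht
  calc ‖dsemi m ρ (t - τ) (g τ)‖ ≤ C * (t - τ) ^ (-(γ' / p)) * ‖g τ‖ := h1
    _ ≤ C * (t - τ) ^ (-(γ' / p)) * (A * τ ^ (-b)) := by gcongr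
    _ = C * A * ((t - τ) ^ (-(γ' / p)) * τ ^ (-b)) := by ring
    _ ≤ C * A * ker γ t τ := by gcongr

theorem DissSymbol.smoothing_duhamel (h : DissSymbol m p) (hp : 0 < p) {ρ θ t : ℝ} (hθ : 0 ≤ θ)
    (ht0 : 0 ≤ t) (ht : t ≤ 1)
    (hi : IntervalIntegrable (fun τ => dsemi m ρ (t - τ) (g τ)) volume 0 t) :
    smoothing θ (duhamel m ρ g t) = duhamel m (ρ - θ) g t := by
  rw [duhamel, ← ContinuousLinearMap.intervalIntegral_comp_comm _ hi, duhamel]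
  refine intervalIntegral.integral_congr_ae ?_
  filter_upwards [Measure.ae_ne volume t] with τ h1 h2
  rw [uIoc_of_le ht0] at h2
  have hr : 0 < t - τ := sub_pos.2 (lt_of_le_of_ne h2.2 h1)
  exact h.smoothing_dsemi hp hθ ρ hr (by linarith [h2.1]) _

/-- The Duhamel integral is continuous: it is the uniform limit of the integrals in which the
semigroup is frozen at times below `ε`, and these are continuous by dominated convergence. -/
theorem DissSymbol.continuousOn_duhamel (h : DissSymbol m p) (hp : 0 < p) {ρ γ' : ℝ}
    (hg : Forcing T b A g) (hT : T ≤ 1) (hA : 0 ≤ A) (hγ' : 0 ≤ γ') (hργ : 1 + ρ ≤ γ')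
    (hb : 0 ≤ b) (hγb : γ' / p + b < 1) : ContinuousOn (duhamel m ρ g) (Icc 0 T) := by
  obtain ⟨C, hC0, hC⟩ := h.exists_norm_dsemi_le hp ρ hγ' hργ
  set a := γ' / p with ha
  have ha0 : 0 ≤ a := by positivity
  obtain ⟨δ, hδ0, hδ⟩ : ∃ δ > 0, a + δ + b < 1 := ⟨(1 - a - b) / 2, by linarith, by linarith⟩
  set γ := a + δ + b with hγ
  have hunif : TendstoUniformlyOn
      (fun ε t => ∫ τ in (0 : ℝ)..t, dsemi m ρ (clamp ε (t - τ)) (g τ)) (duhamel m ρ g)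
      (𝓝[>] (0 : ℝ)) (Icc 0 T) := by
    rw [Metric.tendstoUniformlyOn_iff]
    intro e he
    have hlim : Tendsto (fun ε : ℝ => 2 * C * A * ε ^ δ * (2 / (1 - γ))) (𝓝[>] 0) (𝓝 0) := by
      have h1 : Tendsto (fun ε : ℝ => ε ^ δ) (𝓝[>] 0) (𝓝 0) := by
        have := (Real.continuousAt_rpow_const 0 δ (Or.inr hδ0.le)).tendsto
        rw [Real.zero_rpow hδ0.ne'] at this
        exact this.mono_left nhdsWithin_le_nhds
      have h2 := (h1.const_mul (2 * C * A)).mul_const (2 / (1 - γ))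
      simpa using h2
    filter_upwards [hlim.eventually (eventually_lt_nhds he), self_mem_nhdsWithin,
      Ioc_mem_nhdsGT (zero_lt_one' ℝ)] with ε hε hε0 hε1 t ht
    have hε0 : 0 < ε := hε0
    have hgt := hg.mono ht.2
    have htle : t ≤ 1 := ht.2.trans hT
    have hpt : ∀ τ, 0 < τ → τ < t →
        ‖dsemi m ρ (t - τ) (g τ) - dsemi m ρ (clamp ε (t - τ)) (g τ)‖ ≤
          2 * C * A * ε ^ δ * ker γ t τ := by
      intro τ hτ hτt
      have hr : 0 < t - τ := by linarith
      have hk : 0 ≤ ker γ t τ := by unfold ker; positivity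
      rcases le_or_gt ε (t - τ) with hle | hlt
      · rw [clamp_of_mem hle (by linarith), sub_self, norm_zero]
        positivity
      · have hcl : clamp ε (t - τ) = ε := by
          rw [clamp, max_eq_left]
          exact (min_le_left _ _).trans hlt.le
        rw [hcl]
        have h1 := hC (t - τ) hr (by linarith) (g τ)
        have h2 := hC ε hε0 hε1.2 (g τ)
        have h3 := hgt.le τ ⟨hτ, hτt.le⟩
        have h4 : ε ^ (-a) ≤ (t - τ) ^ (-a) :=
          Real.rpow_le_rpow_of_nonpos hr hlt.le (by linarith)
        have h5 : (t - τ) ^ (-a) ≤ ε ^ δ * (t - τ) ^ (-(a + δ)) := by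
          have h6 : (t - τ) ^ δ ≤ ε ^ δ := Real.rpow_le_rpow hr.le hlt.le hδ0.le
          calc (t - τ) ^ (-a) = (t - τ) ^ δ * (t - τ) ^ (-(a + δ)) := by
                rw [← Real.rpow_add hr]
                ring_nf
            _ ≤ _ := by gcongr
        have h7 := rpow_mul_rpow_le_ker (a := a + δ) (γ := γ) (by positivity) hb le_rfl hτ hτt htle
        calc ‖dsemi m ρ (t - τ) (g τ) - dsemi m ρ ε (g τ)‖
            ≤ C * (t - τ) ^ (-a) * ‖g τ‖ + C * ε ^ (-a) * ‖g τ‖ :=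
              (norm_sub_le _ _).trans (add_le_add h1 h2)
          _ ≤ C * (t - τ) ^ (-a) * ‖g τ‖ + C * (t - τ) ^ (-a) * ‖g τ‖ := by gcongr
          _ = 2 * C * ((t - τ) ^ (-a) * ‖g τ‖) := by ring
          _ ≤ 2 * C * (ε ^ δ * (t - τ) ^ (-(a + δ)) * (A * τ ^ (-b))) := by gcongr
          _ = 2 * C * A * ε ^ δ * ((t - τ) ^ (-(a + δ)) * τ ^ (-b)) := by ring
          _ ≤ _ := by gcongr
    have hi1 : IntervalIntegrable (fun τ => dsemi m ρ (t - τ) (g τ)) volume 0 t := by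
      refine (h.intervalIntegrable_duhamel hp hgt ht.1 htle (γ := a + b) (D := C * A) hγb
        fun τ hτ hτt => ?_).1
      have hr : 0 < t - τ := by linarith
      have h1 := hC (t - τ) hr (by linarith) (g τ)
      have h3 := hgt.le τ ⟨hτ, hτt.le⟩
      have h7 := rpow_mul_rpow_le_ker ha0 hb le_rfl hτ hτt htle
      calc _ ≤ C * (t - τ) ^ (-a) * ‖g τ‖ := h1
        _ ≤ C * (t - τ) ^ (-a) * (A * τ ^ (-b)) := by gcongr
        _ = C * A * ((t - τ) ^ (-a) * τ ^ (-b)) := by ring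
        _ ≤ _ := by gcongr
    have hk := (intervalIntegrable_ker hδ t).const_mul (2 * C * A * ε ^ δ)
    have hle : ∀ᵐ τ ∂(volume.restrict (Ioc 0 t)),
        ‖dsemi m ρ (t - τ) (g τ) - dsemi m ρ (clamp ε (t - τ)) (g τ)‖ ≤
          2 * C * A * ε ^ δ * ker γ t τ := by
      filter_upwards [ae_restrict_of_ae (Measure.ae_ne volume t),
        ae_restrict_mem measurableSet_Ioc] with τ h1 h2
      exact hpt τ h2.1 (lt_of_le_of_ne h2.2 h1)
    have hmeas := (h.aestronglyMeasurable_dsemi hp ρ hgt htle).sub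
      (h.aestronglyMeasurable_dsemi_clamp hp ρ hgt hε0 hε1.2 t)
    have hi3 : IntervalIntegrable (fun τ => dsemi m ρ (t - τ) (g τ) -
        dsemi m ρ (clamp ε (t - τ)) (g τ)) volume 0 t := by
      rw [intervalIntegrable_iff_integrableOn_Ioc_of_le ht.1] at hk ⊢
      exact Integrable.mono' hk hmeas hle
    have hi2 : IntervalIntegrable (fun τ => dsemi m ρ (clamp ε (t - τ)) (g τ)) volume 0 t := by
      refine (hi1.sub hi3).congr fun τ _ => ?_
      simp
    rw [dist_eq_norm, duhamel, ← intervalIntegral.integral_sub hi1 hi2]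
    have h8 := intervalIntegral.norm_integral_le_of_norm_le ht.1
      ((ae_restrict_iff' measurableSet_Ioc).1 hle) hk
    rw [intervalIntegral.integral_const_mul, integral_ker hδ] at h8
    refine h8.trans_lt (lt_of_le_of_lt ?_ hε)
    have h9 : t ^ (1 - γ) ≤ 1 := Real.rpow_le_one ht.1 htle (by linarith)
    have h10 : 0 < 1 - γ := by linarith
    refine mul_le_mul_of_nonneg_left ?_ (by positivity)
    rw [div_le_div_iff_of_pos_right h10]
    linarith
  refine hunif.continuousOn (Eventually.frequently ?_)
  filter_upwards [Ioc_mem_nhdsGT (zero_lt_one' ℝ)] with ε hε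
  -- On `[0, T]` the integral over `[0, t]` is the integral over `[0, T]` with a cut-off.
  have hcont : ContinuousOn (fun t => ∫ τ in Ioc 0 T,
      (Iic t).indicator (fun τ => dsemi m ρ (clamp ε (t - τ)) (g τ)) τ) (Icc 0 T) := by
    intro t₀ ht₀
    have hbd : IntegrableOn (fun τ : ℝ => C * ε ^ (-a) * (A * τ ^ (-b))) (Ioc 0 T) := by
      rw [← intervalIntegrable_iff_integrableOn_Ioc_of_le (ht₀.1.trans ht₀.2)]
      exact ((intervalIntegral.intervalIntegrable_rpow' (by linarith)).const_mul A).const_mul _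
    refine continuousWithinAt_of_dominated (bound := fun τ => C * ε ^ (-a) * (A * τ ^ (-b)))
      ?_ ?_ hbd ?_
    · exact Eventually.of_forall fun t =>
        (h.aestronglyMeasurable_dsemi_clamp hp ρ hg hε.1 hε.2 t).indicator measurableSet_Iic
    · refine Eventually.of_forall fun t => ?_
      filter_upwards [ae_restrict_mem measurableSet_Ioc] with τ hτ
      refine (norm_indicator_le_norm_self _ _).trans ?_
      have h1 := hC (clamp ε (t - τ)) (hε.1.trans_le (le_clamp _ _)) (clamp_le_one hε.2 _) (g τ)
      have h2 := hg.le τ hτ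
      have h3 : clamp ε (t - τ) ^ (-a) ≤ ε ^ (-a) :=
        Real.rpow_le_rpow_of_nonpos hε.1 (le_clamp _ _) (by linarith)
      have h4 : 0 ≤ ε ^ (-a) := Real.rpow_nonneg hε.1.le _
      refine h1.trans ?_
      gcongr
    · filter_upwards [ae_restrict_of_ae (Measure.ae_ne volume t₀)] with τ hτ
      refine ContinuousAt.continuousWithinAt ?_
      have hc : Continuous fun t : ℝ => dsemi m ρ (clamp ε (t - τ)) (g τ) :=
        Continuous.comp (f := fun t : ℝ => (t - τ, g τ))
          (h.continuous_dsemi_clamp hp ρ hε.1 hε.2)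
          ((continuous_id.sub continuous_const).prodMk continuous_const)
      rcases lt_or_gt_of_ne hτ with hlt | hgt
      · refine hc.continuousAt.congr ?_
        filter_upwards [eventually_gt_nhds hlt] with t ht
        rw [indicator_of_mem (show τ ∈ Iic t from ht.le)]
      · refine (continuousAt_const (y := (0 : L2R))).congr ?_
        filter_upwards [eventually_lt_nhds hgt] with t ht
        rw [indicator_of_notMem (show τ ∉ Iic t from not_le.2 ht)]
  refine hcont.congr fun t ht => ?_
  simp only
  rw [setIntegral_indicator measurableSet_Iic, Ioc_inter_Iic, min_eq_right ht.2,
    intervalIntegral.integral_of_le ht.1]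

end

/-! ### Test vectors -/

section

/-- A measurable function bounded by a power of `1 + ξ²`. -/
structure PolyGrowth (h : ℝ → ℂ) : Prop where
  meas : Measurable h
  bdd : ∃ C N, ∀ ξ, ‖h ξ‖ ≤ C * jb N ξ

theorem PolyGrowth.mul {h h' : ℝ → ℂ} (H : PolyGrowth h) (H' : PolyGrowth h') :
    PolyGrowth fun ξ => h ξ * h' ξ := by
  obtain ⟨C, N, hC⟩ := H.bdd
  obtain ⟨C', N', hC'⟩ := H'.bdd
  refine ⟨H.meas.mul H'.meas, C * C', N + N', fun ξ => ?_⟩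
  rw [norm_mul, jb_add]
  calc ‖h ξ‖ * ‖h' ξ‖ ≤ (C * jb N ξ) * (C' * jb N' ξ) :=
        mul_le_mul (hC ξ) (hC' ξ) (norm_nonneg _) ((norm_nonneg _).trans (hC ξ))
    _ = _ := by ring

theorem polyGrowth_jb (r : ℝ) : PolyGrowth fun ξ => (jb r ξ : ℂ) := by
  refine ⟨by fun_prop, 1, r, fun ξ => ?_⟩
  rw [Complex.norm_real, Real.norm_of_nonneg (jb_pos _ _).le, one_mul]

theorem polyGrowth_dSym : PolyGrowth dSym := ⟨measurable_dSym, _, 1, norm_dSym_le⟩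

theorem DissSymbol.polyGrowth {m : ℝ → ℂ} {p : ℝ} (h : DissSymbol m p) : PolyGrowth m :=
  ⟨h.meas, h.growth⟩

theorem exists_schwartz_le_jb (φ : 𝓢(ℝ, ℂ)) (N : ℝ) : ∃ C, 0 ≤ C ∧ ∀ ξ, ‖φ ξ‖ ≤ C * jb N ξ := by
  obtain ⟨n, hn⟩ := exists_nat_ge (-N)
  obtain ⟨C₀, h₀⟩ := φ.decay 0 0
  obtain ⟨C₁, h₁⟩ := φ.decay (2 * n) 0
  have hC₀ : 0 ≤ C₀ := le_trans (by positivity) (h₀.2 0)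
  have hC₁ : 0 ≤ C₁ := le_trans (by positivity) (h₁.2 0)
  refine ⟨2 ^ n * (C₀ + C₁), by positivity, fun ξ => ?_⟩
  have h2 := h₀.2 ξ
  have h3 := h₁.2 ξ
  simp only [pow_zero, one_mul, norm_iteratedFDeriv_zero] at h2 h3
  have h4 : jb (2 * n) ξ ≤ 2 ^ n * (1 + |ξ| ^ (2 * n)) := by
    have h5 : jb (2 * n) ξ = (1 + ξ ^ 2) ^ n := by
      rw [jb, mul_div_cancel_left₀ _ two_ne_zero, Real.rpow_natCast]
    rw [h5]
    refine (add_pow_le zero_le_one (sq_nonneg ξ) n).trans ?_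
    rw [one_pow, ← pow_mul, pow_mul |ξ|, sq_abs, ← pow_mul]
    have : (0 : ℝ) ≤ 1 + ξ ^ (2 * n) := by
      rw [pow_mul]; positivity
    gcongr
    · norm_num
    · exact Nat.sub_le n 1
  have h6 : ‖φ ξ‖ * jb (2 * n) ξ ≤ 2 ^ n * (C₀ + C₁) := by
    calc ‖φ ξ‖ * jb (2 * n) ξ ≤ ‖φ ξ‖ * (2 ^ n * (1 + |ξ| ^ (2 * n))) := by gcongr
      _ = 2 ^ n * (‖φ ξ‖ + |ξ| ^ (2 * n) * ‖φ ξ‖) := by ring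
      _ ≤ _ := by
        rw [Real.norm_eq_abs] at h3
        gcongr
  have h7 : jb (-(2 * n)) ξ ≤ jb N ξ := jb_mono (by
    have : (0 : ℝ) ≤ n := Nat.cast_nonneg n
    linarith) ξ
  calc ‖φ ξ‖ = ‖φ ξ‖ * jb (2 * n) ξ * jb (-(2 * n)) ξ := by rw [mul_assoc, jb_mul_neg, mul_one]
    _ ≤ 2 ^ n * (C₀ + C₁) * jb (-(2 * n)) ξ := by
      gcongr
      exact (jb_pos _ _).le
    _ ≤ _ := by gcongr

theorem PolyGrowth.memLp {h : ℝ → ℂ} (H : PolyGrowth h) (φ : 𝓢(ℝ, ℂ)) :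
    MemLp (fun ξ => h ξ * φ ξ) 2 (volume : Measure ℝ) := by
  obtain ⟨C, N, hC⟩ := H.bdd
  obtain ⟨C', hC'0, hC'⟩ := exists_schwartz_le_jb φ (-N - 1)
  refine ((memLp_jb (r := -1) (by norm_num)).const_mul (C * C')).mono'
    (H.meas.aestronglyMeasurable.mul φ.continuous.aestronglyMeasurable) (ae_of_all _ fun ξ => ?_)
  rw [norm_mul]
  calc ‖h ξ‖ * ‖φ ξ‖ ≤ (C * jb N ξ) * (C' * jb (-N - 1) ξ) :=
        mul_le_mul (hC ξ) (hC' ξ) (norm_nonneg _) ((norm_nonneg _).trans (hC ξ))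
    _ = C * C' * (jb N ξ * jb (-N) ξ * jb (-1) ξ) := by
        rw [sub_eq_add_neg, jb_add (-N)]; ring
    _ = _ := by rw [jb_mul_neg, one_mul]

theorem PolyGrowth.locallyIntegrable_mul {h : ℝ → ℂ} (H : PolyGrowth h) (a : L2R) :
    LocallyIntegrable (fun ξ => a ξ * h ξ) volume := by
  intro x
  obtain ⟨C, M, hC⟩ := H.bdd
  obtain ⟨s, hs, hsi⟩ := (Lp.memLp a).locallyIntegrable (by norm_num) x
  refine ⟨s ∩ Metric.ball x 1, inter_mem hs (Metric.ball_mem_nhds x one_pos), ?_⟩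
  have h2 : IntegrableOn (fun ξ => a ξ) (s ∩ Metric.ball x 1) := hsi.mono_set inter_subset_left
  refine Integrable.mono' (h2.norm.const_mul (|C| * jb |M| (|x| + 1)))
    (h2.aestronglyMeasurable.mul H.meas.aestronglyMeasurable) ?_
  refine (ae_restrict_of_ae_restrict_of_subset (s := s ∩ Metric.ball x 1)
    (t := Metric.ball x 1) inter_subset_right ?_)
  filter_upwards [ae_restrict_mem Metric.isOpen_ball.measurableSet] with ξ hξ
  rw [norm_mul, mul_comm]
  refine mul_le_mul_of_nonneg_right ?_ (norm_nonneg _)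
  refine (hC ξ).trans ?_
  rw [Metric.mem_ball, Real.dist_eq] at hξ
  have h5 : |ξ| ≤ |x| + 1 := by
    have := abs_sub_abs_le_abs_sub ξ x
    linarith
  have h1 : jb M ξ ≤ jb |M| (|x| + 1) := by
    refine (jb_mono (le_abs_self M) ξ).trans ?_
    unfold jb
    have h2 : ξ ^ 2 ≤ (|x| + 1) ^ 2 := by
      rw [← sq_abs ξ]
      gcongr
    gcongr
  have h3 := le_abs_self C
  have h4 := (jb_pos M ξ).le
  gcongr

open Classical in
/-- The element `h φ` of `L²`, for a Schwartz function `φ` and a function `h` of polynomial growth;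
zero for other `h`. -/
def testVec (h : ℝ → ℂ) (φ : 𝓢(ℝ, ℂ)) : L2R :=
  if H : PolyGrowth h then (H.memLp φ).toLp _ else 0

theorem PolyGrowth.coeFn_testVec {h : ℝ → ℂ} (H : PolyGrowth h) (φ : 𝓢(ℝ, ℂ)) :
    testVec h φ =ᵐ[volume] fun ξ => h ξ * φ ξ := by
  rw [testVec, dif_pos H]
  exact (H.memLp φ).coeFn_toLp

theorem PolyGrowth.pair_testVec {h : ℝ → ℂ} (H : PolyGrowth h) (φ : 𝓢(ℝ, ℂ)) (a : L2R) :
    pair a (testVec h φ) = ∫ ξ, a ξ * (h ξ * φ ξ) := by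
  rw [pair_apply]
  refine integral_congr_ae ?_
  filter_upwards [H.coeFn_testVec φ] with ξ hξ
  rw [hξ]

/-! ### Differentiating the semigroup -/

theorem norm_exp_sub_one_le_of_re (z : ℂ) :
    ‖Complex.exp z - 1‖ ≤ Real.exp (max z.re 0) * ‖z‖ := by
  have hconv : Convex ℝ {w : ℂ | w.re ≤ max z.re 0} :=
    (convex_Iic (max z.re 0)).is_linear_preimage Complex.reLm.isLinear
  have h := hconv.norm_image_sub_le_of_norm_deriv_le (f := Complex.exp)
    (C := Real.exp (max z.re 0)) (x := 0) (y := z) (fun w _ => Complex.differentiableAt_exp)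
    (fun w hw => by
      rw [Complex.deriv_exp, Complex.norm_exp]
      exact Real.exp_le_exp.2 hw)
    (by simp) (by simp)
  simpa using h

theorem norm_dslope_exp_le (z : ℂ) : ‖dslope Complex.exp 0 z‖ ≤ Real.exp (max z.re 0) := by
  rcases eq_or_ne z 0 with rfl | hz
  · simp [Complex.deriv_exp]
  · rw [dslope_of_ne _ hz, slope_def_field, Complex.exp_zero, sub_zero, norm_div,
      div_le_iff₀ (norm_pos_iff.2 hz)]
    exact norm_exp_sub_one_le_of_re z

theorem continuous_dslope_exp : Continuous (dslope Complex.exp 0) := by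
  rw [← continuousOn_univ, continuousOn_dslope univ_mem]
  exact ⟨Complex.continuous_exp.continuousOn, Complex.differentiableAt_exp⟩

variable {m : ℝ → ℂ} {p : ℝ}

theorem DissSymbol.hasDerivWithinAt_semi (h : DissSymbol m p) {a b : L2R}
    (hab : b =ᵐ[volume] fun ξ => m ξ * a ξ) {r : ℝ} (hr : r ∈ Ico (0 : ℝ) 1) :
    HasDerivWithinAt (fun r => semi m 0 r a) (semi m 0 r b) (Ioi r) r := by
  obtain ⟨C, hC0, hC⟩ := h.exists_exp_le
  obtain ⟨c, hc, M, hM, hm⟩ := h.re_le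
  rw [hasDerivWithinAt_iff_tendsto_slope' self_notMem_Ioi]
  set φ : ℝ → ℝ → ℂ := fun x ξ =>
    eSym m 0 r ξ * dslope Complex.exp 0 (((x - r : ℝ) : ℂ) * m ξ) with hφ
  have hmeas : ∀ x, Measurable (φ x) := fun x =>
    (h.measurable_eSym 0 r).mul (continuous_dslope_exp.measurable.comp
      (measurable_const.mul h.meas))
  have hbd : ∀ x, r < x → x ≤ 1 → ∀ ξ, ‖φ x ξ‖ ≤ C * Real.exp M := fun x hx hx1 ξ => by
    rw [hφ, norm_mul]
    refine mul_le_mul (hC r hr.1 hr.2.le ξ) ?_ (norm_nonneg _) hC0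
    refine (norm_dslope_exp_le _).trans (Real.exp_le_exp.2 (max_le ?_ hM))
    rw [Complex.re_ofReal_mul]
    have h1 := mul_le_mul_of_nonneg_left (hm ξ) (sub_pos.2 hx).le
    have h2 := mul_nonneg (sub_pos.2 hx).le (mul_pos hc (jb_pos p ξ)).le
    nlinarith [mul_le_mul_of_nonneg_right (show x - r ≤ 1 by linarith [hr.1]) hM]
  have hbd₀ : ∀ ξ, ‖eSym m 0 r ξ‖ ≤ C * Real.exp M := fun ξ =>
    (hC r hr.1 hr.2.le ξ).trans (le_mul_of_one_le_right hC0 (Real.one_le_exp hM))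
  have hmem : Ioc r 1 ∈ 𝓝[>] r := Ioc_mem_nhdsGT hr.2
  have hlim := tendsto_mulOp (l := 𝓝[>] r) (φ := φ) (φ₀ := eSym m 0 r)
    (Eventually.of_forall hmeas)
    (by filter_upwards [hmem] with x hx using hbd x hx.1 hx.2) (h.measurable_eSym 0 r) hbd₀
    (fun ξ => by
      have h1 : Continuous fun x : ℝ => φ x ξ := by
        rw [hφ]
        exact continuous_const.mul (continuous_dslope_exp.comp (by fun_prop))
      have h2 := h1.tendsto r
      have h3 : φ r ξ = eSym m 0 r ξ := by simp [hφ, Complex.deriv_exp]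
      rw [h3] at h2
      exact h2.mono_left nhdsWithin_le_nhds) b
  refine hlim.congr' ?_
  filter_upwards [hmem] with x hx
  have hne : ((x - r : ℝ) : ℂ) ≠ 0 := by exact_mod_cast (sub_pos.2 hx.1).ne'
  rw [slope_def_module]
  refine Lp.ext ?_
  filter_upwards [coeFn_mulOp ⟨hmeas x, _, hbd x hx.1 hx.2⟩ b, hab,
    coeFn_mulOp (h.isSymbol_exp (hr.1.trans hx.1.le) hx.2) a,
    coeFn_mulOp (h.isSymbol_exp hr.1 hr.2.le) a,
    Lp.coeFn_smul ((x - r)⁻¹) (semi m 0 x a - semi m 0 r a),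
    Lp.coeFn_sub (semi m 0 x a) (semi m 0 r a)] with ξ h1 h2 h3 h4 h5 h6
  rw [h1, h5, Pi.smul_apply, h6, Pi.sub_apply, h2]
  rw [semi, semi, h3, h4, hφ]
  have h7 := sub_smul_dslope Complex.exp 0 (((x - r : ℝ) : ℂ) * m ξ)
  rw [sub_zero, smul_eq_mul, Complex.exp_zero] at h7
  have h8 : eSym m 0 x ξ = eSym m 0 r ξ * Complex.exp (((x - r : ℝ) : ℂ) * m ξ) := by
    simp only [eSym, jb_zero, Complex.ofReal_one, one_mul]
    rw [← Complex.exp_add]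
    congr 1
    push_cast
    ring
  rw [h8, Complex.real_smul, Complex.ofReal_inv, eq_inv_mul_iff_mul_eq₀ hne]
  simp only
  linear_combination (eSym m 0 r ξ * a ξ) * h7

theorem DissSymbol.semi_eq_add_integral (h : DissSymbol m p) {a b : L2R}
    (hab : b =ᵐ[volume] fun ξ => m ξ * a ξ) {r : ℝ} (hr : r ∈ Icc (0 : ℝ) 1) :
    semi m 0 r a = a + ∫ r' in (0 : ℝ)..r, semi m 0 r' b := by
  have h1 : ContinuousOn (fun r => semi m 0 r b) (Icc 0 r) :=
    (h.continuousOn_semi b).mono (Icc_subset_Icc_right hr.2)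
  rw [intervalIntegral.integral_eq_sub_of_hasDeriv_right_of_le hr.1
    ((h.continuousOn_semi a).mono (Icc_subset_Icc_right hr.2))
    (fun x hx => h.hasDerivWithinAt_semi hab ⟨hx.1.le, hx.2.trans_le hr.2⟩)
    (h1.intervalIntegrable_of_Icc hr.1), DissSymbol.semi_zero]
  abel

/-! ### Equivalence of the Duhamel formula and the weak formulation -/

theorem integral_triangle_swap {F : ℝ → ℝ → ℂ} {t : ℝ} (ht : 0 ≤ t)
    (hF : Integrable (Function.uncurry F)
      ((volume.restrict (Ioc 0 t)).prod (volume.restrict (Ioc 0 t)))) :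
    ∫ τ in (0 : ℝ)..t, ∫ t' in τ..t, F t' τ = ∫ t' in (0 : ℝ)..t, ∫ τ in (0 : ℝ)..t', F t' τ := by
  set S : Set (ℝ × ℝ) := {x | x.2 < x.1} with hS
  have hSm : MeasurableSet S := measurableSet_lt measurable_snd measurable_fst
  have h1 : ∀ τ ∈ Ioc 0 t, ∫ t' in τ..t, F t' τ =
      ∫ t' in Ioc 0 t, S.indicator (Function.uncurry F) (t', τ) := fun τ hτ => by
    have : (fun t' => S.indicator (Function.uncurry F) (t', τ)) =
        (Ioi τ).indicator fun t' => F t' τ := by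
      ext t'
      simp only [indicator_apply, hS, mem_ofPred_eq, mem_Ioi, Function.uncurry]
    rw [this, setIntegral_indicator measurableSet_Ioi, Ioc_inter_Ioi,
      max_eq_right hτ.1.le, intervalIntegral.integral_of_le hτ.2]
  have h2 : ∀ t' ∈ Ioc 0 t, ∫ τ in (0 : ℝ)..t', F t' τ =
      ∫ τ in Ioc 0 t, S.indicator (Function.uncurry F) (t', τ) := fun t' ht' => by
    have : (fun τ => S.indicator (Function.uncurry F) (t', τ)) =
        (Iio t').indicator fun τ => F t' τ := by
      ext τ
      simp only [indicator_apply, hS, mem_ofPred_eq, mem_Iio, Function.uncurry]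
    have h3 : Ioc 0 t ∩ Iio t' = Ioo 0 t' := by
      ext τ
      simp only [mem_inter_iff, mem_Ioc, mem_Iio, mem_Ioo]
      exact ⟨fun h => ⟨h.1.1, h.2⟩, fun h => ⟨⟨h.1, h.2.le.trans ht'.2⟩, h.2⟩⟩
    rw [this, setIntegral_indicator measurableSet_Iio, h3,
      intervalIntegral.integral_of_le ht'.1.le, integral_Ioc_eq_integral_Ioo]
  rw [intervalIntegral.integral_of_le ht, intervalIntegral.integral_of_le ht,
    setIntegral_congr_fun measurableSet_Ioc h1, setIntegral_congr_fun measurableSet_Ioc h2]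
  exact integral_integral_swap (f := fun τ t' => S.indicator (Function.uncurry F) (t', τ))
    (hF.indicator hSm).swap

variable {T b A ρ : ℝ} {g : ℝ → L2R}

theorem DissSymbol.pair_dsemi (h : DissSymbol m p) (hp : 0 < p) {u v : L2R}
    (huv : v =ᵐ[volume] fun ξ => dSym ξ * jb ρ ξ * u ξ) {r : ℝ} (hr : 0 < r) (hr1 : r ≤ 1)
    (a : L2R) : pair (dsemi m ρ r a) u = pair a (semi m 0 r v) := by
  rw [pair_apply, pair_apply]
  refine integral_congr_ae ?_
  filter_upwards [coeFn_mulOp (h.isSymbol_kSym hp ρ hr hr1) a,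
    coeFn_mulOp (h.isSymbol_exp hr.le hr1) v, huv] with ξ h1 h2 h3
  rw [dsemi, h1, semi, h2, h3, kSym, eSym, eSym, jb_zero]
  push_cast
  ring

theorem DissSymbol.pair_semi (h : DissSymbol m p) {r : ℝ} (hr : 0 ≤ r) (hr1 : r ≤ 1)
    (a v : L2R) : pair (semi m 0 r a) v = pair a (semi m 0 r v) :=
  pair_mulOp (h.isSymbol_exp hr hr1) a v

theorem DissSymbol.pair_duhamel (h : DissSymbol m p) (hp : 0 < p) {u v : L2R}
    (huv : v =ᵐ[volume] fun ξ => dSym ξ * jb ρ ξ * u ξ) {t : ℝ} (ht0 : 0 ≤ t) (ht : t ≤ 1)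
    (hi : IntervalIntegrable (fun τ => dsemi m ρ (t - τ) (g τ)) volume 0 t) :
    pair (duhamel m ρ g t) u = ∫ τ in (0 : ℝ)..t, pair (g τ) (semi m 0 (t - τ) v) := by
  have h0 : pair (duhamel m ρ g t) u = pair.flip u (duhamel m ρ g t) := rfl
  rw [h0, duhamel, ← ContinuousLinearMap.intervalIntegral_comp_comm _ hi]
  refine intervalIntegral.integral_congr_ae ?_
  filter_upwards [Measure.ae_ne volume t] with τ h1 h2
  rw [uIoc_of_le ht0] at h2
  have hr : 0 < t - τ := sub_pos.2 (lt_of_le_of_ne h2.2 h1)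
  exact h.pair_dsemi hp huv hr (by linarith [h2.1]) _

/-- The Duhamel formula implies the equation in integrated form, tested against `u`; here
`u' = m u`, `v = (2πiξ)(1 + ξ²)^(ρ/2) u` and `v' = m v`. -/
theorem DissSymbol.weak_of_duhamel (h : DissSymbol m p) (hp : 0 < p) {u u' v v' z : L2R}
    (hu : u' =ᵐ[volume] fun ξ => m ξ * u ξ)
    (huv : v =ᵐ[volume] fun ξ => dSym ξ * jb ρ ξ * u ξ)
    (hv : v' =ᵐ[volume] fun ξ => m ξ * v ξ)
    (hT : T ≤ 1) (hb : b < 1) (hg : Forcing T b A g)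
    (hi : ∀ t ∈ Icc 0 T, IntervalIntegrable (fun τ => dsemi m ρ (t - τ) (g τ)) volume 0 t)
    (hc : ContinuousOn (duhamel m ρ g) (Icc 0 T)) {t : ℝ} (ht : t ∈ Icc 0 T) :
    pair (semi m 0 t z - duhamel m ρ g t) u - pair z u =
      ∫ τ in (0 : ℝ)..t, (pair (semi m 0 τ z - duhamel m ρ g τ) u' - pair (g τ) v) := by
  have ht1 : t ≤ 1 := ht.2.trans hT
  have hgi := (hg.mono ht.2).intervalIntegrable ht.1 hb
  obtain ⟨C, hC0, hC⟩ := h.exists_norm_exp_le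
  have huv' : v' =ᵐ[volume] fun ξ => dSym ξ * jb ρ ξ * u' ξ := by
    filter_upwards [hu, huv, hv] with ξ h1 h2 h3
    rw [h3, h2, h1]
    ring
  -- the free part
  have hfree : pair (semi m 0 t z) u - pair z u =
      ∫ τ in (0 : ℝ)..t, pair (semi m 0 τ z) u' := by
    have h1 : ContinuousOn (fun r => semi m 0 r u') (Icc 0 t) :=
      (h.continuousOn_semi u').mono (Icc_subset_Icc_right ht1)
    rw [h.pair_semi ht.1 ht1, h.semi_eq_add_integral hu ⟨ht.1, ht1⟩, map_add, add_sub_cancel_left,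
      ← ContinuousLinearMap.intervalIntegral_comp_comm _ (h1.intervalIntegrable_of_Icc ht.1)]
    refine intervalIntegral.integral_congr fun τ hτ => ?_
    rw [uIcc_of_le ht.1] at hτ
    exact (h.pair_semi hτ.1 (hτ.2.trans ht1) _ _).symm
  -- the Duhamel part
  set F : ℝ → ℝ → ℂ := fun t' τ => pair (g τ) (semi m 0 (clamp 0 (t' - τ)) v') with hF
  have hFint : Integrable (Function.uncurry F)
      ((volume.restrict (Ioc 0 t)).prod (volume.restrict (Ioc 0 t))) := by
    have hgr : Integrable g (volume.restrict (Ioc 0 t)) := hgi.1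
    have h1 : Integrable (fun x : ℝ × ℝ => ‖g x.2‖)
        ((volume.restrict (Ioc 0 t)).prod (volume.restrict (Ioc 0 t))) :=
      hgr.norm.comp_snd _
    have h2 : Continuous fun x : ℝ × ℝ => semi m 0 (clamp 0 (x.1 - x.2)) v' :=
      Continuous.comp (f := fun x : ℝ × ℝ => (x.1 - x.2, v')) h.continuous_semi_clamp
        (by fun_prop)
    have h3 : AEStronglyMeasurable (fun x : ℝ × ℝ => (g x.2, semi m 0 (clamp 0 (x.1 - x.2)) v'))
        ((volume.restrict (Ioc 0 t)).prod (volume.restrict (Ioc 0 t))) :=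
      hgr.aestronglyMeasurable.comp_snd.prodMk h2.aestronglyMeasurable
    have h4 : Continuous fun x : L2R × L2R => pair x.1 x.2 := by fun_prop
    refine Integrable.mono' (h1.const_mul (‖pair‖ * (C * ‖v'‖)))
      (h4.comp_aestronglyMeasurable h3) (ae_of_all _ fun x => ?_)
    have h5 := pair.le_opNorm₂ (g x.2) (semi m 0 (clamp 0 (x.1 - x.2)) v')
    have h6 := hC _ (le_clamp 0 (x.1 - x.2)) (clamp_le_one zero_le_one _) v'
    calc ‖Function.uncurry F x‖ ≤ ‖pair‖ * ‖g x.2‖ * ‖semi m 0 (clamp 0 (x.1 - x.2)) v'‖ := h5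
      _ ≤ ‖pair‖ * ‖g x.2‖ * (C * ‖v'‖) := by gcongr
      _ = _ := by ring
  have hgv : IntervalIntegrable (fun τ => pair (g τ) v) volume 0 t :=
    ⟨(pair.flip v).integrable_comp hgi.1, (pair.flip v).integrable_comp hgi.2⟩
  have hinner : ∀ τ ∈ Icc 0 t, pair (g τ) (semi m 0 (t - τ) v) =
      pair (g τ) v + ∫ t' in τ..t, F t' τ := fun τ hτ => by
    have hr : t - τ ∈ Icc (0 : ℝ) 1 := ⟨by linarith [hτ.2], by linarith [hτ.1]⟩
    have h1 : ContinuousOn (fun r => semi m 0 r v') (Icc 0 (t - τ)) :=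
      (h.continuousOn_semi v').mono (Icc_subset_Icc_right hr.2)
    rw [h.semi_eq_add_integral hv hr, map_add,
      ← ContinuousLinearMap.intervalIntegral_comp_comm _ (h1.intervalIntegrable_of_Icc hr.1)]
    congr 1
    have h2 := intervalIntegral.integral_comp_sub_right (a := τ) (b := t)
      (fun r => pair (g τ) (semi m 0 r v')) τ
    rw [sub_self] at h2
    rw [← h2]
    refine intervalIntegral.integral_congr fun t' ht' => ?_
    rw [uIcc_of_le hτ.2] at ht'
    simp only [hF]
    rw [clamp_of_mem (by linarith [ht'.1]) (by linarith [ht'.2, hτ.1])]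
  have hduh : pair (duhamel m ρ g t) u =
      (∫ τ in (0 : ℝ)..t, pair (g τ) v) + ∫ τ in (0 : ℝ)..t, pair (duhamel m ρ g τ) u' := by
    rw [h.pair_duhamel hp huv ht.1 ht1 (hi t ht)]
    have h1 : IntervalIntegrable (fun τ => ∫ t' in τ..t, F t' τ) volume 0 t := by
      set S : Set (ℝ × ℝ) := {x | x.2 < x.1} with hS
      have hSm : MeasurableSet S := measurableSet_lt measurable_snd measurable_fst
      have h2 := (hFint.indicator hSm).swap.integral_prod_left
      rw [intervalIntegrable_iff_integrableOn_Ioc_of_le ht.1]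
      refine h2.congr ?_
      filter_upwards [ae_restrict_mem measurableSet_Ioc] with τ hτ
      have h3 : (fun t' => (S.indicator (Function.uncurry F) ∘ Prod.swap) (τ, t')) =
          (Ioi τ).indicator fun t' => F t' τ := by
        ext t'
        simp only [Function.comp, Prod.swap, indicator_apply, hS, mem_ofPred_eq, mem_Ioi,
          Function.uncurry]
      rw [h3, setIntegral_indicator measurableSet_Ioi, Ioc_inter_Ioi,
        max_eq_right hτ.1.le, intervalIntegral.integral_of_le hτ.2]
    rw [intervalIntegral.integral_congr (g := fun τ => pair (g τ) v + ∫ t' in τ..t, F t' τ)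
      (fun τ hτ => by rw [uIcc_of_le ht.1] at hτ; exact hinner τ hτ),
      intervalIntegral.integral_add hgv h1, integral_triangle_swap ht.1 hFint]
    congr 1
    refine intervalIntegral.integral_congr fun t' ht' => ?_
    rw [uIcc_of_le ht.1] at ht'
    have ht'1 : t' ≤ 1 := ht'.2.trans ht1
    rw [h.pair_duhamel hp huv' ht'.1 ht'1 (hi t' ⟨ht'.1, ht'.2.trans ht.2⟩)]
    refine intervalIntegral.integral_congr fun τ hτ => ?_
    rw [uIcc_of_le ht'.1] at hτ
    simp only [hF]
    rw [clamp_of_mem (by linarith [hτ.2]) (by linarith [hτ.1])]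
  have hci1 : IntervalIntegrable (fun τ => pair (semi m 0 τ z) u') volume 0 t :=
    ContinuousOn.intervalIntegrable_of_Icc ht.1
      ((pair.flip u').continuous.comp_continuousOn
        ((h.continuousOn_semi z).mono (Icc_subset_Icc_right ht1)))
  have hci2 : IntervalIntegrable (fun τ => pair (duhamel m ρ g τ) u') volume 0 t :=
    ContinuousOn.intervalIntegrable_of_Icc ht.1
      ((pair.flip u').continuous.comp_continuousOn (hc.mono (Icc_subset_Icc_right ht.2)))
  simp only [map_sub, _root_.sub_apply]
  rw [intervalIntegral.integral_sub (hci1.sub hci2) hgv, intervalIntegral.integral_sub hci1 hci2,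
    hduh, ← hfree]
  ring

/-- A continuous solution of a homogeneous linear equation with bounded operator, vanishing
initially, is zero. -/
theorem eq_zero_of_eq_integral {B : L2R →L[ℂ] L2R} {y : ℝ → L2R} (hy : ContinuousOn y (Icc 0 T))
    (hT : 0 ≤ T) (h : ∀ t ∈ Icc 0 T, y t = ∫ τ in (0 : ℝ)..t, B (y τ)) :
    ∀ t ∈ Icc 0 T, y t = 0 := by
  set y' : ℝ → L2R := IccExtend hT ((Icc 0 T).domRestrict y) with hy'
  have hyc : Continuous y' := hy.domRestrict.Icc_extend'
  have hyeq : ∀ t ∈ Icc 0 T, y' t = y t := fun t ht => by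
    rw [hy', IccExtend_of_mem _ _ ht, domRestrict_apply]
  set Y : ℝ → L2R := fun t => ∫ τ in (0 : ℝ)..t, B (y' τ) with hY
  have hBc : Continuous fun τ => B (y' τ) := B.continuous.comp hyc
  have hd : ∀ t, HasDerivAt Y (B (y' t)) t := fun t => (hBc.integral_hasStrictDerivAt 0 t).hasDerivAt
  have hYeq : ∀ t ∈ Icc 0 T, Y t = y t := fun t ht => by
    rw [h t ht, hY]
    refine intervalIntegral.integral_congr fun τ hτ => ?_
    rw [uIcc_of_le ht.1] at hτ
    rw [hyeq τ ⟨hτ.1, hτ.2.trans ht.2⟩]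
  have hgr := norm_le_gronwallBound_of_norm_deriv_right_le (f := Y) (f' := fun t => B (y' t))
    (δ := 0) (K := ‖B‖) (ε := 0) (a := 0) (b := T)
    (fun t _ => (hd t).continuousAt.continuousWithinAt) (fun t _ => (hd t).hasDerivWithinAt)
    (by simp [hY]) (fun t ht => by
      have ht' : t ∈ Icc 0 T := ⟨ht.1, ht.2.le⟩
      rw [add_zero, hyeq t ht', hYeq t ht']
      exact B.le_opNorm _)
  intro t ht
  have h1 := hgr t ht
  rw [gronwallBound_ε0_δ0, hYeq t ht] at h1
  exact norm_le_zero_iff.1 h1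

/-- Uniqueness for the weak form of the linear equation `∂ₜ d = m d`: after restriction to
`|ξ| < N` the symbol is bounded. -/
theorem DissSymbol.linear_unique (h : DissSymbol m p) {w : ℝ → ℂ} (hw : PolyGrowth w)
    (hw0 : ∀ ξ, w ξ ≠ 0) (hT : 0 ≤ T) {d : ℝ → L2R}
    (hd : ContinuousOn d (Icc 0 T))
    (hweak : ∀ φ : 𝓢(ℝ, ℂ), ∀ t ∈ Icc 0 T, pair (d t) (testVec w φ) =
      ∫ τ in (0 : ℝ)..t, pair (d τ) (testVec (fun ξ => m ξ * w ξ) φ)) :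
    ∀ t ∈ Icc 0 T, d t = 0 := by
  have key : ∀ N : ℕ, ∀ t ∈ Icc 0 T, ∀ᵐ ξ, ξ ∈ Ioo (-(N : ℝ)) N → d t ξ = 0 := by
    intro N
    set χ : ℝ → ℂ := (Ioo (-(N : ℝ)) N).indicator 1 with hχ
    have hχs : IsSymbol χ := by
      refine ⟨measurable_one.indicator measurableSet_Ioo, 1, fun ξ => ?_⟩
      refine (norm_indicator_le_norm_self _ _).trans ?_
      simp
    have hχm : IsSymbol fun ξ => χ ξ * m ξ := by
      obtain ⟨C, M, hC⟩ := h.growth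
      refine ⟨hχs.meas.mul h.meas, |C| * jb |M| N, fun ξ => ?_⟩
      by_cases hξ : ξ ∈ Ioo (-(N : ℝ)) N
      · rw [hχ, indicator_of_mem hξ, Pi.one_apply, one_mul]
        refine (hC ξ).trans ?_
        have h1 : jb M ξ ≤ jb |M| N := by
          refine (jb_mono (le_abs_self M) ξ).trans ?_
          unfold jb
          have h2 : ξ ^ 2 ≤ (N : ℝ) ^ 2 := sq_le_sq' hξ.1.le hξ.2.le
          gcongr
        have h3 := le_abs_self C
        have h4 := (jb_pos M ξ).le
        gcongr
      · rw [hχ, indicator_of_notMem hξ, zero_mul, norm_zero]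
        exact mul_nonneg (abs_nonneg _) (jb_pos _ _).le
    set B := mulOp fun ξ => χ ξ * m ξ with hB
    have hBd : ContinuousOn (fun τ => B (d τ)) (Icc 0 T) := B.continuous.comp_continuousOn hd
    have hcut : ∀ t ∈ Icc 0 T, mulOp χ (d t) = ∫ τ in (0 : ℝ)..t, B (mulOp χ (d τ)) := by
      intro t ht
      have hBi : IntervalIntegrable (fun τ => B (d τ)) volume 0 t :=
        (hBd.mono (Icc_subset_Icc_right ht.2)).intervalIntegrable_of_Icc ht.1
      set δ := d t - ∫ τ in (0 : ℝ)..t, B (d τ) with hδ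
      have hδ0 : ∀ᵐ ξ, ξ ∈ Ioo (-(N : ℝ)) N → δ ξ * w ξ = 0 := by
        refine isOpen_Ioo.ae_eq_zero_of_integral_contDiff_smul_eq_zero ?_ ?_
        · exact (hw.locallyIntegrable_mul δ).locallyIntegrableOn _
        · intro η hη hηc hηs
          have hηC : ContDiff ℝ ∞ fun ξ => (η ξ : ℂ) := Complex.ofRealCLM.contDiff.comp hη
          have hηcc : HasCompactSupport fun ξ => (η ξ : ℂ) := hηc.comp_left Complex.ofReal_zero
          set φ : 𝓢(ℝ, ℂ) := hηcc.toSchwartzMap hηC with hφ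
          have hφ' : ∀ ξ, φ ξ = (η ξ : ℂ) := fun ξ => rfl
          have h1 : testVec (fun ξ => m ξ * w ξ) φ = B (testVec w φ) := by
            refine Lp.ext ?_
            filter_upwards [(h.polyGrowth.mul hw).coeFn_testVec φ, coeFn_mulOp hχm (testVec w φ),
              hw.coeFn_testVec φ] with ξ h1 h2 h3
            rw [h1, hB, h2, h3]
            by_cases hξ : ξ ∈ Ioo (-(N : ℝ)) N
            · rw [hχ, indicator_of_mem hξ, Pi.one_apply]
              ring
            · have h4 : φ ξ = 0 := by
                rw [hφ', image_eq_zero_of_notMem_tsupport fun hh => hξ (hηs hh),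
                  Complex.ofReal_zero]
              rw [h4]
              ring
          have h2 := hweak φ t ht
          rw [h1] at h2
          have h3 : ∫ τ in (0 : ℝ)..t, pair (d τ) (B (testVec w φ)) =
              pair (∫ τ in (0 : ℝ)..t, B (d τ)) (testVec w φ) := by
            have h4 : pair (∫ τ in (0 : ℝ)..t, B (d τ)) (testVec w φ) =
              pair.flip (testVec w φ) (∫ τ in (0 : ℝ)..t, B (d τ)) := rfl
            rw [h4, ← ContinuousLinearMap.intervalIntegral_comp_comm _ hBi]
            refine intervalIntegral.integral_congr fun τ _ => ?_
            exact (pair_mulOp hχm _ _).symm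
          have h5 : pair δ (testVec w φ) = 0 := by
            rw [hδ, map_sub, _root_.sub_apply, h2, h3, sub_self]
          rw [hw.pair_testVec] at h5
          rw [← h5]
          refine integral_congr_ae (ae_of_all _ fun ξ => ?_)
          simp only [hφ', Complex.real_smul]
          ring
      have hδχ : mulOp χ δ = 0 := by
        refine Lp.ext ?_
        filter_upwards [coeFn_mulOp hχs δ, hδ0, Lp.coeFn_zero ℂ 2 (volume : Measure ℝ)]
          with ξ h1 h2 h3
        rw [h1, h3, Pi.zero_apply]
        by_cases hξ : ξ ∈ Ioo (-(N : ℝ)) N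
        · rw [(mul_eq_zero.1 (h2 hξ)).resolve_right (hw0 ξ), mul_zero]
        · rw [hχ, indicator_of_notMem hξ, zero_mul]
      rw [hδ, map_sub, sub_eq_zero] at hδχ
      rw [hδχ, ← ContinuousLinearMap.intervalIntegral_comp_comm _ hBi]
      refine intervalIntegral.integral_congr fun τ _ => ?_
      simp only [hB]
      rw [mulOp_mulOp hχs hχm, mulOp_mulOp hχm hχs]
      congr 2
      ext ξ
      ring
    intro t ht
    have h0 := eq_zero_of_eq_integral ((mulOp χ).continuous.comp_continuousOn hd) hT hcut t ht
    have h1 := coeFn_mulOp hχs (d t)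
    rw [Function.comp_apply] at h0
    rw [h0] at h1
    filter_upwards [h1, Lp.coeFn_zero ℂ 2 (volume : Measure ℝ)] with ξ h2 h3 hξ
    rw [h3, hχ, indicator_of_mem hξ, Pi.one_apply, one_mul] at h2
    exact h2.symm
  intro t ht
  refine Lp.ext ?_
  filter_upwards [ae_all_iff.2 fun N => key N t ht, Lp.coeFn_zero ℂ 2 (volume : Measure ℝ)]
    with ξ h1 h2
  obtain ⟨N, hN⟩ := exists_nat_gt |ξ|
  rw [h2, Pi.zero_apply]
  exact h1 N (abs_lt.1 hN)

/-- The equation in integrated form, tested against `w φ` for a Schwartz function `φ`. -/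
theorem DissSymbol.weak_of_duhamel_testVec (h : DissSymbol m p) (hp : 0 < p) {w : ℝ → ℂ}
    (hw : PolyGrowth w) (hT : T ≤ 1) (hb : b < 1) (hg : Forcing T b A g)
    (hi : ∀ t ∈ Icc 0 T, IntervalIntegrable (fun τ => dsemi m ρ (t - τ) (g τ)) volume 0 t)
    (hc : ContinuousOn (duhamel m ρ g) (Icc 0 T)) (z : L2R) (φ : 𝓢(ℝ, ℂ)) {t : ℝ}
    (ht : t ∈ Icc 0 T) :
    pair (semi m 0 t z - duhamel m ρ g t) (testVec w φ) - pair z (testVec w φ) =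
      ∫ τ in (0 : ℝ)..t, (pair (semi m 0 τ z - duhamel m ρ g τ) (testVec (fun ξ => m ξ * w ξ) φ) -
        pair (g τ) (testVec (fun ξ => dSym ξ * jb ρ ξ * w ξ) φ)) := by
  have hd := (polyGrowth_dSym.mul (polyGrowth_jb ρ)).mul hw
  refine h.weak_of_duhamel hp (v' := testVec (fun ξ => m ξ * (dSym ξ * jb ρ ξ * w ξ)) φ)
    ?_ ?_ ?_ hT hb hg hi hc ht
  · filter_upwards [hw.coeFn_testVec φ, (h.polyGrowth.mul hw).coeFn_testVec φ] with ξ h1 h2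
    rw [h1, h2]
    ring
  · filter_upwards [hw.coeFn_testVec φ, hd.coeFn_testVec φ] with ξ h1 h2
    rw [h1, h2]
    ring
  · filter_upwards [hd.coeFn_testVec φ, (h.polyGrowth.mul hd).coeFn_testVec φ] with ξ h1 h2
    rw [h1, h2]
    ring

/-- The weak form of the equation implies the Duhamel formula. -/
theorem DissSymbol.duhamel_of_weak (h : DissSymbol m p) (hp : 0 < p) {w : ℝ → ℂ}
    (hw : PolyGrowth w) (hw0 : ∀ ξ, w ξ ≠ 0) (hT0 : 0 ≤ T) (hT : T ≤ 1) (hb : b < 1)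
    (hg : Forcing T b A g)
    (hi : ∀ t ∈ Icc 0 T, IntervalIntegrable (fun τ => dsemi m ρ (t - τ) (g τ)) volume 0 t)
    (hc : ContinuousOn (duhamel m ρ g) (Icc 0 T)) {y : ℝ → L2R} (hy : ContinuousOn y (Icc 0 T))
    (hweak : ∀ φ : 𝓢(ℝ, ℂ), ∀ t ∈ Icc 0 T, pair (y t) (testVec w φ) - pair (y 0) (testVec w φ) =
      ∫ τ in (0 : ℝ)..t, (pair (y τ) (testVec (fun ξ => m ξ * w ξ) φ) -
        pair (g τ) (testVec (fun ξ => dSym ξ * jb ρ ξ * w ξ) φ))) :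
    ∀ t ∈ Icc 0 T, y t = semi m 0 t (y 0) - duhamel m ρ g t := by
  set z : ℝ → L2R := fun t => semi m 0 t (y 0) - duhamel m ρ g t with hz
  have hzc : ContinuousOn z (Icc 0 T) :=
    ((h.continuousOn_semi (y 0)).mono (Icc_subset_Icc_right hT)).sub hc
  have h0 := h.linear_unique hw hw0 hT0 (hy.sub hzc) fun φ t ht => by
    have h1 := hweak φ t ht
    have h2 := h.weak_of_duhamel_testVec hp hw hT hb hg hi hc (y 0) φ ht
    have hgi := (hg.mono ht.2).intervalIntegrable ht.1 hb
    have hi3 : IntervalIntegrable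
        (fun τ => pair (g τ) (testVec (fun ξ => dSym ξ * jb ρ ξ * w ξ) φ)) volume 0 t :=
      ⟨(pair.flip _).integrable_comp hgi.1, (pair.flip _).integrable_comp hgi.2⟩
    have hi1 : IntervalIntegrable
        (fun τ => pair (y τ) (testVec (fun ξ => m ξ * w ξ) φ)) volume 0 t :=
      ContinuousOn.intervalIntegrable_of_Icc ht.1
        ((pair.flip _).continuous.comp_continuousOn (hy.mono (Icc_subset_Icc_right ht.2)))
    have hi2 : IntervalIntegrable
        (fun τ => pair (z τ) (testVec (fun ξ => m ξ * w ξ) φ)) volume 0 t :=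
      ContinuousOn.intervalIntegrable_of_Icc ht.1
        ((pair.flip _).continuous.comp_continuousOn (hzc.mono (Icc_subset_Icc_right ht.2)))
    rw [intervalIntegral.integral_sub hi1 hi3] at h1
    change pair (z t) _ - _ = ∫ τ in (0 : ℝ)..t, (pair (z τ) _ - _) at h2
    rw [intervalIntegral.integral_sub hi2 hi3] at h2
    simp only [Pi.sub_apply, map_sub, _root_.sub_apply]
    rw [intervalIntegral.integral_sub hi1 hi2]
    linear_combination h1 - h2
  intro t ht
  exact sub_eq_zero.1 (h0 t ht)

end

/-! ### The product on the Fourier side -/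

section

/-- The isometry `a ↦ a(ξ - ·)` of `L²`. -/
def reflectAt (ξ : ℝ) : L2R →ₗᵢ[ℂ] L2R :=
  Lp.compMeasurePreservingₗᵢ ℂ (fun ζ => ξ - ζ) (Measure.measurePreserving_sub_left volume ξ)

theorem coeFn_reflectAt (ξ : ℝ) (a : L2R) : reflectAt ξ a =ᵐ[volume] fun ζ => a (ξ - ζ) :=
  Lp.coeFn_compMeasurePreserving a (Measure.measurePreserving_sub_left volume ξ)

/-- The convolution of two elements of `L²`, which is defined at every point. -/
def conv (a b : L2R) (ξ : ℝ) : ℂ := pair (reflectAt ξ a) b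

theorem conv_eq_integral (a b : L2R) (ξ : ℝ) : conv a b ξ = ∫ ζ, a (ξ - ζ) * b ζ := by
  rw [conv, pair_apply]
  refine integral_congr_ae ?_
  filter_upwards [coeFn_reflectAt ξ a] with ζ h
  rw [h]

theorem conv_add_left (a a' b : L2R) (ξ : ℝ) : conv (a + a') b ξ = conv a b ξ + conv a' b ξ := by
  simp [conv]

theorem conv_add_right (a b b' : L2R) (ξ : ℝ) : conv a (b + b') ξ = conv a b ξ + conv a b' ξ := by
  simp [conv]

theorem conv_smul_left (c : ℂ) (a b : L2R) (ξ : ℝ) : conv (c • a) b ξ = c * conv a b ξ := by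
  simp [conv]

theorem conv_smul_right (c : ℂ) (a b : L2R) (ξ : ℝ) : conv a (c • b) ξ = c * conv a b ξ := by
  simp [conv]

theorem measurable_conv (a b : L2R) : StronglyMeasurable (conv a b) := by
  have h : conv a b = fun ξ => ∫ ζ, a (ξ - ζ) * b ζ := funext (conv_eq_integral a b)
  rw [h]
  have h1 : StronglyMeasurable (Function.uncurry fun ξ ζ : ℝ => a (ξ - ζ) * b ζ) := by
    have ha := Lp.stronglyMeasurable a
    have hb := Lp.stronglyMeasurable b
    exact (ha.comp_measurable (measurable_fst.sub measurable_snd)).mul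
      (hb.comp_measurable measurable_snd)
  exact h1.integral_prod_right

/-- Peetre's inequality lets the weight of a product be distributed on the factors. -/
theorem norm_conv_smoothing_le {σ : ℝ} (hσ : 0 ≤ σ) (a b : L2R) (ξ : ℝ) :
    ‖conv (smoothing σ a) (smoothing σ b) ξ‖ ≤
      ‖pair‖ * 2 ^ (σ / 2) * jb (-σ) ξ * (‖a‖ * ‖b‖) := by
  set χ : ℝ → ℂ := fun ζ => (jb (-σ) (ξ - ζ) : ℂ) * (jb (-σ) ζ : ℂ) with hχ
  have hχm : Measurable χ := by
    have := measurable_jb (-σ)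
    fun_prop
  have hχb : ∀ ζ, ‖χ ζ‖ ≤ 2 ^ (σ / 2) * jb (-σ) ξ := fun ζ => by
    rw [hχ, norm_mul, Complex.norm_real, Complex.norm_real, Real.norm_of_nonneg (jb_pos _ _).le,
      Real.norm_of_nonneg (jb_pos _ _).le]
    have h1 := jb_peetre hσ ξ ζ
    have h2 := (jb_pos (-σ) (ξ - ζ)).le
    have h3 := (jb_pos (-σ) ζ).le
    have h4 := (jb_pos (-σ) ξ).le
    calc jb (-σ) (ξ - ζ) * jb (-σ) ζ
        = (jb σ ξ * jb (-σ) ξ) * (jb (-σ) (ξ - ζ) * jb (-σ) ζ) := by rw [jb_mul_neg, one_mul]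
      _ ≤ (2 ^ (σ / 2) * (jb σ (ξ - ζ) * jb σ ζ) * jb (-σ) ξ) *
            (jb (-σ) (ξ - ζ) * jb (-σ) ζ) := by gcongr
      _ = 2 ^ (σ / 2) * jb (-σ) ξ * (jb σ (ξ - ζ) * jb (-σ) (ξ - ζ)) *
            (jb σ ζ * jb (-σ) ζ) := by ring
      _ = _ := by rw [jb_mul_neg, jb_mul_neg, mul_one, mul_one]
  have h1 : conv (smoothing σ a) (smoothing σ b) ξ = pair (reflectAt ξ a) (mulOp χ b) := by
    rw [conv, pair_apply, pair_apply]
    refine integral_congr_ae ?_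
    have h2 := (Measure.measurePreserving_sub_left volume ξ).quasiMeasurePreserving.ae_eq_comp
      (coeFn_smoothing hσ a)
    filter_upwards [coeFn_reflectAt ξ (smoothing σ a), h2, coeFn_reflectAt ξ a,
      coeFn_smoothing hσ b, coeFn_mulOp ⟨hχm, _, hχb⟩ b] with ζ h3 h4 h5 h6 h7
    simp only [Function.comp] at h4
    rw [h3, h4, h5, h6, h7, hχ]
    ring
  rw [h1]
  refine (pair.le_opNorm₂ _ _).trans ?_
  rw [LinearIsometry.norm_map]
  have h2 := norm_mulOp_apply_le hχm hχb b
  calc ‖pair‖ * ‖a‖ * ‖mulOp χ b‖ ≤ ‖pair‖ * ‖a‖ * (2 ^ (σ / 2) * jb (-σ) ξ * ‖b‖) := by gcongr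
    _ = _ := by ring

section Product

variable {σ κ : ℝ}

theorem memLp_weighted_conv (hσ : 0 ≤ σ) (hκ : 1 / 2 < κ) (a b : L2R) :
    MemLp (fun ξ => (jb (σ - κ) ξ : ℂ) * conv (smoothing σ a) (smoothing σ b) ξ) 2
      (volume : Measure ℝ) ∧
    eLpNorm (fun ξ => (jb (σ - κ) ξ : ℂ) * conv (smoothing σ a) (smoothing σ b) ξ) 2 volume ≤
      ENNReal.ofReal (‖pair‖ * 2 ^ (σ / 2) * (eLpNorm (jb (-κ)) 2 volume).toReal * ‖a‖ * ‖b‖) := by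
  have hJ := memLp_jb (r := -κ) (by linarith)
  have hm : AEStronglyMeasurable
      (fun ξ => (jb (σ - κ) ξ : ℂ) * conv (smoothing σ a) (smoothing σ b) ξ) volume := by
    have h1 : Measurable fun ξ => (jb (σ - κ) ξ : ℂ) := by fun_prop
    exact h1.aestronglyMeasurable.mul (measurable_conv _ _).aestronglyMeasurable
  have hle : ∀ ξ, ‖(jb (σ - κ) ξ : ℂ) * conv (smoothing σ a) (smoothing σ b) ξ‖ ≤
      ‖(‖pair‖ * 2 ^ (σ / 2) * (‖a‖ * ‖b‖)) * jb (-κ) ξ‖ := fun ξ => by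
    rw [norm_mul, Complex.norm_real, Real.norm_of_nonneg (jb_pos _ _).le]
    have h1 := norm_conv_smoothing_le hσ a b ξ
    have h2 := (jb_pos (σ - κ) ξ).le
    have h3 := (jb_pos (-κ) ξ).le
    have h4 : 0 ≤ ‖pair‖ * 2 ^ (σ / 2) * (‖a‖ * ‖b‖) * jb (-κ) ξ := by positivity
    rw [Real.norm_of_nonneg h4]
    calc _ ≤ jb (σ - κ) ξ * (‖pair‖ * 2 ^ (σ / 2) * jb (-σ) ξ * (‖a‖ * ‖b‖)) := by gcongr
      _ = ‖pair‖ * 2 ^ (σ / 2) * (‖a‖ * ‖b‖) * ((jb σ ξ * jb (-σ) ξ) * jb (-κ) ξ) := by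
        rw [sub_eq_add_neg, jb_add]; ring
      _ = _ := by rw [jb_mul_neg, one_mul]
  have hbig := hJ.const_mul (‖pair‖ * 2 ^ (σ / 2) * (‖a‖ * ‖b‖))
  refine ⟨hbig.of_le hm (ae_of_all _ hle), (eLpNorm_mono hle).trans ?_⟩
  have h0 : 0 ≤ ‖pair‖ * 2 ^ (σ / 2) * (‖a‖ * ‖b‖) := by positivity
  have h1 := eLpNorm_const_smul (‖pair‖ * 2 ^ (σ / 2) * (‖a‖ * ‖b‖)) (jb (-κ)) 2
    (volume : Measure ℝ)
  have h2 : eLpNorm (fun ξ => (‖pair‖ * 2 ^ (σ / 2) * (‖a‖ * ‖b‖)) * jb (-κ) ξ) 2 volume =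
      ENNReal.ofReal (‖pair‖ * 2 ^ (σ / 2) * (‖a‖ * ‖b‖)) * eLpNorm (jb (-κ)) 2 volume := by
    rw [← Real.enorm_of_nonneg h0, ← h1]
    rfl
  rw [h2, ← ENNReal.ofReal_toReal hJ.eLpNorm_ne_top, ← ENNReal.ofReal_mul h0,
    ENNReal.toReal_ofReal ENNReal.toReal_nonneg]
  refine ENNReal.ofReal_le_ofReal (le_of_eq ?_)
  ring

/-- The product `H^σ × H^σ → H^(σ-κ)`, `σ ≥ 0`, `κ > 1/2`, on the Fourier side: the convolution of
`(1 + ξ²)^(-σ/2) a` and `(1 + ξ²)^(-σ/2) b`, multiplied with `(1 + ξ²)^((σ-κ)/2)`. -/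
def prodOp (hσ : 0 ≤ σ) (hκ : 1 / 2 < κ) : L2R →L[ℂ] L2R →L[ℂ] L2R :=
  LinearMap.mkContinuous₂
    (LinearMap.mk₂ ℂ (fun a b => (memLp_weighted_conv hσ hκ a b).1.toLp)
      (fun a a' b => by
        rw [← MemLp.toLp_add]
        congr 1
        ext ξ
        simp only [map_add, conv_add_left, Pi.add_apply]
        ring)
      (fun c a b => by
        rw [← MemLp.toLp_const_smul]
        congr 1
        ext ξ
        simp only [map_smul, conv_smul_left, Pi.smul_apply, smul_eq_mul]
        ring)
      (fun a b b' => by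
        rw [← MemLp.toLp_add]
        congr 1
        ext ξ
        simp only [map_add, conv_add_right, Pi.add_apply]
        ring)
      (fun c a b => by
        rw [← MemLp.toLp_const_smul]
        congr 1
        ext ξ
        simp only [map_smul, conv_smul_right, Pi.smul_apply, smul_eq_mul]
        ring))
    (‖pair‖ * 2 ^ (σ / 2) * (eLpNorm (jb (-κ)) 2 volume).toReal)
    (fun a b => by
      rw [LinearMap.mk₂_apply, Lp.norm_toLp]
      exact ENNReal.toReal_le_of_le_ofReal (by positivity) (memLp_weighted_conv hσ hκ a b).2)

theorem coeFn_prodOp (hσ : 0 ≤ σ) (hκ : 1 / 2 < κ) (a b : L2R) :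
    prodOp hσ hκ a b =ᵐ[volume]
      fun ξ => (jb (σ - κ) ξ : ℂ) * conv (smoothing σ a) (smoothing σ b) ξ := by
  have : prodOp hσ hκ a b = (memLp_weighted_conv hσ hκ a b).1.toLp := rfl
  rw [this]
  exact MemLp.coeFn_toLp _

attribute [irreducible] prodOp

theorem conv_toLp (f g : 𝓢(ℝ, ℂ)) (ξ : ℝ) :
    conv (f.toLp 2) (g.toLp 2) ξ =
      SchwartzMap.convolution (ContinuousLinearMap.mul ℂ ℂ) f g ξ := by
  rw [SchwartzMap.convolution_apply, conv_eq_integral, convolution_eq_swap]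
  refine integral_congr_ae ?_
  have h2 := (Measure.measurePreserving_sub_left volume ξ).quasiMeasurePreserving.ae_eq_comp
    (f.coeFn_toLp 2 volume)
  filter_upwards [h2, g.coeFn_toLp 2 volume] with ζ h3 h4
  simp only [Function.comp] at h3
  rw [h3, h4]
  rfl

/-- The Fourier transform turns products into convolutions, tested against a Schwartz function. -/
theorem integral_conv_mul_eq (a b : L2R) (φ : 𝓢(ℝ, ℂ)) :
    ∫ ξ, conv a b ξ * φ ξ = ∫ x, (𝓕⁻ a : L2R) x * (𝓕⁻ b : L2R) x * (𝓕 φ) x := by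
  have hκ : (1 : ℝ) / 2 < 1 := by norm_num
  have hsym : IsSymbol (𝓕 φ : 𝓢(ℝ, ℂ)) := by
    refine ⟨(𝓕 φ).continuous.measurable, _, fun ξ => (𝓕 φ).norm_le_seminorm ℂ ξ⟩
  have hL : ∀ a b : L2R, ∫ ξ, conv a b ξ * φ ξ =
      pair (prodOp le_rfl hκ a b) (testVec (fun ξ => (jb 1 ξ : ℂ)) φ) := fun a b => by
    rw [(polyGrowth_jb 1).pair_testVec]
    refine integral_congr_ae ?_
    filter_upwards [coeFn_prodOp le_rfl hκ a b] with ξ h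
    rw [h, smoothing_zero, smoothing_zero, zero_sub]
    have h1 : (jb 1 ξ : ℂ) * (jb (-1) ξ : ℂ) = 1 := by exact_mod_cast jb_mul_neg 1 ξ
    linear_combination (-conv a b ξ * φ ξ) * h1
  have hR : ∀ a b : L2R, ∫ x, (𝓕⁻ a : L2R) x * (𝓕⁻ b : L2R) x * (𝓕 φ) x =
      pair (𝓕⁻ a) (mulOp (𝓕 φ : 𝓢(ℝ, ℂ)) (𝓕⁻ b)) := fun a b => by
    rw [pair_apply]
    refine integral_congr_ae ?_
    filter_upwards [coeFn_mulOp hsym (𝓕⁻ b)] with ξ h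
    rw [h]
    ring
  have hFc : Continuous fun a : L2R => (𝓕⁻ a : L2R) := ContinuousFourierInv.continuous_fourierInv
  have hdense := SchwartzMap.denseRange_toLpCLM (E := ℝ) (F := ℂ) (p := 2)
    (μ := (volume : Measure ℝ)) ENNReal.ofNat_ne_top
  rw [hL, hR]
  refine hdense.induction_on₂ (p := fun a b => pair (prodOp le_rfl hκ a b)
    (testVec (fun ξ => (jb 1 ξ : ℂ)) φ) = pair (𝓕⁻ a) (mulOp (𝓕 φ : 𝓢(ℝ, ℂ)) (𝓕⁻ b))) ?_ ?_ a b
  · exact isClosed_eq (by fun_prop) (by fun_prop)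
  · intro f g
    rw [SchwartzMap.toLpCLM_apply, SchwartzMap.toLpCLM_apply, ← hL, ← hR,
      SchwartzMap.toLp_fourierInv_eq, SchwartzMap.toLp_fourierInv_eq]
    set c := SchwartzMap.convolution (ContinuousLinearMap.mul ℂ ℂ) f g with hc
    have h1 : ∫ x, (𝓕⁻ f : 𝓢(ℝ, ℂ)).toLp 2 volume x * (𝓕⁻ g : 𝓢(ℝ, ℂ)).toLp 2 volume x * (𝓕 φ) x =
        ∫ x, (𝓕⁻ c : 𝓢(ℝ, ℂ)) x * (𝓕 φ) x := by
      refine integral_congr_ae ?_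
      filter_upwards [(𝓕⁻ f : 𝓢(ℝ, ℂ)).coeFn_toLp 2 volume, (𝓕⁻ g : 𝓢(ℝ, ℂ)).coeFn_toLp 2 volume]
        with x h2 h3
      rw [h2, h3]
      congr 1
      rw [SchwartzMap.fourierInv_apply_eq, SchwartzMap.fourierInv_apply_eq,
        SchwartzMap.fourierInv_apply_eq, hc, SchwartzMap.fourier_convolution]
      rfl
    rw [h1, SchwartzMap.integral_fourierInv_mul_eq]
    simp only [FourierTransform.fourierInv_fourier_eq, conv_toLp]
    rfl

end Product

/-! ### Coordinates on the Sobolev spaces -/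

theorem Hs.bessel_surjective {s : ℝ} : Function.Surjective (Hs.bessel (s := s)) := by
  intro g
  have h : besselPotential ℝ ℂ s (besselPotential ℝ ℂ (-s) (g : 𝓢'(ℝ, ℂ))) = g := by simp
  exact ⟨(⟨besselPotential ℝ ℂ (-s) (g : 𝓢'(ℝ, ℂ)), g, h⟩ : sobolevSubmodule s),
    Hs.bessel_unique _ h⟩

/-- The isometry of `H^s` with `L²` which maps `f` to `(1 + ξ²)^(s/2) 𝓕 f`. -/
def coord (s : ℝ) : Hs s ≃ₗᵢ[ℂ] L2R :=
  LinearIsometryEquiv.trans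
    (⟨LinearEquiv.ofBijective Hs.bessel ⟨Hs.bessel_injective, Hs.bessel_surjective⟩,
      fun _ => rfl⟩ : Hs s ≃ₗᵢ[ℂ] L2R)
    (Lp.fourierTransformₗᵢ ℝ ℂ)

theorem coord_apply {s : ℝ} (f : Hs s) : coord s f = 𝓕 (Hs.bessel f) := rfl

theorem hat_eq {s : ℝ} (f : Hs s) (ξ : ℝ) : f.hat ξ = (jb (-s) ξ : ℂ) * coord s f ξ := rfl

/-- A Sobolev distribution is determined by its coordinate. -/
theorem toDist_apply {s : ℝ} (f : Hs s) (ψ : 𝓢(ℝ, ℂ)) :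
    Hs.toDist f ψ = pair (coord s f) (testVec (fun ξ => (jb (-s) ξ : ℂ)) (𝓕⁻ ψ)) := by
  have h1 : Hs.toDist f = besselPotential ℝ ℂ (-s) (Hs.bessel f : 𝓢'(ℝ, ℂ)) := by
    rw [← Hs.bessel_spec]
    simp
  have hg : Function.HasTemperateGrowth
      fun ξ : ℝ => (((1 + ‖ξ‖ ^ 2) ^ (-s / 2) : ℝ) : ℂ) := by fun_prop
  rw [(polyGrowth_jb (-s)).pair_testVec, h1, besselPotential, fourierMultiplierCLM_apply_apply]
  have h2 : ∀ χ : 𝓢(ℝ, ℂ), (Hs.bessel f : 𝓢'(ℝ, ℂ)) (𝓕 χ) = ∫ ξ, coord s f ξ * χ ξ := by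
    intro χ
    rw [← TemperedDistribution.fourier_apply, Lp.fourier_toTemperedDistribution_eq,
      ← coord_apply, Lp.toTemperedDistribution_apply]
    simp only [smul_eq_mul, mul_comm]
  rw [h2]
  refine integral_congr_ae (ae_of_all _ fun ξ => ?_)
  simp only
  rw [SchwartzMap.smulLeftCLM_apply_apply hg, smul_eq_mul, Real.norm_eq_abs, sq_abs]
  rfl

/-- A function of `L²` as a distribution, in terms of its Fourier transform. -/
theorem lp_toDist_apply (u : L2R) (ψ : 𝓢(ℝ, ℂ)) :
    (u : 𝓢'(ℝ, ℂ)) ψ = pair (𝓕 u) (testVec (fun _ => 1) (𝓕⁻ ψ)) := by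
  have hone : PolyGrowth fun _ => 1 := ⟨measurable_const, 1, 0, by simp⟩
  have h1 : (u : 𝓢'(ℝ, ℂ)) = 𝓕⁻ ((𝓕 u : L2R) : 𝓢'(ℝ, ℂ)) := by
    rw [Lp.fourierInv_toTemperedDistribution_eq, FourierTransform.fourierInv_fourier_eq]
  rw [h1, TemperedDistribution.fourierInv_apply, hone.pair_testVec, Lp.toTemperedDistribution_apply]
  simp only [smul_eq_mul, one_mul, mul_comm]

/-- Test vectors with nowhere vanishing weight separate points of `L²`. -/
theorem eq_of_pair_testVec_eq {h h' : ℝ → ℂ} (H : PolyGrowth h) (H' : PolyGrowth h') {a b : L2R}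
    (hab : ∀ φ : 𝓢(ℝ, ℂ), pair a (testVec h φ) = pair b (testVec h' φ)) :
    ∀ᵐ ξ, a ξ * h ξ = b ξ * h' ξ := by
  have key := ae_eq_zero_of_integral_contDiff_smul_eq_zero (μ := (volume : Measure ℝ))
    (f := fun ξ => a ξ * h ξ - b ξ * h' ξ)
    ((H.locallyIntegrable_mul a).sub (H'.locallyIntegrable_mul b)) fun η hη hηc => by
      have hηC : ContDiff ℝ ∞ fun ξ => (η ξ : ℂ) := Complex.ofRealCLM.contDiff.comp hη
      have hηcc : HasCompactSupport fun ξ => (η ξ : ℂ) := hηc.comp_left Complex.ofReal_zero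
      have h1 := hab (hηcc.toSchwartzMap hηC)
      rw [H.pair_testVec, H'.pair_testVec] at h1
      have hint : ∀ {c : L2R} {k : ℝ → ℂ}, PolyGrowth k →
          Integrable fun ξ => c ξ * (k ξ * (η ξ : ℂ)) := fun {c k} hk =>
        (Lp.memLp c).integrable_mul (hk.memLp (hηcc.toSchwartzMap hηC))
      have h2 : ∀ ξ, η ξ • (a ξ * h ξ - b ξ * h' ξ) =
          a ξ * (h ξ * (η ξ : ℂ)) - b ξ * (h' ξ * (η ξ : ℂ)) := fun ξ => by
        rw [Complex.real_smul]
        ring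
      simp only [h2]
      rw [integral_sub (hint H) (hint H')]
      exact sub_eq_zero.2 h1
  filter_upwards [key] with ξ hξ
  exact sub_eq_zero.1 hξ

theorem schwartz_fourierInv_fourier (φ : 𝓢(ℝ, ℂ)) : 𝓕⁻ (𝓕 φ) = φ :=
  FourierTransform.fourierInv_fourier_eq φ

/-- A distribution in `H^s`, `s ≤ σ`, which is also in `H^σ`: the coordinates are related by
smoothing. -/
theorem toDist_eq_iff {s σ : ℝ} (hsσ : s ≤ σ) (f : Hs s) (g : Hs σ) :
    Hs.toDist f = Hs.toDist g ↔ coord s f = smoothing (σ - s) (coord σ g) := by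
  have h0 : 0 ≤ σ - s := by linarith
  have hw : ∀ ξ : ℝ, jb (-s) ξ * jb (-(σ - s)) ξ = jb (-σ) ξ := fun ξ => by
    rw [← jb_add]
    congr 1
    ring
  constructor
  · intro h
    have h1 := eq_of_pair_testVec_eq (polyGrowth_jb (-s)) (polyGrowth_jb (-σ))
      (a := coord s f) (b := coord σ g) fun φ => by
        have := congrArg (fun T : 𝓢'(ℝ, ℂ) => T (𝓕 φ)) h
        simp only [toDist_apply, schwartz_fourierInv_fourier] at this
        exact this
    refine Lp.ext ?_
    filter_upwards [h1, coeFn_smoothing h0 (coord σ g)] with ξ h2 h3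
    have h4 : (jb (-s) ξ : ℂ) ≠ 0 := by exact_mod_cast (jb_pos (-s) ξ).ne'
    refine mul_right_cancel₀ h4 ?_
    rw [h2, h3, ← hw ξ]
    push_cast
    ring
  · intro h
    ext ψ
    rw [toDist_apply, toDist_apply, h, (polyGrowth_jb _).pair_testVec,
      (polyGrowth_jb _).pair_testVec]
    refine integral_congr_ae ?_
    filter_upwards [coeFn_smoothing h0 (coord σ g)] with ξ h3
    rw [h3, ← hw ξ]
    push_cast
    ring

/-- The element of `H⁰` given by a function of `L²`. -/
theorem toDist_coord_symm_zero (u : L2R) : Hs.toDist ((coord 0).symm (𝓕 u)) = (u : 𝓢'(ℝ, ℂ)) := by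
  ext ψ
  rw [toDist_apply, lp_toDist_apply, LinearIsometryEquiv.apply_symm_apply]
  simp

end

/-! ### Quadratic equations in a Banach space -/

section Quadratic

variable {E : Type*} [NormedAddCommGroup E] [NormedSpace ℂ E]

theorem quadratic_sub_le {B : E →L[ℂ] E →L[ℂ] E} {K r : ℝ} (hB : ‖B‖ ≤ K) (hKr : 8 * K * r ≤ 1)
    {v w : E} (hv : ‖v‖ ≤ 2 * r) (hw : ‖w‖ ≤ 2 * r) :
    ‖B v v - B w w‖ ≤ 1 / 2 * ‖v - w‖ := by
  have h1 : B v v - B w w = B v (v - w) + B (v - w) w := by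
    simp only [map_sub, _root_.sub_apply]
    abel
  have hK : 0 ≤ K := (norm_nonneg B).trans hB
  rw [h1]
  calc ‖B v (v - w) + B (v - w) w‖ ≤ ‖B‖ * ‖v‖ * ‖v - w‖ + ‖B‖ * ‖v - w‖ * ‖w‖ :=
        (norm_add_le _ _).trans (add_le_add (B.le_opNorm₂ _ _) (B.le_opNorm₂ _ _))
    _ ≤ K * (2 * r) * ‖v - w‖ + K * ‖v - w‖ * (2 * r) := by gcongr
    _ = (8 * K * r) * (1 / 2 * ‖v - w‖) := by ring
    _ ≤ 1 * (1 / 2 * ‖v - w‖) := by gcongr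
    _ = _ := one_mul _

theorem quadratic_unique {B : E →L[ℂ] E →L[ℂ] E} {K r : ℝ} (hB : ‖B‖ ≤ K) (hKr : 8 * K * r ≤ 1)
    {v w : E} (hv : ‖v‖ ≤ 2 * r) (hw : ‖w‖ ≤ 2 * r) (h : v + B v v = w + B w w) : v = w := by
  have h1 := quadratic_sub_le hB hKr hv hw
  have h2 : B v v - B w w = -(v - w) := by
    have h3 : B v v - B w w = (v + B v v) - (w + B w w) - (v - w) := by abel
    rw [h3, h, sub_self, zero_sub]
  rw [h2, norm_neg] at h1
  have h3 : ‖v - w‖ ≤ 0 := by linarith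
  exact sub_eq_zero.1 (norm_le_zero_iff.1 h3)

variable [CompleteSpace E]

theorem quadratic_exists {B : E →L[ℂ] E →L[ℂ] E} {K r : ℝ} (hB : ‖B‖ ≤ K) (hKr : 8 * K * r ≤ 1)
    {y : E} (hy : ‖y‖ < r) : ∃ v : E, v + B v v = y ∧ ‖v‖ < 2 * r := by
  have hr : 0 < r := (norm_nonneg y).trans_lt hy
  have hK : 0 ≤ K := (norm_nonneg B).trans hB
  have hbd : ∀ v : E, ‖v‖ ≤ 2 * r → ‖y - B v v‖ < 2 * r := fun v hv => by
    calc ‖y - B v v‖ ≤ ‖y‖ + ‖B‖ * ‖v‖ * ‖v‖ := (norm_sub_le _ _).trans (by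
          gcongr
          exact B.le_opNorm₂ _ _)
      _ ≤ ‖y‖ + K * (2 * r) * (2 * r) := by gcongr
      _ = ‖y‖ + (8 * K * r) * (r / 2) := by ring
      _ ≤ ‖y‖ + 1 * (r / 2) := by gcongr
      _ < 2 * r := by linarith
  set s : Set E := Metric.closedBall 0 (2 * r) with hs
  have hmem : ∀ v, v ∈ s ↔ ‖v‖ ≤ 2 * r := fun v => mem_closedBall_zero_iff
  have hmaps : MapsTo (fun v => y - B v v) s s := fun v hv => (hmem _).2 (hbd v ((hmem v).1 hv)).le
  have hcontr : ContractingWith (1 / 2) (hmaps.restrict _ s s) := by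
    refine ⟨by norm_num, LipschitzWith.of_dist_le_mul fun v w => ?_⟩
    rw [Subtype.dist_eq, Subtype.dist_eq, MapsTo.val_restrict_apply, MapsTo.val_restrict_apply,
      dist_eq_norm, dist_eq_norm]
    have h1 := quadratic_sub_le hB hKr ((hmem w).1 w.2) ((hmem v).1 v.2)
    have h2 : y - B v v - (y - B w w) = B w w - B v v := by abel
    rw [h2, norm_sub_rev (v : E)]
    simpa using h1
  obtain ⟨v, hv, hfix, -⟩ := hcontr.exists_fixedPoint' Metric.isClosed_closedBall.isComplete hmaps
    (x := 0) ((hmem 0).2 (by rw [norm_zero]; positivity)) (edist_ne_top _ _)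
  have hfix' : y - B v v = v := hfix
  refine ⟨v, ?_, ?_⟩
  · nth_rewrite 1 [← hfix']
    abel
  · rw [← hfix']
    exact hbd v ((hmem v).1 hv)

open Classical in
/-- The small solution `v` of `v + B(v, v) = y`. -/
def quadSol (B : E →L[ℂ] E →L[ℂ] E) (r : ℝ) (y : E) : E :=
  if h : ∃ v : E, v + B v v = y ∧ ‖v‖ < 2 * r then h.choose else 0

theorem quadSol_spec {B : E →L[ℂ] E →L[ℂ] E} {K r : ℝ} (hB : ‖B‖ ≤ K) (hKr : 8 * K * r ≤ 1)
    {y : E} (hy : ‖y‖ < r) :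
    quadSol B r y + B (quadSol B r y) (quadSol B r y) = y ∧ ‖quadSol B r y‖ < 2 * r := by
  have h := quadratic_exists hB hKr hy
  rw [quadSol, dif_pos h]
  exact h.choose_spec

/-- By the inverse function theorem the small solution depends smoothly on the right-hand side. -/
theorem contDiffOn_quadSol {B : E →L[ℂ] E →L[ℂ] E} {K r : ℝ} (hB : ‖B‖ ≤ K)
    (hKr : 8 * K * r ≤ 1) : ContDiffOn ℂ ∞ (quadSol B r) (Metric.ball 0 r) := by
  intro y₀ hy₀
  rw [mem_ball_zero_iff] at hy₀
  have hK : 0 ≤ K := (norm_nonneg B).trans hB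
  have hr : 0 < r := (norm_nonneg y₀).trans_lt hy₀
  obtain ⟨hv, hvr⟩ := quadSol_spec hB hKr hy₀
  set v₀ := quadSol B r y₀ with hv₀
  set G : E → E := fun v => v + B v v with hG
  have hGc : ContDiff ℂ ∞ G := contDiff_id.add (B.isBoundedBilinearMap.contDiff.comp
    (contDiff_id.prodMk contDiff_id))
  set P : E →L[ℂ] E := -(B v₀ + B.flip v₀) with hP
  have hPn : ‖P‖ < 1 := by
    rw [hP, norm_neg]
    have h1 : ‖B v₀‖ ≤ K * ‖v₀‖ := (B.le_opNorm v₀).trans (by gcongr)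
    have h2 : ‖B.flip v₀‖ ≤ K * ‖v₀‖ := (B.flip.le_opNorm v₀).trans (by
      rw [ContinuousLinearMap.opNorm_flip]; gcongr)
    have h3 : K * ‖v₀‖ ≤ K * (2 * r) := by gcongr
    linarith [norm_add_le (B v₀) (B.flip v₀)]
  set e : E ≃L[ℂ] E := ContinuousLinearEquiv.ofUnit (Units.oneSub P hPn) with he
  have hd : HasFDerivAt G (e : E →L[ℂ] E) v₀ := by
    have h1 := (hasFDerivAt_id (𝕜 := ℂ) v₀).add
      (B.hasFDerivAt_of_bilinear (hasFDerivAt_id (𝕜 := ℂ) v₀) (hasFDerivAt_id (𝕜 := ℂ) v₀))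
    refine h1.congr_fderiv ?_
    ext w
    have h2 : (e : E →L[ℂ] E) w = w - P w := rfl
    rw [h2, hP]
    simp only [id_eq, _root_.add_apply, ContinuousLinearMap.id_apply,
      ContinuousLinearMap.precompR_apply, ContinuousLinearMap.precompL_apply, _root_.neg_apply,
      ContinuousLinearMap.flip_apply, ContinuousLinearMap.compL_apply,
      ContinuousLinearMap.comp_apply]
    abel
  have hGat : ContDiffAt ℂ ∞ G v₀ := hGc.contDiffAt
  have hn : (∞ : WithTop ℕ∞) ≠ 0 := by simp
  have hloc := hGat.to_localInverse hd hn
  have hstrict := hGat.hasStrictFDerivAt' hd hn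
  have hGv : G v₀ = y₀ := hv
  rw [hGv] at hloc
  have hri := hstrict.eventually_right_inverse
  have hval := hstrict.localInverse_apply_image
  rw [hGv] at hri hval
  refine ContDiffAt.contDiffWithinAt (hloc.congr_of_eventuallyEq ?_)
  have hcont : ContinuousAt (hstrict.localInverse G e v₀) y₀ := hloc.continuousAt
  have hsmall : ∀ᶠ y in 𝓝 y₀, ‖hstrict.localInverse G e v₀ y‖ < 2 * r := by
    have h1 : Tendsto (fun y => ‖hstrict.localInverse G e v₀ y‖) (𝓝 y₀) (𝓝 ‖v₀‖) := by
      have := hcont.norm.tendsto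
      rwa [hval] at this
    exact h1.eventually (eventually_lt_nhds hvr)
  have hyr : ∀ᶠ y in 𝓝 y₀, ‖y‖ < r := continuous_norm.continuousAt.eventually_lt_const hy₀
  filter_upwards [hri, hsmall, hyr] with y h1 h2 h3
  obtain ⟨h4, h5⟩ := quadSol_spec hB hKr h3
  exact quadratic_unique hB hKr h5.le h2.le (h4.trans h1.symm)

end Quadratic

/-! ### The coordinate at the level of `H^max(s,0)` -/

section

/-- The number of derivatives by which `H^s` fails to be contained in `L²`. -/
def deficit (s : ℝ) : ℝ := max (-s) 0

theorem deficit_nonneg (s : ℝ) : 0 ≤ deficit s := le_max_right _ _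

theorem max_sub_eq_deficit (s : ℝ) : max s 0 - s = deficit s := by
  rcases le_total 0 s with h | h
  · rw [max_eq_left h, deficit, max_eq_right (by linarith), sub_self]
  · rw [max_eq_right h, deficit, max_eq_left (by linarith), zero_sub]

theorem deficit_of_nonneg {s : ℝ} (h : 0 ≤ s) : deficit s = 0 := max_eq_right (by linarith)

theorem deficit_of_nonpos {s : ℝ} (h : s ≤ 0) : deficit s = -s := max_eq_left (by linarith)

theorem l2ENorm_coe (u : L2R) : l2ENorm (u : 𝓢'(ℝ, ℂ)) = ‖u‖ₑ := by
  refine le_antisymm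
    (iInf₂_le (f := fun (g : L2R) (_ : (u : 𝓢'(ℝ, ℂ)) = g) => ‖g‖ₑ) u rfl)
    (le_iInf fun g => le_iInf fun hg => ?_)
  rw [l2_toTemperedDistribution_injective hg]

theorem exists_of_l2ENorm_ne_top {f : 𝓢'(ℝ, ℂ)} (h : l2ENorm f ≠ ⊤) :
    ∃ u : L2R, f = (u : 𝓢'(ℝ, ℂ)) := by
  by_contra hne
  push Not at hne
  exact h (by simp [l2ENorm, hne])

/-- If `b` is the coordinate of `f` in `H^max(s,0)`, then `f` is a function of `L²`. -/
theorem toDist_eq_of_coord {s : ℝ} {f : Hs s} {b : L2R} (h : coord s f = smoothing (deficit s) b) :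
    Hs.toDist f = ((𝓕⁻ (smoothing (max s 0) b) : L2R) : 𝓢'(ℝ, ℂ)) := by
  rw [← toDist_coord_symm_zero, FourierTransform.fourier_fourierInv_eq]
  rcases le_total 0 s with hs | hs
  · rw [deficit_of_nonneg hs, smoothing_zero] at h
    rw [max_eq_left hs]
    refine ((toDist_eq_iff hs _ f).2 ?_).symm
    rw [LinearIsometryEquiv.apply_symm_apply, sub_zero, h]
  · rw [deficit_of_nonpos hs] at h
    rw [max_eq_right hs, smoothing_zero]
    refine (toDist_eq_iff hs f _).2 ?_
    rw [LinearIsometryEquiv.apply_symm_apply, zero_sub, h]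

/-- If `f ∈ H^s` is a function of `L²`, then it has a coordinate in `H^max(s,0)`. -/
theorem exists_coord_of_toDist_eq {s : ℝ} {f : Hs s} {u : L2R}
    (h : Hs.toDist f = (u : 𝓢'(ℝ, ℂ))) :
    ∃ b, coord s f = smoothing (deficit s) b ∧ 𝓕 u = smoothing (max s 0) b ∧
      ‖b‖ ≤ max ‖f‖ ‖u‖ := by
  rw [← toDist_coord_symm_zero] at h
  rcases le_total 0 s with hs | hs
  · refine ⟨coord s f, ?_, ?_, ?_⟩
    · rw [deficit_of_nonneg hs, smoothing_zero]
    · have h1 := (toDist_eq_iff hs _ f).1 h.symm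
      rw [LinearIsometryEquiv.apply_symm_apply, sub_zero] at h1
      rw [max_eq_left hs, h1]
    · rw [LinearIsometryEquiv.norm_map]
      exact le_max_left _ _
  · have h1 := (toDist_eq_iff hs f _).1 h
    rw [LinearIsometryEquiv.apply_symm_apply, zero_sub] at h1
    refine ⟨𝓕 u, ?_, ?_, ?_⟩
    · rw [deficit_of_nonpos hs, h1]
    · rw [max_eq_right hs, smoothing_zero]
    · rw [Lp.norm_fourier_eq]
      exact le_max_right _ _

instance (s : ℝ) : CompleteSpace (Hs s) :=
  ((coord s).isometry.isUniformInducing.completeSpace_congr (coord s).surjective).2 inferInstance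

/-! ### The space `XT` -/

variable {p s T : ℝ}

theorem XT.norm_def (F : XT p s T) : ‖F‖ = (xENorm p s T (XT.toC F)).toReal := rfl

theorem XT.norm_apply_le (F : XT p s T) (t : Icc (0 : ℝ) T) : ‖XT.toC F t‖ ≤ ‖F‖ := by
  have h : ‖XT.toC F t‖ₑ ≤ xENorm p s T (XT.toC F) :=
    le_trans le_self_add (le_iSup (fun t : Icc (0 : ℝ) T => (‖XT.toC F t‖ₑ +
    ENNReal.ofReal ((t : ℝ) ^ (|s| / p)) * l2ENorm (Hs.toDist (XT.toC F t)))) t)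
  rw [XT.norm_def, ← toReal_enorm]
  exact ENNReal.toReal_mono F.ne_top h

theorem XT.norm_toC_le (F : XT p s T) : ‖XT.toC F‖ ≤ ‖F‖ :=
  (ContinuousMap.norm_le _ (norm_nonneg _)).2 F.norm_apply_le

/-- For `0 < t` an element of `XT` has a coordinate in `H^max(s,0)`, of size `t^(-s⁻/p)`. -/
theorem XT.exists_coord (F : XT p s T) (t : Icc (0 : ℝ) T)
    (ht : 0 < (t : ℝ)) :
    ∃ b, coord s (XT.toC F t) = smoothing (deficit s) b ∧
      (t : ℝ) ^ (deficit s / p) * ‖b‖ ≤ ‖F‖ := by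
  have h : ENNReal.ofReal ((t : ℝ) ^ (|s| / p)) * l2ENorm (Hs.toDist (XT.toC F t)) ≤
      xENorm p s T (XT.toC F) :=
    le_trans le_add_self (le_iSup (fun t : Icc (0 : ℝ) T => (‖XT.toC F t‖ₑ +
    ENNReal.ofReal ((t : ℝ) ^ (|s| / p)) * l2ENorm (Hs.toDist (XT.toC F t)))) t)
  have hpos : 0 < (t : ℝ) ^ (|s| / p) := Real.rpow_pos_of_pos ht _
  have hne : l2ENorm (Hs.toDist (XT.toC F t)) ≠ ⊤ := by
    intro h1
    rw [h1, ENNReal.mul_top (by simpa using hpos)] at h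
    exact F.ne_top (top_le_iff.1 h)
  obtain ⟨u, hu⟩ := exists_of_l2ENorm_ne_top hne
  have h2 := ENNReal.toReal_mono F.ne_top h
  rw [hu, l2ENorm_coe, ENNReal.toReal_mul, toReal_enorm, ENNReal.toReal_ofReal hpos.le,
    ← XT.norm_def] at h2
  obtain ⟨b, hb, hb', -⟩ := exists_coord_of_toDist_eq hu
  refine ⟨b, hb, ?_⟩
  rcases le_total 0 s with hs | hs
  · rw [deficit_of_nonneg hs, zero_div, Real.rpow_zero, one_mul]
    rw [deficit_of_nonneg hs, smoothing_zero] at hb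
    rw [← hb, LinearIsometryEquiv.norm_map]
    exact F.norm_apply_le t
  · rw [max_eq_right hs, smoothing_zero] at hb'
    rw [deficit_of_nonpos hs, ← hb', Lp.norm_fourier_eq]
    rwa [abs_of_nonpos hs] at h2

/-- The norm of `XT` in terms of coordinates in `H^max(s,0)`. The time weight of the definition is
`t^(|s|/p)` also for `s > 0`, where it is harmless because `t ≤ 1`. -/
theorem xENorm_le (hp : 0 < p) (hT : T ≤ 1) {f : C(Icc (0 : ℝ) T, Hs s)} {A₁ A₂ : ℝ}
    (h1 : ∀ t, ‖f t‖ ≤ A₁) (hA₁ : 0 ≤ A₁) (hA₂ : 0 ≤ A₂)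
    (h2 : ∀ t : Icc (0 : ℝ) T, 0 < (t : ℝ) → ∃ b, coord s (f t) = smoothing (deficit s) b ∧
      (t : ℝ) ^ (deficit s / p) * ‖b‖ ≤ A₂) :
    xENorm p s T f ≤ ENNReal.ofReal (2 * A₁ + A₂) := by
  refine iSup_le fun t => ?_
  have h3 : ‖f t‖ₑ ≤ ENNReal.ofReal A₁ := by
    rw [← ofReal_norm]
    exact ENNReal.ofReal_le_ofReal (h1 t)
  have h4 : ENNReal.ofReal ((t : ℝ) ^ (|s| / p)) * l2ENorm (Hs.toDist (f t)) ≤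
      ENNReal.ofReal (A₁ + A₂) := by
    rcases le_total 0 s with hs | hs
    · have h5 : coord s (f t) = smoothing (deficit s) (coord s (f t)) := by
        rw [deficit_of_nonneg hs, smoothing_zero]
      rw [toDist_eq_of_coord h5, l2ENorm_coe, ← ofReal_norm,
        ← ENNReal.ofReal_mul (Real.rpow_nonneg t.2.1 _)]
      refine ENNReal.ofReal_le_ofReal ?_
      have h6 : (t : ℝ) ^ (|s| / p) ≤ 1 :=
        Real.rpow_le_one t.2.1 (t.2.2.trans hT) (by positivity)
      have h7 : ‖(𝓕⁻ (smoothing (max s 0) (coord s (f t))) : L2R)‖ ≤ A₁ := by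
        rw [← Lp.norm_fourier_eq, FourierTransform.fourier_fourierInv_eq]
        refine (norm_smoothing_le (le_max_right _ _) _).trans ?_
        rw [LinearIsometryEquiv.norm_map]
        exact h1 t
      calc _ ≤ 1 * A₁ := by gcongr
        _ ≤ _ := by linarith
    · rcases t.2.1.eq_or_lt with h0 | h0
      · rcases hs.eq_or_lt with rfl | hs'
        · have h5 : coord 0 (f t) = smoothing (deficit 0) (coord 0 (f t)) := by
            rw [deficit_of_nonneg le_rfl, smoothing_zero]
          rw [toDist_eq_of_coord h5, l2ENorm_coe, ← ofReal_norm, abs_zero, zero_div,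
            Real.rpow_zero, ENNReal.ofReal_one, one_mul]
          refine ENNReal.ofReal_le_ofReal ?_
          rw [← Lp.norm_fourier_eq, FourierTransform.fourier_fourierInv_eq]
          refine (norm_smoothing_le (le_max_right _ _) _).trans ?_
          rw [LinearIsometryEquiv.norm_map]
          linarith [h1 t]
        · rw [← h0, Real.zero_rpow (div_ne_zero (abs_ne_zero.2 hs'.ne) hp.ne'),
            ENNReal.ofReal_zero, zero_mul]
          exact bot_le
      · obtain ⟨b, hb, hb'⟩ := h2 t h0
        rw [toDist_eq_of_coord hb, l2ENorm_coe, ← ofReal_norm,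
          ← ENNReal.ofReal_mul (Real.rpow_nonneg t.2.1 _)]
        refine ENNReal.ofReal_le_ofReal ?_
        rw [← Lp.norm_fourier_eq, FourierTransform.fourier_fourierInv_eq, max_eq_right hs,
          smoothing_zero, abs_of_nonpos hs, ← deficit_of_nonpos hs]
        linarith
  refine (add_le_add h3 h4).trans ?_
  rw [← ENNReal.ofReal_add hA₁ (by positivity)]
  exact ENNReal.ofReal_le_ofReal (by linarith)

/-- The element of `XT` given by a continuous function of finite norm. -/
def XT.mk (f : C(Icc (0 : ℝ) T, Hs s)) (h : xENorm p s T f < ⊤) : XT p s T :=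
  (⟨f, h⟩ : xSubmodule p s T)

theorem XT.toC_mk (f : C(Icc (0 : ℝ) T, Hs s)) (h : xENorm p s T f < ⊤) :
    XT.toC (XT.mk f h) = f := rfl

theorem XT.norm_mk_le {f : C(Icc (0 : ℝ) T, Hs s)} (h : xENorm p s T f < ⊤) {A : ℝ} (hA : 0 ≤ A)
    (hf : xENorm p s T f ≤ ENNReal.ofReal A) : ‖XT.mk f h‖ ≤ A :=
  ENNReal.toReal_le_of_le_ofReal hA hf

theorem XT.toC_injective : Function.Injective (XT.toC (p := p) (s := s) (T := T)) :=
  (xSubmodule p s T).injective_subtype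

theorem XT.completeSpace (hp : 0 < p) (hT : T ≤ 1) : CompleteSpace (XT p s T) := by
  refine Metric.complete_of_cauchySeq_tendsto fun u hu => ?_
  have hlip : ∀ F G : XT p s T, dist (XT.toC F) (XT.toC G) ≤ dist F G := fun F G => by
    rw [dist_eq_norm, dist_eq_norm, ← map_sub]
    exact XT.norm_toC_le _
  have huC : CauchySeq fun n => XT.toC (u n) := by
    rw [Metric.cauchySeq_iff] at hu ⊢
    intro ε hε
    obtain ⟨N, hN⟩ := hu ε hε
    exact ⟨N, fun m hm n hn => (hlip _ _).trans_lt (hN m hm n hn)⟩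
  obtain ⟨f, hf⟩ := cauchySeq_tendsto_of_complete huC
  have hft : ∀ t, Tendsto (fun n => XT.toC (u n) t) atTop (𝓝 (f t)) := fun t =>
    ((continuous_eval_const t).tendsto f).comp hf
  -- the coordinates in `H^max(s,0)` converge as well
  have hb : ∀ t : Icc (0 : ℝ) T, 0 < (t : ℝ) → ∃ (b : ℕ → L2R) (b₀ : L2R),
      (∀ n, coord s (XT.toC (u n) t) = smoothing (deficit s) (b n)) ∧
      coord s (f t) = smoothing (deficit s) b₀ ∧ Tendsto b atTop (𝓝 b₀) ∧
      ∀ n n', (t : ℝ) ^ (deficit s / p) * ‖b n - b n'‖ ≤ ‖u n - u n'‖ := by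
    intro t ht
    choose b hb hb' using fun n => XT.exists_coord (u n) t ht
    have hpos : 0 < (t : ℝ) ^ (deficit s / p) := Real.rpow_pos_of_pos ht _
    have hdiff : ∀ n n', (t : ℝ) ^ (deficit s / p) * ‖b n - b n'‖ ≤ ‖u n - u n'‖ := by
      intro n n'
      obtain ⟨c, hc, hc'⟩ := XT.exists_coord (u n - u n') t ht
      have : c = b n - b n' := by
        refine smoothing_injective (deficit_nonneg s) ?_
        rw [← hc, map_sub, map_sub, ← hb, ← hb, ContinuousMap.sub_apply, map_sub]
      rwa [this] at hc'
    have hbC : CauchySeq b := by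
      rw [Metric.cauchySeq_iff] at hu ⊢
      intro ε hε
      obtain ⟨N, hN⟩ := hu ((t : ℝ) ^ (deficit s / p) * ε) (by positivity)
      refine ⟨N, fun m hm n hn => ?_⟩
      have h1 := (hdiff m n).trans_lt (by simpa [dist_eq_norm] using hN m hm n hn)
      rw [dist_eq_norm]
      exact lt_of_mul_lt_mul_left h1 hpos.le
    obtain ⟨b₀, hb₀⟩ := cauchySeq_tendsto_of_complete hbC
    refine ⟨b, b₀, hb, ?_, hb₀, hdiff⟩
    have h1 : Tendsto (fun n => coord s (XT.toC (u n) t)) atTop (𝓝 (coord s (f t))) :=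
      ((coord s).continuous.tendsto _).comp (hft t)
    have h2 : Tendsto (fun n => smoothing (deficit s) (b n)) atTop
        (𝓝 (smoothing (deficit s) b₀)) := ((smoothing (deficit s)).continuous.tendsto _).comp hb₀
    simp only [hb] at h1
    exact tendsto_nhds_unique h1 h2
  have hbound : ∀ ε > 0, ∃ N, ∀ n ≥ N, xENorm p s T (XT.toC (u n) - f) ≤
      ENNReal.ofReal (3 * ε) := by
    intro ε hε
    rw [Metric.cauchySeq_iff] at hu
    obtain ⟨N, hN⟩ := hu ε hε
    refine ⟨N, fun n hn => ?_⟩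
    have hev : ∀ᶠ n' in atTop, ‖u n - u n'‖ ≤ ε := by
      filter_upwards [eventually_ge_atTop N] with n' hn'
      rw [← dist_eq_norm]
      exact (hN n hn n' hn').le
    have h3 : 3 * ε = 2 * ε + ε := by ring
    rw [h3]
    refine xENorm_le hp hT (fun t => ?_) hε.le hε.le fun t ht => ?_
    · have h1 : Tendsto (fun n' => ‖XT.toC (u n) t - XT.toC (u n') t‖) atTop
          (𝓝 ‖XT.toC (u n) t - f t‖) := (tendsto_const_nhds.sub (hft t)).norm
      refine le_of_tendsto h1 ?_
      filter_upwards [hev] with n' hn'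
      have := XT.norm_apply_le (u n - u n') t
      rw [map_sub, ContinuousMap.sub_apply] at this
      exact this.trans hn'
    · obtain ⟨b, b₀, h1, h2, h4, h5⟩ := hb t ht
      refine ⟨b n - b₀, ?_, ?_⟩
      · rw [ContinuousMap.sub_apply, map_sub, map_sub, h1, h2]
      · have h6 : Tendsto (fun n' => (t : ℝ) ^ (deficit s / p) * ‖b n - b n'‖) atTop
            (𝓝 ((t : ℝ) ^ (deficit s / p) * ‖b n - b₀‖)) :=
          ((tendsto_const_nhds.sub h4).norm).const_mul _
        refine le_of_tendsto h6 ?_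
        filter_upwards [hev] with n' hn'
        exact (h5 n n').trans hn'
  have hfm : xENorm p s T f < ⊤ := by
    obtain ⟨N, hN⟩ := hbound 1 one_pos
    have h1 : XT.toC (u N) - f ∈ xSubmodule p s T := (hN N le_rfl).trans_lt ENNReal.ofReal_lt_top
    have h2 : XT.toC (u N) ∈ xSubmodule p s T := (u N).2
    have h3 := (xSubmodule p s T).sub_mem h2 h1
    rwa [sub_sub_cancel] at h3
  refine ⟨XT.mk f hfm, ?_⟩
  rw [Metric.tendsto_atTop]
  intro ε hε
  obtain ⟨N, hN⟩ := hbound (ε / 4) (by positivity)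
  refine ⟨N, fun n hn => ?_⟩
  rw [dist_eq_norm]
  have h1 : ‖u n - XT.mk f hfm‖ ≤ 3 * (ε / 4) := by
    refine ENNReal.toReal_le_of_le_ofReal (by positivity) ?_
    have h2 : XT.toC (u n - XT.mk f hfm) = XT.toC (u n) - f := by rw [map_sub, XT.toC_mk]
    rw [h2]
    exact hN n hn
  linarith

open Classical in
/-- The coordinate of `F(τ)` in `H^max(s,0)`, for `0 < τ ≤ T`; zero for other `τ`. -/
def XT.rep (F : XT p s T) (τ : ℝ) : L2R :=
  if h : ∃ (hτ : τ ∈ Ioc 0 T) (b : L2R),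
    coord s (XT.toC F ⟨τ, hτ.1.le, hτ.2⟩) = smoothing (deficit s) b then h.choose_spec.choose
  else 0

theorem XT.rep_spec (F : XT p s T) {τ : ℝ} (hτ : τ ∈ Ioc 0 T) :
    coord s (XT.toC F ⟨τ, hτ.1.le, hτ.2⟩) = smoothing (deficit s) (F.rep τ) := by
  obtain ⟨b, hb, -⟩ := XT.exists_coord F ⟨τ, hτ.1.le, hτ.2⟩ hτ.1
  have h : ∃ (hτ : τ ∈ Ioc 0 T) (b : L2R),
    coord s (XT.toC F ⟨τ, hτ.1.le, hτ.2⟩) = smoothing (deficit s) b := ⟨hτ, b, hb⟩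
  rw [XT.rep, dif_pos h]
  exact h.choose_spec.choose_spec

theorem XT.rep_eq (F : XT p s T) {τ : ℝ} (hτ : τ ∈ Ioc 0 T) {b : L2R}
    (hb : coord s (XT.toC F ⟨τ, hτ.1.le, hτ.2⟩) = smoothing (deficit s) b) : F.rep τ = b :=
  smoothing_injective (deficit_nonneg s) ((F.rep_spec hτ).symm.trans hb)

theorem XT.norm_rep_le (F : XT p s T) {τ : ℝ} (hτ : τ ∈ Ioc 0 T) :
    ‖F.rep τ‖ ≤ ‖F‖ * τ ^ (-(deficit s / p)) := by
  obtain ⟨b, hb, hb'⟩ := XT.exists_coord F ⟨τ, hτ.1.le, hτ.2⟩ hτ.1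
  rw [F.rep_eq hτ hb, Real.rpow_neg hτ.1.le, ← div_eq_mul_inv,
    le_div_iff₀ (Real.rpow_pos_of_pos hτ.1 _), mul_comm]
  exact hb'

theorem XT.rep_add (F G : XT p s T) {τ : ℝ} (hτ : τ ∈ Ioc 0 T) :
    (F + G).rep τ = F.rep τ + G.rep τ := by
  refine XT.rep_eq _ hτ ?_
  rw [map_add, map_add, ← F.rep_spec hτ, ← G.rep_spec hτ, ContinuousMap.add_apply,
    map_add]

theorem XT.rep_smul (c : ℂ) (F : XT p s T) {τ : ℝ} (hτ : τ ∈ Ioc 0 T) :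
    (c • F).rep τ = c • F.rep τ := by
  refine XT.rep_eq _ hτ ?_
  rw [map_smul, map_smul, ← F.rep_spec hτ, ContinuousMap.smul_apply, map_smul]

/-- If a family in `L²` becomes measurable after smoothing, it is measurable: it is the pointwise
limit of its frequency truncations, on which smoothing is invertible. -/
theorem aestronglyMeasurable_of_smoothing {θ : ℝ} (hθ : 0 ≤ θ) {μ : Measure ℝ} {y b : ℝ → L2R}
    (hy : AEStronglyMeasurable y μ) (h : ∀ᵐ τ ∂μ, y τ = smoothing θ (b τ)) :
    AEStronglyMeasurable b μ := by
  set χ : ℕ → ℝ → ℂ := fun N => (Icc (-(N : ℝ)) N).indicator 1 with hχ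
  have hχm : ∀ N, Measurable (χ N) := fun N => measurable_one.indicator measurableSet_Icc
  have hχb : ∀ N ξ, ‖χ N ξ‖ ≤ 1 := fun N ξ =>
    (norm_indicator_le_norm_self _ _).trans (by simp)
  have hs : ∀ N, IsSymbol fun ξ => χ N ξ * (jb θ ξ : ℂ) := fun N => by
    refine ⟨(hχm N).mul (by fun_prop), jb θ N, fun ξ => ?_⟩
    by_cases hξ : ξ ∈ Icc (-(N : ℝ)) N
    · rw [hχ]
      simp only
      rw [indicator_of_mem hξ, Pi.one_apply, one_mul, Complex.norm_real,
        Real.norm_of_nonneg (jb_pos _ _).le]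
      unfold jb
      have h2 : ξ ^ 2 ≤ (N : ℝ) ^ 2 := sq_le_sq' hξ.1 hξ.2
      gcongr
    · rw [hχ]
      simp only
      rw [indicator_of_notMem hξ, zero_mul, norm_zero]
      exact (jb_pos _ _).le
  refine aestronglyMeasurable_of_tendsto_ae (u := atTop)
    (f := fun (N : ℕ) τ => mulOp (fun ξ => χ N ξ * (jb θ ξ : ℂ)) (y τ))
    (fun N => (mulOp fun ξ => χ N ξ * (jb θ ξ : ℂ)).continuous.comp_aestronglyMeasurable hy) ?_
  filter_upwards [h] with τ hτ
  have h1 : ∀ N, mulOp (fun ξ => χ N ξ * (jb θ ξ : ℂ)) (y τ) = mulOp (χ N) (b τ) := fun N => by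
    rw [hτ, smoothing, mulOp_mulOp (hs N) (isSymbol_jb (by linarith))]
    congr 2
    ext ξ
    have h2 : (jb θ ξ : ℂ) * (jb (-θ) ξ : ℂ) = 1 := by exact_mod_cast jb_mul_neg θ ξ
    rw [mul_assoc, h2, mul_one]
  simp only [h1]
  have h2 := tendsto_mulOp (l := atTop) (φ := χ) (φ₀ := fun _ => 1) (C := 1)
    (Eventually.of_forall hχm) (Eventually.of_forall hχb) measurable_const (by simp)
    (fun ξ => by
      refine Tendsto.congr' ?_ tendsto_const_nhds
      obtain ⟨N₀, hN₀⟩ := exists_nat_ge |ξ|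
      filter_upwards [eventually_ge_atTop N₀] with N hN
      have h3 : |ξ| ≤ N := hN₀.trans (by exact_mod_cast hN)
      simp only [hχ]
      rw [indicator_of_mem (show ξ ∈ Icc (-(N : ℝ)) N from abs_le.1 h3), Pi.one_apply]) (b τ)
  rwa [mulOp_one] at h2

theorem XT.aestronglyMeasurable_rep (hT0 : 0 ≤ T) (F : XT p s T) :
    AEStronglyMeasurable F.rep (volume.restrict (Ioc 0 T)) := by
  have hc : Continuous fun τ => coord s (IccExtend hT0 (XT.toC F) τ) :=
    (coord s).continuous.comp (XT.toC F).continuous.Icc_extend'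
  refine aestronglyMeasurable_of_smoothing (deficit_nonneg s) hc.aestronglyMeasurable ?_
  filter_upwards [ae_restrict_mem measurableSet_Ioc] with τ hτ
  rw [IccExtend_of_mem _ _ ⟨hτ.1.le, hτ.2⟩]
  exact F.rep_spec hτ

end

/-! ### The integral equation in `XT` -/

section

/-- The exponents of the fixed point argument: `κ` is the loss of smoothness in the product
`H^σ × H^σ → H^(σ-κ)`, and `γ < 1` bounds the singularities of the Duhamel kernels, both those with
values in `H^s` (`base`) and those with values in `H^max(s,0)` (`top`). -/
structure Exponents (p s κ γ : ℝ) : Prop where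
  hp : 3 < p
  hκ : 1 / 2 < κ
  hκ1 : κ < 1
  base : max (1 + κ - deficit s) 0 / p + 2 * (deficit s / p) ≤ γ
  top : (1 + κ) / p + deficit s / p ≤ γ
  hγ : γ < 1

theorem exists_exponents {p s : ℝ} (hp : 3 < p) (hs : -p / 2 < s) :
    ∃ κ γ, Exponents p s κ γ := by
  obtain ⟨κ, hκ, hκ'⟩ := exists_between (show (1 : ℝ) / 2 < min 1 (p / 2 - 1) from
    lt_min (by norm_num) (by linarith))
  have hκ1 := hκ'.trans_le (min_le_left _ _)
  have hκp := hκ'.trans_le (min_le_right _ _)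
  have hp0 : 0 < p := by linarith
  have hθ : deficit s < p / 2 := max_lt (by linarith) (by linarith)
  refine ⟨κ, _, hp, hκ, hκ1, le_max_left _ ((1 + κ) / p + deficit s / p), le_max_right _ _,
    max_lt ?_ ?_⟩
  · have h1 : max (1 + κ - deficit s) 0 / p + 2 * (deficit s / p) =
        (max (1 + κ - deficit s) 0 + 2 * deficit s) / p := by ring
    rw [h1, div_lt_one hp0]
    rcases max_choice (1 + κ - deficit s) 0 with h | h <;> rw [h] <;> linarith
  · rw [← add_div, div_lt_one hp0]
    linarith

variable {p s κ γ T : ℝ} {m : ℝ → ℂ}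

theorem Exponents.p_pos (e : Exponents p s κ γ) : 0 < p := by linarith [e.hp]

theorem Exponents.weight_nonneg (e : Exponents p s κ γ) : 0 ≤ deficit s / p :=
  div_nonneg (deficit_nonneg s) e.p_pos.le

theorem Exponents.two_mul_le (e : Exponents p s κ γ) : 2 * (deficit s / p) ≤ γ := by
  have h := e.base
  have : 0 ≤ max (1 + κ - deficit s) 0 / p := div_nonneg (le_max_right _ _) e.p_pos.le
  linarith

theorem Exponents.two_mul_lt (e : Exponents p s κ γ) : 2 * (deficit s / p) < 1 :=
  e.two_mul_le.trans_lt e.hγ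

theorem Exponents.γ_nonneg (e : Exponents p s κ γ) : 0 ≤ γ := by
  linarith [e.two_mul_le, e.weight_nonneg]

theorem weighted_rpow_le_ker {a b γ t τ : ℝ} (ha : 0 ≤ a) (hb : 0 ≤ b) (hb1 : b ≤ 1)
    (hab : a + b ≤ γ) (h2b : 2 * b ≤ γ) (hτ : 0 < τ) (hτt : τ < t) (ht : t ≤ 1) :
    t ^ b * ((t - τ) ^ (-a) * τ ^ (-(2 * b))) ≤ 2 * ker γ t τ := by
  have hr : 0 < t - τ := by linarith
  have ht0 : 0 < t := by linarith
  have h2 : (2 : ℝ) ^ b ≤ 2 := by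
    simpa using Real.rpow_le_rpow_of_exponent_le (one_le_two (α := ℝ)) hb1
  rcases le_total (t - τ) τ with hle | hle
  · have h1 : t ^ b ≤ 2 * τ ^ b := by
      calc t ^ b ≤ (2 * τ) ^ b := Real.rpow_le_rpow ht0.le (by linarith) hb
        _ = 2 ^ b * τ ^ b := Real.mul_rpow zero_le_two hτ.le
        _ ≤ _ := by gcongr
    have h3 := rpow_mul_rpow_le_ker ha hb hab hτ hτt ht
    calc t ^ b * ((t - τ) ^ (-a) * τ ^ (-(2 * b)))
        ≤ 2 * τ ^ b * ((t - τ) ^ (-a) * τ ^ (-(2 * b))) := by gcongr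
      _ = 2 * ((t - τ) ^ (-a) * (τ ^ b * τ ^ (-(2 * b)))) := by ring
      _ = 2 * ((t - τ) ^ (-a) * τ ^ (-b)) := by
        rw [← Real.rpow_add hτ]
        ring_nf
      _ ≤ _ := by gcongr
  · have h1 : t ^ b ≤ 2 * (t - τ) ^ b := by
      calc t ^ b ≤ (2 * (t - τ)) ^ b := Real.rpow_le_rpow ht0.le (by linarith) hb
        _ = 2 ^ b * (t - τ) ^ b := Real.mul_rpow zero_le_two hr.le
        _ ≤ _ := by gcongr
    have h3 : (t - τ) ^ (b - a) * τ ^ (-(2 * b)) ≤ ker γ t τ := by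
      rcases le_total a b with hab' | hab'
      · have h4 : (t - τ) ^ (b - a) ≤ (t - τ) ^ (-(0 : ℝ)) := by
          rw [neg_zero, Real.rpow_zero]
          exact Real.rpow_le_one hr.le (by linarith) (by linarith)
        refine (mul_le_mul_of_nonneg_right h4 (by positivity)).trans ?_
        exact rpow_mul_rpow_le_ker le_rfl (by positivity) (by linarith) hτ hτt ht
      · have := rpow_mul_rpow_le_ker (a := a - b) (b := 2 * b) (γ := γ) (by linarith)
          (by positivity) (by linarith) hτ hτt ht
        rwa [neg_sub] at this
    calc t ^ b * ((t - τ) ^ (-a) * τ ^ (-(2 * b)))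
        ≤ 2 * (t - τ) ^ b * ((t - τ) ^ (-a) * τ ^ (-(2 * b))) := by gcongr
      _ = 2 * ((t - τ) ^ b * (t - τ) ^ (-a) * τ ^ (-(2 * b))) := by ring
      _ = 2 * ((t - τ) ^ (b - a) * τ ^ (-(2 * b))) := by
        rw [← Real.rpow_add hr, show b + -a = b - a by ring]
      _ ≤ _ := by gcongr

theorem ker_nonneg {γ t τ : ℝ} (hτ : 0 < τ) (hτt : τ < t) : 0 ≤ ker γ t τ := by
  have : 0 < t - τ := by linarith
  unfold ker
  positivity

/-- The weighted bound for the kernel with values in `H^max(s,0)`. -/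
theorem Exponents.exists_weighted_dsemi_le (e : Exponents p s κ γ) (h : DissSymbol m p) :
    ∃ C : ℝ, 0 ≤ C ∧ ∀ t τ : ℝ, 0 < τ → τ < t → t ≤ 1 → ∀ x : L2R,
      t ^ (deficit s / p) * (τ ^ (-(2 * (deficit s / p))) * ‖dsemi m κ (t - τ) x‖) ≤
        C * ker γ t τ * ‖x‖ := by
  have hκ := e.hκ
  obtain ⟨C, hC0, hC⟩ := h.exists_norm_dsemi_le e.p_pos κ (γ := 1 + κ) (by linarith) le_rfl
  refine ⟨2 * C, by positivity, fun t τ hτ hτt ht x => ?_⟩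
  have hr : 0 < t - τ := by linarith
  have ht0 : 0 < t := by linarith
  have h1 := hC (t - τ) hr (by linarith) x
  have hp := e.p_pos
  have h2 := weighted_rpow_le_ker (a := (1 + κ) / p) (γ := γ) (by positivity) e.weight_nonneg
    (by linarith [e.two_mul_lt, e.weight_nonneg]) e.top e.two_mul_le hτ hτt ht
  calc _ ≤ t ^ (deficit s / p) * (τ ^ (-(2 * (deficit s / p))) *
        (C * (t - τ) ^ (-((1 + κ) / p)) * ‖x‖)) := by gcongr
    _ = C * ‖x‖ * (t ^ (deficit s / p) * ((t - τ) ^ (-((1 + κ) / p)) *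
        τ ^ (-(2 * (deficit s / p))))) := by ring
    _ ≤ C * ‖x‖ * (2 * ker γ t τ) := by gcongr
    _ = _ := by ring

/-- The properties of the Duhamel integral of a forcing which is `O(τ^(-2s⁻/p))` in
`H^(max(s,0)-κ)`. -/
structure DuhamelBound (m : ℝ → ℂ) (p s κ : ℝ) (g : ℝ → L2R) (t A : ℝ) : Prop where
  integrable : IntervalIntegrable (fun τ => dsemi m (κ - deficit s) (t - τ) (g τ)) volume 0 t
  norm_le : ‖duhamel m (κ - deficit s) g t‖ ≤ A
  integrable_top : IntervalIntegrable (fun τ => dsemi m κ (t - τ) (g τ)) volume 0 t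
  eq_smoothing : duhamel m (κ - deficit s) g t = smoothing (deficit s) (duhamel m κ g t)
  norm_top_le : t ^ (deficit s / p) * ‖duhamel m κ g t‖ ≤ A

theorem Exponents.exists_duhamelBound (e : Exponents p s κ γ) (h : DissSymbol m p) :
    ∃ C : ℝ, 0 ≤ C ∧ ∀ {T A : ℝ} {g : ℝ → L2R}, T ≤ 1 → 0 ≤ A →
      Forcing T (2 * (deficit s / p)) A g →
        ContinuousOn (duhamel m (κ - deficit s) g) (Icc 0 T) ∧
        ∀ t ∈ Icc 0 T, DuhamelBound m p s κ g t (C * t ^ (1 - γ) * A) := by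
  have hp := e.p_pos
  have hγ1 : 0 < 1 - γ := by linarith [e.hγ]
  have hb : 0 ≤ 2 * (deficit s / p) := by linarith [e.weight_nonneg]
  obtain ⟨C₁, hC₁0, hC₁⟩ := h.exists_dsemi_forcing_le hp (ρ := κ - deficit s)
    (γ' := max (1 + κ - deficit s) 0) (le_max_right _ _)
    (by rw [← add_sub_assoc]; exact le_max_left _ _) hb e.base
  obtain ⟨C₂, hC₂0, hC₂⟩ := e.exists_weighted_dsemi_le h
  refine ⟨(C₁ + C₂) * (2 / (1 - γ)), by positivity, fun {T A g} hT hA hg => ⟨?_, fun t ht => ?_⟩⟩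
  · exact h.continuousOn_duhamel hp hg hT hA (γ' := max (1 + κ - deficit s) 0) (le_max_right _ _)
      (by rw [← add_sub_assoc]; exact le_max_left _ _) hb (e.base.trans_lt e.hγ)
  have ht1 : t ≤ 1 := ht.2.trans hT
  have hgt := hg.mono ht.2
  have h1 := h.intervalIntegrable_duhamel hp hgt ht.1 ht1 e.hγ (D := C₁ * A)
    fun τ hτ hτt => hC₁ hA ht1 hgt τ hτ hτt
  have htγ : 0 ≤ t ^ (1 - γ) := Real.rpow_nonneg ht.1 _
  have hle1 : C₁ * A * (2 * t ^ (1 - γ) / (1 - γ)) ≤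
      (C₁ + C₂) * (2 / (1 - γ)) * t ^ (1 - γ) * A := by
    calc _ = C₁ * (2 / (1 - γ)) * t ^ (1 - γ) * A := by ring
      _ ≤ _ := by gcongr; linarith
  rcases ht.1.eq_or_lt with h0 | h0
  · subst h0
    have h2 : ∀ ρ, duhamel m ρ g 0 = 0 := fun ρ => intervalIntegral.integral_same
    refine ⟨h1.1, h1.2.trans hle1, IntervalIntegrable.refl, by rw [h2, h2, map_zero], ?_⟩
    rw [h2, norm_zero, mul_zero]
    positivity
  · have htβ : 0 < t ^ (deficit s / p) := Real.rpow_pos_of_pos h0 _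
    have h2 := h.intervalIntegrable_duhamel hp (ρ := κ) hgt ht.1 ht1 e.hγ
      (D := (t ^ (deficit s / p))⁻¹ * (C₂ * A)) fun τ hτ hτt => by
        have h3 := hC₂ t τ hτ hτt ht1 (g τ)
        have h4 := hgt.le τ ⟨hτ, hτt.le⟩
        have h5 : 0 < τ ^ (-(2 * (deficit s / p))) := Real.rpow_pos_of_pos hτ _
        have h6 := ker_nonneg (γ := γ) hτ hτt
        have h7 : τ ^ (-(2 * (deficit s / p))) * (t ^ (deficit s / p) *
            ‖dsemi m κ (t - τ) (g τ)‖) ≤ τ ^ (-(2 * (deficit s / p))) * (C₂ * A * ker γ t τ) := by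
          calc _ = t ^ (deficit s / p) * (τ ^ (-(2 * (deficit s / p))) *
                ‖dsemi m κ (t - τ) (g τ)‖) := by ring
            _ ≤ C₂ * ker γ t τ * ‖g τ‖ := h3
            _ ≤ C₂ * ker γ t τ * (A * τ ^ (-(2 * (deficit s / p)))) := by gcongr
            _ = _ := by ring
        have h8 := le_of_mul_le_mul_left h7 h5
        rw [mul_assoc, le_inv_mul_iff₀ htβ]
        exact h8
    refine ⟨h1.1, h1.2.trans hle1, h2.1, (h.smoothing_duhamel hp (deficit_nonneg s) ht.1 ht1
      h2.1).symm, ?_⟩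
    calc t ^ (deficit s / p) * ‖duhamel m κ g t‖
        ≤ t ^ (deficit s / p) * ((t ^ (deficit s / p))⁻¹ * (C₂ * A) *
          (2 * t ^ (1 - γ) / (1 - γ))) := by
          gcongr
          exact h2.2
      _ = (t ^ (deficit s / p) * (t ^ (deficit s / p))⁻¹) *
          (C₂ * (2 / (1 - γ)) * t ^ (1 - γ) * A) := by ring
      _ = C₂ * (2 / (1 - γ)) * t ^ (1 - γ) * A := by rw [mul_inv_cancel₀ htβ.ne', one_mul]
      _ ≤ _ := by gcongr; linarith

/-- The product at the level of `H^max(s,0)`. -/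
def Exponents.prod (e : Exponents p s κ γ) : L2R →L[ℂ] L2R →L[ℂ] L2R :=
  prodOp (le_max_right s 0) e.hκ

theorem Exponents.forcing_of_le (e : Exponents p s κ γ) {b b' : ℝ → L2R} {M M' : ℝ}
    (hb : AEStronglyMeasurable b (volume.restrict (Ioc 0 T)))
    (hb' : AEStronglyMeasurable b' (volume.restrict (Ioc 0 T))) (hM : 0 ≤ M)
    (h : ∀ τ ∈ Ioc 0 T, ‖b τ‖ ≤ M * τ ^ (-(deficit s / p)))
    (h' : ∀ τ ∈ Ioc 0 T, ‖b' τ‖ ≤ M' * τ ^ (-(deficit s / p))) :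
    Forcing T (2 * (deficit s / p)) (‖e.prod‖ * (M * M')) fun τ => e.prod (b τ) (b' τ) := by
  refine ⟨?_, fun τ hτ => ?_⟩
  · have : Continuous fun x : L2R × L2R => e.prod x.1 x.2 := by fun_prop
    exact Continuous.comp_aestronglyMeasurable (f := fun τ => (b τ, b' τ)) this (hb.prodMk hb')
  · have h2 : τ ^ (-(2 * (deficit s / p))) = τ ^ (-(deficit s / p)) * τ ^ (-(deficit s / p)) := by
      rw [← Real.rpow_add hτ.1]
      ring_nf
    have h3 : 0 ≤ τ ^ (-(deficit s / p)) := Real.rpow_nonneg hτ.1.le _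
    calc ‖e.prod (b τ) (b' τ)‖ ≤ ‖e.prod‖ * ‖b τ‖ * ‖b' τ‖ := e.prod.le_opNorm₂ _ _
      _ ≤ ‖e.prod‖ * (M * τ ^ (-(deficit s / p))) * (M' * τ ^ (-(deficit s / p))) := by
        gcongr
        · exact h τ hτ
        · exact h' τ hτ
      _ = _ := by rw [h2]; ring

theorem Exponents.forcing_rep (e : Exponents p s κ γ) (hT0 : 0 ≤ T) (F G : XT p s T) :
    Forcing T (2 * (deficit s / p)) (‖e.prod‖ * (‖F‖ * ‖G‖))
      fun τ => e.prod (F.rep τ) (G.rep τ) :=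
  e.forcing_of_le (F.aestronglyMeasurable_rep hT0) (G.aestronglyMeasurable_rep hT0) (norm_nonneg F)
    (fun _ hτ => F.norm_rep_le hτ) fun _ hτ => G.norm_rep_le hτ

theorem duhamel_congr {ρ t : ℝ} {g g' : ℝ → L2R} (ht : 0 ≤ t) (h : ∀ τ ∈ Ioc 0 t, g τ = g' τ) :
    duhamel m ρ g t = duhamel m ρ g' t := by
  refine intervalIntegral.integral_congr_ae (ae_of_all _ fun τ hτ => ?_)
  rw [uIoc_of_le ht] at hτ
  rw [h τ hτ]

theorem duhamel_add {ρ t : ℝ} {g g' : ℝ → L2R}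
    (h : IntervalIntegrable (fun τ => dsemi m ρ (t - τ) (g τ)) volume 0 t)
    (h' : IntervalIntegrable (fun τ => dsemi m ρ (t - τ) (g' τ)) volume 0 t) :
    duhamel m ρ (fun τ => g τ + g' τ) t = duhamel m ρ g t + duhamel m ρ g' t := by
  simp only [duhamel, map_add]
  exact intervalIntegral.integral_add h h'

theorem duhamel_smul {ρ t : ℝ} {g : ℝ → L2R} (c : ℂ) :
    duhamel m ρ (fun τ => c • g τ) t = c • duhamel m ρ g t := by
  simp only [duhamel, map_smul]
  exact intervalIntegral.integral_smul c _

/-- The bilinear Duhamel operator on `XT`; its norm tends to zero with `T`. -/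
theorem Exponents.exists_bilinear (e : Exponents p s κ γ) (h : DissSymbol m p) :
    ∃ C : ℝ, 0 ≤ C ∧ ∀ T : ℝ, 0 < T → T ≤ 1 → ∃ B : XT p s T →L[ℂ] XT p s T →L[ℂ] XT p s T,
      ‖B‖ ≤ C * T ^ (1 - γ) ∧ ∀ F G (t : Icc (0 : ℝ) T), coord s (XT.toC (B F G) t) =
        duhamel m (κ - deficit s) (fun τ => e.prod (F.rep τ) (G.rep τ)) t := by
  obtain ⟨C, hC0, hC⟩ := e.exists_duhamelBound h
  refine ⟨3 * C * ‖e.prod‖, by positivity, fun T hT0 hT => ?_⟩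
  set D : XT p s T → XT p s T → ℝ → L2R := fun F G =>
    duhamel m (κ - deficit s) fun τ => e.prod (F.rep τ) (G.rep τ) with hD
  have hdb := fun F G : XT p s T => hC hT (by positivity) (e.forcing_rep hT0.le F G)
  have hcont : ∀ F G, Continuous fun t : Icc (0 : ℝ) T => (coord s).symm (D F G t) := fun F G =>
    (coord s).symm.continuous.comp (continuousOn_iff_continuous_domRestrict.1 (hdb F G).1)
  set f : XT p s T → XT p s T → C(Icc (0 : ℝ) T, Hs s) := fun F G => ⟨_, hcont F G⟩ with hf
  have hfc : ∀ F G t, coord s (f F G t) = D F G t := fun F G t =>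
    (coord s).apply_symm_apply _
  have hTγ : ∀ t : Icc (0 : ℝ) T, (t : ℝ) ^ (1 - γ) ≤ T ^ (1 - γ) := fun t =>
    Real.rpow_le_rpow t.2.1 t.2.2 (by linarith [e.hγ])
  have hbound : ∀ F G, xENorm p s T (f F G) ≤
      ENNReal.ofReal (3 * C * ‖e.prod‖ * T ^ (1 - γ) * ‖F‖ * ‖G‖) := fun F G => by
    have h1 : ∀ t : Icc (0 : ℝ) T, C * (t : ℝ) ^ (1 - γ) * (‖e.prod‖ * (‖F‖ * ‖G‖)) ≤
        C * T ^ (1 - γ) * (‖e.prod‖ * (‖F‖ * ‖G‖)) := fun t => by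
      have := hTγ t
      gcongr
    refine (xENorm_le e.p_pos hT (A₁ := C * T ^ (1 - γ) * (‖e.prod‖ * (‖F‖ * ‖G‖)))
      (A₂ := C * T ^ (1 - γ) * (‖e.prod‖ * (‖F‖ * ‖G‖))) (fun t => ?_) (by positivity)
      (by positivity) fun t _ => ?_).trans (le_of_eq (by congr 1; ring))
    · rw [← LinearIsometryEquiv.norm_map (coord s), hfc]
      exact ((hdb F G).2 t t.2).norm_le.trans (h1 t)
    · refine ⟨_, (hfc F G t).trans ((hdb F G).2 t t.2).eq_smoothing, ?_⟩
      exact ((hdb F G).2 t t.2).norm_top_le.trans (h1 t)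
  have hfin : ∀ F G, xENorm p s T (f F G) < ⊤ := fun F G =>
    (hbound F G).trans_lt ENNReal.ofReal_lt_top
  have hext : ∀ (F G : XT p s T) (H : XT p s T),
      (∀ t : Icc (0 : ℝ) T, D F G t = coord s (XT.toC H t)) → XT.mk (f F G) (hfin F G) = H := by
    intro F G H hH
    refine XT.toC_injective ?_
    ext1 t
    exact (coord s).injective ((hfc F G t).trans (hH t))
  have hmk : ∀ F G t, coord s (XT.toC (XT.mk (f F G) (hfin F G)) t) = D F G t := fun F G t =>
    hfc F G t
  have hIoc : ∀ {t : Icc (0 : ℝ) T} {τ : ℝ}, τ ∈ Ioc 0 (t : ℝ) → τ ∈ Ioc 0 T := fun {t τ} hτ =>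
    ⟨hτ.1, hτ.2.trans t.2.2⟩
  set L : XT p s T →ₗ[ℂ] XT p s T →ₗ[ℂ] XT p s T :=
    LinearMap.mk₂ ℂ (fun F G => XT.mk (f F G) (hfin F G))
      (fun F F' G => hext _ _ _ fun t => by
        rw [map_add, ContinuousMap.add_apply, map_add, hmk, hmk, hD]
        simp only
        rw [← duhamel_add ((hdb F G).2 t t.2).integrable ((hdb F' G).2 t t.2).integrable]
        refine duhamel_congr t.2.1 fun τ hτ => ?_
        rw [XT.rep_add _ _ (hIoc hτ), map_add, _root_.add_apply])
      (fun c F G => hext _ _ _ fun t => by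
        rw [map_smul, ContinuousMap.smul_apply, map_smul, hmk, hD]
        simp only
        rw [← duhamel_smul]
        refine duhamel_congr t.2.1 fun τ hτ => ?_
        rw [XT.rep_smul _ _ (hIoc hτ), map_smul, _root_.smul_apply])
      (fun F G G' => hext _ _ _ fun t => by
        rw [map_add, ContinuousMap.add_apply, map_add, hmk, hmk, hD]
        simp only
        rw [← duhamel_add ((hdb F G).2 t t.2).integrable ((hdb F G').2 t t.2).integrable]
        refine duhamel_congr t.2.1 fun τ hτ => ?_
        rw [XT.rep_add _ _ (hIoc hτ), map_add])
      (fun c F G => hext _ _ _ fun t => by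
        rw [map_smul, ContinuousMap.smul_apply, map_smul, hmk, hD]
        simp only
        rw [← duhamel_smul]
        refine duhamel_congr t.2.1 fun τ hτ => ?_
        rw [XT.rep_smul _ _ (hIoc hτ), map_smul]) with hL
  have hle : ∀ F G, ‖L F G‖ ≤ 3 * C * ‖e.prod‖ * T ^ (1 - γ) * ‖F‖ * ‖G‖ := fun F G =>
    XT.norm_mk_le (hfin F G) (by positivity) (hbound F G)
  exact ⟨L.mkContinuous₂ _ hle, LinearMap.mkContinuous₂_norm_le _ (by positivity) _, hmk⟩

/-- The free evolution as a map into `XT`, bounded uniformly in `T ≤ 1`. -/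
theorem Exponents.exists_linear (e : Exponents p s κ γ) (h : DissSymbol m p) :
    ∃ C : ℝ, 0 ≤ C ∧ ∀ T : ℝ, 0 < T → T ≤ 1 → ∃ V : Hs s →L[ℂ] XT p s T,
      ‖V‖ ≤ C ∧ ∀ f (t : Icc (0 : ℝ) T), coord s (XT.toC (V f) t) = semi m 0 t (coord s f) := by
  obtain ⟨C₁, hC₁0, hC₁⟩ := h.exists_norm_exp_le
  obtain ⟨C₂, hC₂0, hC₂⟩ := h.exists_norm_semi_le e.p_pos (deficit s) (deficit_nonneg s) le_rfl
  refine ⟨2 * C₁ + C₂, by positivity, fun T hT0 hT => ?_⟩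
  have hcont : ∀ v : Hs s, Continuous fun t : Icc (0 : ℝ) T =>
      (coord s).symm (semi m 0 t (coord s v)) := fun v =>
    (coord s).symm.continuous.comp (continuousOn_iff_continuous_domRestrict.1
      ((h.continuousOn_semi (coord s v)).mono (Icc_subset_Icc_right hT)))
  set f : Hs s → C(Icc (0 : ℝ) T, Hs s) := fun v => ⟨_, hcont v⟩ with hf
  have hfc : ∀ v t, coord s (f v t) = semi m 0 t (coord s v) := fun v t =>
    (coord s).apply_symm_apply _
  have hbound : ∀ v, xENorm p s T (f v) ≤ ENNReal.ofReal ((2 * C₁ + C₂) * ‖v‖) := fun v => by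
    refine (xENorm_le e.p_pos hT (A₁ := C₁ * ‖v‖)
      (A₂ := C₂ * ‖v‖) (fun t => ?_) (by positivity)
      (by positivity) fun t ht => ⟨semi m (deficit s) t (coord s v), ?_, ?_⟩).trans
      (le_of_eq (by congr 1; ring))
    · rw [← LinearIsometryEquiv.norm_map (coord s), hfc, ← LinearIsometryEquiv.norm_map (coord s) v]
      exact hC₁ t t.2.1 (t.2.2.trans hT) _
    · rw [hfc, h.smoothing_semi e.p_pos (deficit_nonneg s) _ ht (t.2.2.trans hT), sub_self]
    · have h1 := hC₂ t ht (t.2.2.trans hT) (coord s v)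
      rw [LinearIsometryEquiv.norm_map, Real.rpow_neg t.2.1] at h1
      have h2 : 0 < (t : ℝ) ^ (deficit s / p) := Real.rpow_pos_of_pos ht _
      calc _ ≤ (t : ℝ) ^ (deficit s / p) * (C₂ * ((t : ℝ) ^ (deficit s / p))⁻¹ * ‖v‖) := by gcongr
        _ = C₂ * ‖v‖ := by field_simp
  have hfin : ∀ v, xENorm p s T (f v) < ⊤ := fun v => (hbound v).trans_lt ENNReal.ofReal_lt_top
  have hext : ∀ (v : Hs s) (H : XT p s T),
      (∀ t : Icc (0 : ℝ) T, semi m 0 t (coord s v) = coord s (XT.toC H t)) →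
        XT.mk (f v) (hfin v) = H := by
    intro v H hH
    refine XT.toC_injective ?_
    ext1 t
    exact (coord s).injective ((hfc v t).trans (hH t))
  have hmk : ∀ v t, coord s (XT.toC (XT.mk (f v) (hfin v)) t) = semi m 0 t (coord s v) :=
    fun v t => hfc v t
  set L : Hs s →ₗ[ℂ] XT p s T :=
    { toFun := fun v => XT.mk (f v) (hfin v)
      map_add' := fun v w => hext _ _ fun t => by
        rw [map_add, map_add, map_add, ContinuousMap.add_apply, map_add, hmk, hmk]
      map_smul' := fun c v => hext _ _ fun t => by
        rw [RingHom.id_apply, map_smul, map_smul, map_smul, ContinuousMap.smul_apply, map_smul,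
          hmk] } with hL
  have hle : ∀ v, ‖L v‖ ≤ (2 * C₁ + C₂) * ‖v‖ := fun v =>
    XT.norm_mk_le (hfin v) (by positivity) (hbound v)
  exact ⟨L.mkContinuous _ hle, LinearMap.mkContinuous_norm_le _ (by positivity) _, hmk⟩

/-- `V` satisfies the integral equation with initial value `v₀`. -/
def IsMild (m : ℝ → ℂ) (e : Exponents p s κ γ) (v₀ : Hs s) (V : XT p s T) : Prop :=
  ∀ t : Icc (0 : ℝ) T, coord s (XT.toC V t) = semi m 0 t (coord s v₀) -
    duhamel m (κ - deficit s) (fun τ => e.prod (V.rep τ) (V.rep τ)) t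

/-- On a time interval which depends only on `R` the integral equation has a solution for all
initial values in the ball of radius `R`, which depends smoothly on the initial value. -/
theorem Exponents.exists_solutionMap (e : Exponents p s κ γ) (h : DissSymbol m p) {R : ℝ}
    (hR : 0 < R) :
    ∃ (T : ℝ) (_ : 0 < T) (S : Hs s → XT p s T), T ≤ 1 ∧
      (∀ v₀, ‖v₀‖ < R → IsMild m e v₀ (S v₀)) ∧
      ContDiffOn ℂ ∞ S (Metric.ball 0 R) := by
  obtain ⟨C₀, hC₀0, hC₀⟩ := e.exists_linear h
  obtain ⟨C₁, hC₁0, hC₁⟩ := e.exists_bilinear h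
  set r := C₀ * R + 1 with hr
  have hr0 : 0 < r := by positivity
  obtain ⟨T, hT0, hT1, hTr⟩ : ∃ T : ℝ, 0 < T ∧ T ≤ 1 ∧ 8 * (C₁ * T ^ (1 - γ)) * r ≤ 1 := by
    have hlim : Tendsto (fun T : ℝ => 8 * (C₁ * T ^ (1 - γ)) * r) (𝓝[>] 0) (𝓝 0) := by
      have hγ1 : 0 < 1 - γ := by linarith [e.hγ]
      have h1 : Tendsto (fun T : ℝ => T ^ (1 - γ)) (𝓝[>] 0) (𝓝 0) := by
        have := (Real.continuousAt_rpow_const 0 (1 - γ) (Or.inr hγ1.le)).tendsto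
        rw [Real.zero_rpow hγ1.ne'] at this
        exact this.mono_left nhdsWithin_le_nhds
      simpa using ((h1.const_mul C₁).const_mul 8).mul_const r
    have hev := (hlim.eventually (eventually_le_nhds one_pos)).and (Ioc_mem_nhdsGT (zero_lt_one' ℝ))
    obtain ⟨T, hT, hT'⟩ := hev.exists
    exact ⟨T, hT'.1, hT'.2, hT⟩
  obtain ⟨V, hVn, hV⟩ := hC₀ T hT0 hT1
  obtain ⟨B, hBn, hB⟩ := hC₁ T hT0 hT1
  have : CompleteSpace (XT p s T) := XT.completeSpace e.p_pos hT1
  have hVr : ∀ v₀ : Hs s, ‖v₀‖ < R → ‖V v₀‖ < r := fun v₀ hv₀ => by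
    calc ‖V v₀‖ ≤ C₀ * ‖v₀‖ := (V.le_opNorm v₀).trans (by gcongr)
      _ ≤ C₀ * R := by gcongr
      _ < r := by linarith
  have hmild : ∀ v₀ W, W + B W W = V v₀ → IsMild m e v₀ W := fun v₀ W hW t => by
    rw [← hV, ← hB, ← hW, map_add, ContinuousMap.add_apply, map_add, add_sub_cancel_right]
  refine ⟨T, hT0, fun v₀ => quadSol B r (V v₀), hT1, fun v₀ hv₀ =>
    hmild v₀ _ (quadSol_spec hBn hTr (hVr v₀ hv₀)).1, ?_⟩
  refine (contDiffOn_quadSol hBn hTr).comp V.contDiff.contDiffOn fun v₀ hv₀ => ?_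
  rw [mem_ball_zero_iff] at hv₀
  exact mem_ball_zero_iff.2 (hVr v₀ hv₀)

end

/-! ### The symbol of the equation and the distributional pairings -/

section

/-- The symbol of `-∂ₓ³ - ηL`, as a function of the frequency in the convention
`∫ e^{-2πi x ξ} f(x) dx`. -/
def symbol (η : ℝ) (Φ : ℝ → ℝ) (ξ : ℝ) : ℂ := -dSym ξ ^ 3 + η * Φ (2 * Real.pi * ξ)

/-- The lower order term is absorbed by half of the leading term. -/
theorem exists_mul_one_add_rpow_le {p q C : ℝ} (hq : 0 ≤ q) (hqp : q < p) (hC : 0 ≤ C) :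
    ∃ M : ℝ, 0 ≤ M ∧ ∀ x : ℝ, 0 ≤ x → C * (1 + x ^ q) ≤ x ^ p / 2 + M := by
  set X : ℝ := (2 * C) ^ (1 / (p - q)) with hX
  have hX0 : 0 ≤ X := by positivity
  refine ⟨C * (1 + X ^ q), by positivity, fun x hx => ?_⟩
  rcases le_total x X with h | h
  · have h1 : x ^ q ≤ X ^ q := Real.rpow_le_rpow hx h hq
    have h2 : 0 ≤ x ^ p := Real.rpow_nonneg hx _
    have : C * (1 + x ^ q) ≤ C * (1 + X ^ q) := by gcongr
    linarith
  · have hXq : 0 ≤ X ^ q := by positivity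
    have h1 : 2 * C ≤ x ^ (p - q) := by
      calc 2 * C = X ^ (p - q) := by
            rw [hX, ← Real.rpow_mul (by positivity), one_div_mul_cancel (by linarith), Real.rpow_one]
        _ ≤ _ := Real.rpow_le_rpow hX0 h (by linarith)
    have h2 : x ^ p = x ^ (p - q) * x ^ q := by
      rcases hx.eq_or_lt with rfl | hx0
      · have hX0' : X = 0 := le_antisymm h hX0
        rw [Real.zero_rpow (by linarith : p ≠ 0), Real.zero_rpow (by linarith : p - q ≠ 0), zero_mul]
      · rw [← Real.rpow_add hx0, sub_add_cancel]
    have h3 : 0 ≤ x ^ q := Real.rpow_nonneg hx _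
    have h4 : 2 * C * x ^ q ≤ x ^ p := by
      rw [h2]
      gcongr
    nlinarith [mul_nonneg hC hXq]

theorem jb_le_rpow {p : ℝ} (hp : 0 ≤ p) (ξ : ℝ) :
    jb p ξ ≤ 2 ^ (p / 2) * (1 + |2 * Real.pi * ξ| ^ p) := by
  have hπ : 1 ≤ 2 * Real.pi := by linarith [Real.pi_gt_three]
  set x := |2 * Real.pi * ξ| with hx
  have hx0 : 0 ≤ x := abs_nonneg _
  have h1 : |ξ| ≤ x := by
    rw [hx, abs_mul, abs_of_pos (by positivity : 0 < 2 * Real.pi)]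
    nlinarith [abs_nonneg ξ]
  have h2 : ξ ^ 2 ≤ x ^ 2 := by
    rw [← sq_abs]
    gcongr
  have hxp : 0 ≤ x ^ p := Real.rpow_nonneg hx0 _
  unfold jb
  rcases le_total x 1 with h | h
  · calc (1 + ξ ^ 2) ^ (p / 2) ≤ 2 ^ (p / 2) :=
          Real.rpow_le_rpow (by positivity) (by nlinarith) (by linarith)
      _ ≤ _ := le_mul_of_one_le_right (by positivity) (by linarith)
  · calc (1 + ξ ^ 2) ^ (p / 2) ≤ (2 * x ^ 2) ^ (p / 2) :=
          Real.rpow_le_rpow (by positivity) (by nlinarith) (by linarith)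
      _ = 2 ^ (p / 2) * x ^ p := by
        rw [Real.mul_rpow zero_le_two (by positivity), ← Real.rpow_natCast x 2,
          ← Real.rpow_mul hx0]
        congr 2
        push_cast
        ring
      _ ≤ _ := by gcongr; linarith

theorem dSym_cube_re (ξ : ℝ) : (dSym ξ ^ 3).re = 0 := by
  have : dSym ξ ^ 3 = ((-(2 * Real.pi * ξ) ^ 3 : ℝ) : ℂ) * Complex.I := by
    unfold dSym
    push_cast
    rw [show (2 * (Real.pi : ℂ) * Complex.I * ξ) ^ 3 =
      (2 * (Real.pi : ℂ) * ξ) ^ 3 * (Complex.I ^ 2 * Complex.I) by ring, Complex.I_sq]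
    ring
  rw [this, Complex.re_ofReal_mul, Complex.I_re, mul_zero]

/-- The assumptions on `Φ` make the symbol dissipative of order `p`. -/
theorem dissSymbol_symbol {η : ℝ} (hη : 0 < η) {p q C : ℝ} (hp : 3 < p) (hq : 0 ≤ q)
    (hqp : q < p) {Φ Φ₁ : ℝ → ℝ} (hΦ₁meas : Measurable Φ₁)
    (hΦ₁ : ∀ ξ : ℝ, |Φ₁ ξ| ≤ C * (1 + |ξ| ^ q)) (hΦ : ∀ ξ : ℝ, Φ ξ = -|ξ| ^ p + Φ₁ ξ) :
    DissSymbol (symbol η Φ) p := by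
  have hp0 : 0 < p := by linarith
  have hC : 0 ≤ C := by
    have h1 := (abs_nonneg _).trans (hΦ₁ 1)
    rw [abs_one, Real.one_rpow] at h1
    linarith
  have hΦm : Measurable Φ := by
    rw [show Φ = fun ξ => -|ξ| ^ p + Φ₁ ξ from funext hΦ]
    fun_prop
  obtain ⟨M, hM0, hM⟩ := exists_mul_one_add_rpow_le hq hqp hC
  refine ⟨?_, ?_, ?_⟩
  · unfold symbol
    fun_prop
  · refine ⟨η / 2 * (2 ^ (p / 2))⁻¹, by positivity, η * (M + 1 / 2), by positivity, fun ξ => ?_⟩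
    have h1 := hM _ (abs_nonneg (2 * Real.pi * ξ))
    have h2 := (le_abs_self _).trans (hΦ₁ (2 * Real.pi * ξ))
    have h3 := jb_le_rpow hp0.le ξ
    have hre : (symbol η Φ ξ).re = η * Φ (2 * Real.pi * ξ) := by
      unfold symbol
      rw [Complex.add_re, Complex.neg_re, dSym_cube_re, neg_zero, zero_add, ← Complex.ofReal_mul,
        Complex.ofReal_re]
    have h4 : (2 ^ (p / 2))⁻¹ * jb p ξ ≤ 1 + |2 * Real.pi * ξ| ^ p := by
      rwa [inv_mul_le_iff₀ (by positivity)]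
    rw [hre, hΦ]
    have h5 : -|2 * Real.pi * ξ| ^ p + Φ₁ (2 * Real.pi * ξ) ≤
        (M + 1 / 2) - 1 / 2 * ((2 ^ (p / 2))⁻¹ * jb p ξ) := by linarith
    calc η * (-|2 * Real.pi * ξ| ^ p + Φ₁ (2 * Real.pi * ξ))
        ≤ η * ((M + 1 / 2) - 1 / 2 * ((2 ^ (p / 2))⁻¹ * jb p ξ)) := by gcongr
      _ = _ := by ring
  · have h1 : ∀ ξ, |2 * Real.pi * ξ| ^ p ≤ (2 * Real.pi) ^ p * jb p ξ := fun ξ => by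
      rw [abs_mul, abs_of_pos (by positivity : 0 < 2 * Real.pi),
        Real.mul_rpow (by positivity) (abs_nonneg _)]
      gcongr
      exact abs_rpow_le_jb hp0.le ξ
    refine ⟨(2 * Real.pi) ^ 3 + η * (2 * (2 * Real.pi) ^ p + M), p, fun ξ => ?_⟩
    have h2 := hM _ (abs_nonneg (2 * Real.pi * ξ))
    have h3 : |Φ (2 * Real.pi * ξ)| ≤ (2 * (2 * Real.pi) ^ p + M) * jb p ξ := by
      have h4 := hΦ₁ (2 * Real.pi * ξ)
      have h5 := h1 ξ
      have h6 := one_le_jb hp0.le ξ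
      have h7 : 0 ≤ |2 * Real.pi * ξ| ^ p := Real.rpow_nonneg (abs_nonneg _) _
      rw [hΦ]
      calc _ ≤ |2 * Real.pi * ξ| ^ p + |Φ₁ (2 * Real.pi * ξ)| := by
            refine (abs_add_le _ _).trans_eq ?_
            rw [abs_neg, abs_of_nonneg h7]
        _ ≤ _ := by nlinarith
    have h8 : ‖dSym ξ ^ 3‖ ≤ (2 * Real.pi) ^ 3 * jb p ξ := by
      rw [norm_pow]
      calc ‖dSym ξ‖ ^ 3 ≤ (2 * Real.pi * jb 1 ξ) ^ 3 := by
            gcongr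
            exact norm_dSym_le ξ
        _ = (2 * Real.pi) ^ 3 * jb 3 ξ := by
          rw [mul_pow, ← Real.rpow_natCast (jb 1 ξ) 3, jb_rpow]
          norm_num
        _ ≤ _ := by
          gcongr
          exact jb_mono hp.le ξ
    unfold symbol
    calc _ ≤ ‖dSym ξ ^ 3‖ + η * |Φ (2 * Real.pi * ξ)| := by
          refine (norm_add_le _ _).trans_eq ?_
          rw [norm_neg, norm_mul, Complex.norm_real, Complex.norm_real, Real.norm_eq_abs,
            abs_of_pos hη, Real.norm_eq_abs]
      _ ≤ (2 * Real.pi) ^ 3 * jb p ξ + η * ((2 * (2 * Real.pi) ^ p + M) * jb p ξ) := by gcongr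
      _ = _ := by ring

theorem fourierInv_derivCLM (ψ : 𝓢(ℝ, ℂ)) (ξ : ℝ) :
    (𝓕⁻ (SchwartzMap.derivCLM ℂ ℂ ψ) : 𝓢(ℝ, ℂ)) ξ = -dSym ξ * (𝓕⁻ ψ : 𝓢(ℝ, ℂ)) ξ := by
  rw [SchwartzMap.fourierInv_coe, SchwartzMap.fourierInv_coe, Real.fourierInv_eq_fourier_neg,
    Real.fourierInv_eq_fourier_neg]
  have h1 : (SchwartzMap.derivCLM ℂ ℂ ψ : ℝ → ℂ) = deriv ψ := funext fun x =>
    SchwartzMap.derivCLM_apply ℂ ψ x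
  have h2 : Integrable (deriv ψ) := by
    rw [← h1]
    exact (SchwartzMap.derivCLM ℂ ℂ ψ).integrable
  rw [h1, Real.fourier_deriv ψ.integrable ψ.differentiable h2]
  simp only [smul_eq_mul, dSym]
  push_cast
  ring

/-- The linear part of the equation, tested with `ψ`. -/
theorem pairDxxx_add_pairL {η : ℝ} {Φ : ℝ → ℝ} {p s : ℝ} (h : DissSymbol (symbol η Φ) p)
    (hη : η ≠ 0) (f : Hs s) (ψ : 𝓢(ℝ, ℂ)) :
    pairDxxx (Hs.toDist f) ψ + η * pairL Φ f ψ =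
      -pair (coord s f) (testVec (fun ξ => symbol η Φ ξ * jb (-s) ξ) (𝓕⁻ ψ)) := by
  have hd : PolyGrowth fun ξ => dSym ξ ^ 3 := by
    have := (polyGrowth_dSym.mul polyGrowth_dSym).mul polyGrowth_dSym
    refine ⟨by fun_prop, ?_⟩
    obtain ⟨C, N, hC⟩ := this.bdd
    refine ⟨C, N, fun ξ => ?_⟩
    rw [pow_three']
    exact hC ξ
  have hmul : ∀ ξ : ℝ, η * (Φ (2 * Real.pi * ξ) : ℂ) = symbol η Φ ξ + dSym ξ ^ 3 := fun ξ => by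
    unfold symbol
    ring
  have hmeas : Measurable fun ξ : ℝ => ((Φ (2 * Real.pi * ξ) : ℝ) : ℂ) := by
    have h1 := (h.meas.add hd.meas).const_mul (η : ℂ)⁻¹
    convert h1 using 2 with ξ
    rw [Pi.add_apply, ← hmul, inv_mul_cancel_left₀ (Complex.ofReal_ne_zero.2 hη)]
  have hΦg : PolyGrowth fun ξ => ((Φ (2 * Real.pi * ξ) : ℝ) : ℂ) := by
    obtain ⟨C, N, hCN⟩ := h.growth
    obtain ⟨C', N', hCN'⟩ := hd.bdd
    refine ⟨hmeas, |η|⁻¹ * (|C| + |C'|), max N N', fun ξ => ?_⟩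
    have h2 : |η| * ‖(Φ (2 * Real.pi * ξ) : ℂ)‖ ≤ (|C| + |C'|) * jb (max N N') ξ := by
      rw [← Real.norm_eq_abs η, ← Complex.norm_real η, ← norm_mul, hmul]
      have h3 := jb_mono (le_max_left N N') ξ
      have h4 := jb_mono (le_max_right N N') ξ
      have h5 := jb_pos N ξ
      have h6 := jb_pos N' ξ
      calc _ ≤ ‖symbol η Φ ξ‖ + ‖dSym ξ ^ 3‖ := norm_add_le _ _
        _ ≤ |C| * jb (max N N') ξ + |C'| * jb (max N N') ξ := by
          refine add_le_add ((hCN ξ).trans ?_) ((hCN' ξ).trans ?_)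
          · exact mul_le_mul (le_abs_self _) h3 h5.le (abs_nonneg _)
          · exact mul_le_mul (le_abs_self _) h4 h6.le (abs_nonneg _)
        _ = _ := by ring
    rw [mul_assoc |η|⁻¹, le_inv_mul_iff₀ (abs_pos.2 hη)]
    exact h2
  have hint : ∀ {k : ℝ → ℂ}, PolyGrowth k →
      Integrable fun ξ => coord s f ξ * (k ξ * (𝓕⁻ ψ : 𝓢(ℝ, ℂ)) ξ) := fun {k} hk =>
    (Lp.memLp (coord s f)).integrable_mul (hk.memLp _)
  have hj := polyGrowth_jb (-s)
  have h1 : pairDxxx (Hs.toDist f) ψ =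
      ∫ ξ, coord s f ξ * ((dSym ξ ^ 3 * jb (-s) ξ) * (𝓕⁻ ψ : 𝓢(ℝ, ℂ)) ξ) := by
    unfold pairDxxx
    rw [derivCLM_apply_apply, derivCLM_apply_apply, derivCLM_apply_apply]
    simp only [map_neg, neg_neg]
    rw [toDist_apply, hj.pair_testVec, ← integral_neg]
    refine integral_congr_ae (ae_of_all _ fun ξ => ?_)
    simp only [fourierInv_derivCLM]
    ring
  have h2 : η * pairL Φ f ψ = -∫ ξ, coord s f ξ *
      ((η * Φ (2 * Real.pi * ξ) * jb (-s) ξ) * (𝓕⁻ ψ : 𝓢(ℝ, ℂ)) ξ) := by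
    unfold pairL
    rw [← integral_const_mul, ← integral_neg]
    refine integral_congr_ae (ae_of_all _ fun ξ => ?_)
    simp only [hat_eq]
    ring
  have hηg : PolyGrowth fun _ : ℝ => (η : ℂ) :=
    ⟨measurable_const, ‖(η : ℂ)‖, 0, fun ξ => by rw [jb_zero, mul_one]⟩
  rw [h1, h2, (h.polyGrowth.mul hj).pair_testVec, ← sub_eq_add_neg,
    ← integral_sub (hint (hd.mul hj)) (hint ((hηg.mul hΦg).mul hj)), ← integral_neg]
  refine integral_congr_ae (ae_of_all _ fun ξ => ?_)
  simp only [symbol]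
  ring

/-- The nonlinear term of the equation, tested with `ψ`, for `u ∈ H^σ`. -/
theorem pairDxSq_eq {σ κ ρ s : ℝ} (hσ : 0 ≤ σ) (hκ : 1 / 2 < κ) (hρ : ρ - s = κ - σ) {u b : L2R}
    (hu : 𝓕 u = smoothing σ b) (ψ : 𝓢(ℝ, ℂ)) :
    pairDxSq u ψ = pair (prodOp hσ hκ b b)
      (testVec (fun ξ => dSym ξ * jb ρ ξ * jb (-s) ξ) (𝓕⁻ ψ)) := by
  have h1 := integral_conv_mul_eq (𝓕 u) (𝓕 u) (𝓕⁻ (SchwartzMap.derivCLM ℂ ℂ ψ))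
  rw [FourierTransform.fourierInv_fourier_eq, FourierTransform.fourier_fourierInv_eq] at h1
  have h2 : pairDxSq u ψ = -∫ x, u x * u x * (SchwartzMap.derivCLM ℂ ℂ ψ) x := by
    unfold pairDxSq
    simp only [SchwartzMap.derivCLM_apply, sq]
  rw [h2, ← h1, ((polyGrowth_dSym.mul (polyGrowth_jb ρ)).mul (polyGrowth_jb (-s))).pair_testVec,
    ← integral_neg, hu]
  refine integral_congr_ae ?_
  filter_upwards [coeFn_prodOp hσ hκ b b] with ξ hξ
  rw [hξ, fourierInv_derivCLM]
  have h3 : (jb (σ - κ) ξ : ℂ) * jb ρ ξ * jb (-s) ξ = 1 := by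
    rw [← Complex.ofReal_mul, ← Complex.ofReal_mul, ← jb_add, ← jb_add,
      show σ - κ + ρ + -s = 0 by linarith, jb_zero, Complex.ofReal_one]
  linear_combination -(conv (smoothing σ b) (smoothing σ b) ξ * dSym ξ *
    (𝓕⁻ ψ : 𝓢(ℝ, ℂ)) ξ) * h3

end

/-! ### Solutions of the integral equation solve the initial value problem -/

section

variable {p s κ γ T η : ℝ} {Φ : ℝ → ℝ} {m : ℝ → ℂ}

theorem IsMild.isSolution {e : Exponents p s κ γ} (h : DissSymbol (symbol η Φ) p) (hη : η ≠ 0)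
    (hT0 : 0 < T) (hT : T ≤ 1) {v₀ : Hs s} {V : XT p s T} (hV : IsMild (symbol η Φ) e v₀ V) :
    IsSolution η Φ s T v₀ (IccExtend hT0.le (XT.toC V)) := by
  set m := symbol η Φ with hm
  set v : ℝ → Hs s := IccExtend hT0.le (XT.toC V) with hv
  have hvc : Continuous v := (XT.toC V).continuous.Icc_extend'
  have hvt : ∀ t (ht : t ∈ Icc 0 T), v t = XT.toC V ⟨t, ht⟩ := fun t ht => by
    rw [hv, IccExtend_of_mem]
  set g : ℝ → L2R := fun τ => e.prod (V.rep τ) (V.rep τ) with hg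
  obtain ⟨C, hC0, hC⟩ := e.exists_duhamelBound h
  have hgF := e.forcing_rep hT0.le V V
  have hdb := hC hT (by positivity) hgF
  have hmild : ∀ t ∈ Icc 0 T, coord s (v t) = semi m 0 t (coord s v₀) -
      duhamel m (κ - deficit s) g t := fun t ht => by
    rw [hvt t ht]
    exact hV ⟨t, ht⟩
  have hrep : ∀ t ∈ Ioc 0 T, coord s (v t) = smoothing (deficit s) (V.rep t) := fun t ht => by
    rw [hvt t ⟨ht.1.le, ht.2⟩]
    exact V.rep_spec ht
  refine ⟨hvc.continuousOn, ?_, fun t => 𝓕⁻ (smoothing (max s 0) (V.rep t)), fun t ht =>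
    toDist_eq_of_coord (hrep t ht), fun ε hε => ⟨‖V‖ * ε ^ (-(deficit s / p)), fun t ht => ?_⟩,
    fun ψ a b ha hab hb => ?_⟩
  · refine (coord s).injective ?_
    rw [hmild 0 ⟨le_rfl, hT0.le⟩, DissSymbol.semi_zero]
    simp [duhamel]
  · have ht0 : t ∈ Ioc 0 T := ⟨hε.1.trans_le ht.1, ht.2⟩
    calc ‖(𝓕⁻ (smoothing (max s 0) (V.rep t)) : L2R)‖ = ‖smoothing (max s 0) (V.rep t)‖ :=
          (Lp.fourierTransformₗᵢ ℝ ℂ).symm.norm_map _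
      _ ≤ ‖V.rep t‖ := norm_smoothing_le (le_max_right _ _) _
      _ ≤ ‖V‖ * t ^ (-(deficit s / p)) := V.norm_rep_le ht0
      _ ≤ _ := by
        gcongr ?_ * ?_
        exact Real.rpow_le_rpow_of_nonpos hε.1 ht.1 (neg_nonpos.2 e.weight_nonneg)
  · set φ : 𝓢(ℝ, ℂ) := 𝓕⁻ ψ with hφ
    set U' := testVec (fun ξ => m ξ * jb (-s) ξ) φ with hU'
    set W := testVec (fun ξ => dSym ξ * jb (κ - deficit s) ξ * jb (-s) ξ) φ with hW
    set f : ℝ → ℂ := fun τ => pair (coord s (v τ)) U' - pair (g τ) W with hf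
    have heq : ∀ τ ∈ Ioc 0 T, pairDxxx (Hs.toDist (v τ)) ψ + η * pairL Φ (v τ) ψ +
        pairDxSq (𝓕⁻ (smoothing (max s 0) (V.rep τ)) : L2R) ψ = -f τ := fun τ hτ => by
      rw [pairDxxx_add_pairL h hη, pairDxSq_eq (le_max_right s 0) e.hκ
        (ρ := κ - deficit s) (s := s) (by linarith [max_sub_eq_deficit s])
        (FourierTransform.fourier_fourierInv_eq _)]
      simp only [hf, hg, neg_sub', sub_neg_eq_add]
      rfl
    have hfi : IntervalIntegrable f volume 0 T := by
      refine IntervalIntegrable.sub ?_ ?_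
      · have : Continuous fun τ => pair (coord s (v τ)) U' := by fun_prop
        exact this.intervalIntegrable _ _
      · have h1 := hgF.intervalIntegrable hT0.le e.two_mul_lt
        have h2 := (pair.flip W).integrable_comp h1.1
        exact ⟨h2, by simp [Ioc_eq_empty (not_lt.2 hT0.le)]⟩
    have hsub : ∀ {x y : ℝ}, 0 ≤ x → x ≤ y → y ≤ T → IntervalIntegrable f volume x y :=
      fun {x y} hx hxy hy => hfi.mono_set (by
        rw [uIcc_of_le hxy, uIcc_of_le hT0.le]
        exact Icc_subset_Icc hx hy)
    have hweak : ∀ t ∈ Icc 0 T, Hs.toDist (v t) ψ - Hs.toDist v₀ ψ = ∫ τ in (0 : ℝ)..t, f τ := by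
      intro t ht
      rw [toDist_apply, toDist_apply, hmild t ht]
      refine (h.weak_of_duhamel_testVec e.p_pos (polyGrowth_jb (-s)) hT e.two_mul_lt hgF
        (fun t ht => (hdb.2 t ht).integrable) hdb.1 (coord s v₀) φ ht).trans ?_
      refine intervalIntegral.integral_congr fun τ hτ => ?_
      rw [uIcc_of_le ht.1] at hτ
      simp only [hf]
      rw [hmild τ ⟨hτ.1, hτ.2.trans ht.2⟩]
    have hcongr : ∀ τ ∈ uIoc a b, pairDxxx (Hs.toDist (v τ)) ψ + η * pairL Φ (v τ) ψ +
        pairDxSq (𝓕⁻ (smoothing (max s 0) (V.rep τ)) : L2R) ψ = -f τ := fun τ hτ => by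
      rw [uIoc_of_le hab] at hτ
      exact heq τ ⟨ha.trans hτ.1, hτ.2.trans hb⟩
    refine ⟨(hsub ha.le hab hb).neg.congr fun τ hτ => (hcongr τ hτ).symm, ?_⟩
    rw [intervalIntegral.integral_congr_ae (ae_of_all _ hcongr), intervalIntegral.integral_neg]
    have h1 := hweak a ⟨ha.le, hab.trans hb⟩
    have h2 := hweak b ⟨ha.le.trans hab, hb⟩
    have h3 := intervalIntegral.integral_add_adjacent_intervals (hsub le_rfl ha.le (hab.trans hb))
      (hsub ha.le hab hb)
    linear_combination h2 - h1 - h3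

end

/-! ### Solutions satisfy the integral equation away from the initial time -/

section

variable {p s κ γ T η : ℝ} {Φ : ℝ → ℝ} {m : ℝ → ℂ}

theorem DissSymbol.exists_duhamel_bounded (h : DissSymbol m p) (hp : 0 < p) {ρ γ' : ℝ}
    (hγ' : 0 ≤ γ') (hργ : 1 + ρ ≤ γ') (hγp : γ' < p) :
    ∃ C : ℝ, 0 ≤ C ∧ ∀ {T A : ℝ} {g : ℝ → L2R}, T ≤ 1 → 0 ≤ A → Forcing T 0 A g →
      (∀ t ∈ Icc 0 T, IntervalIntegrable (fun τ => dsemi m ρ (t - τ) (g τ)) volume 0 t ∧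
        ‖duhamel m ρ g t‖ ≤ C * A) ∧ ContinuousOn (duhamel m ρ g) (Icc 0 T) := by
  have hγ1 : γ' / p < 1 := (div_lt_one hp).2 hγp
  obtain ⟨C, hC0, hC⟩ := h.exists_dsemi_forcing_le hp hγ' hργ le_rfl (γ := γ' / p)
    (by rw [add_zero])
  have h1 : 0 < 1 - γ' / p := by linarith
  refine ⟨C * (2 / (1 - γ' / p)), by positivity, fun {T A g} hT hA hg => ⟨fun t ht => ?_, ?_⟩⟩
  · have h2 := h.intervalIntegrable_duhamel hp (hg.mono ht.2) ht.1 (ht.2.trans hT) hγ1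
      (D := C * A) fun τ hτ hτt => hC hA (ht.2.trans hT) (hg.mono ht.2) τ hτ hτt
    refine ⟨h2.1, h2.2.trans ?_⟩
    have h3 : t ^ (1 - γ' / p) ≤ 1 := Real.rpow_le_one ht.1 (ht.2.trans hT) h1.le
    calc C * A * (2 * t ^ (1 - γ' / p) / (1 - γ' / p)) ≤ C * A * (2 * 1 / (1 - γ' / p)) := by gcongr
      _ = _ := by ring
  · exact h.continuousOn_duhamel hp hg hT hA hγ' hργ le_rfl (by linarith)

theorem DissSymbol.smoothing_semi_comm (h : DissSymbol m p) {θ : ℝ} (hθ : 0 ≤ θ) {r : ℝ}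
    (hr : 0 ≤ r) (hr1 : r ≤ 1) (a : L2R) :
    smoothing θ (semi m 0 r a) = semi m 0 r (smoothing θ a) := by
  have h1 := isSymbol_jb (neg_nonpos.2 hθ)
  have h2 := h.isSymbol_exp hr hr1
  unfold smoothing semi
  rw [mulOp_mulOp h1 h2, mulOp_mulOp h2 h1]
  simp only [mul_comm]

theorem forcing_prodOp {σ : ℝ} (hσ : 0 ≤ σ) (hκ : 1 / 2 < κ) {b : ℝ → L2R} {M : ℝ}
    (hb : AEStronglyMeasurable b (volume.restrict (Ioc 0 T))) (hM : 0 ≤ M)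
    (h : ∀ τ ∈ Ioc 0 T, ‖b τ‖ ≤ M) :
    Forcing T 0 (‖prodOp hσ hκ‖ * (M * M)) fun τ => prodOp hσ hκ (b τ) (b τ) := by
  refine ⟨?_, fun τ hτ => ?_⟩
  · have : Continuous fun x : L2R => prodOp hσ hκ x x := by fun_prop
    exact Continuous.comp_aestronglyMeasurable (f := b) this hb
  · rw [neg_zero, Real.rpow_zero, mul_one, ← mul_assoc]
    refine ((prodOp hσ hκ).le_opNorm₂ _ _).trans ?_
    have := h τ hτ
    gcongr

/-- While a solution is bounded in `H^σ`, it satisfies the integral equation in `H^σ`. -/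
theorem IsSolution.duhamel_eq (h : DissSymbol (symbol η Φ) p) (hη : η ≠ 0) (hp : 3 < p)
    (hκ : 1 / 2 < κ) (hκ1 : κ < 1) (hT : T ≤ 1) {v₀ : Hs s} {w : ℝ → Hs s}
    (hw : IsSolution η Φ s T v₀ w) {σ : ℝ} (hsσ : s ≤ σ) (hσ : 0 ≤ σ) {t₀ : ℝ} (ht₀ : t₀ ∈ Ioc 0 T)
    {b : ℝ → L2R} {M : ℝ} (hb : ∀ t ∈ Icc t₀ T, coord s (w t) = smoothing (σ - s) (b t))
    (hM : ∀ t ∈ Icc t₀ T, ‖b t‖ ≤ M) :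
    Forcing (T - t₀) 0 (‖prodOp hσ hκ‖ * (M * M))
      (fun τ => prodOp hσ hκ (b (t₀ + τ)) (b (t₀ + τ))) ∧
    ∀ t ∈ Icc 0 (T - t₀), b (t₀ + t) = semi (symbol η Φ) 0 t (b t₀) -
      duhamel (symbol η Φ) κ (fun τ => prodOp hσ hκ (b (t₀ + τ)) (b (t₀ + τ))) t := by
  set m := symbol η Φ with hm
  set g : ℝ → L2R := fun τ => prodOp hσ hκ (b (t₀ + τ)) (b (t₀ + τ)) with hg
  have hp0 : 0 < p := by linarith
  have hθ : 0 ≤ σ - s := by linarith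
  have hT' : T - t₀ ≤ 1 := by linarith [ht₀.1]
  have hT0' : 0 ≤ T - t₀ := by linarith [ht₀.2]
  have hmem : ∀ {τ}, τ ∈ Icc 0 (T - t₀) → t₀ + τ ∈ Icc t₀ T := fun {τ} hτ =>
    ⟨by linarith [hτ.1], by linarith [hτ.2]⟩
  have hM0 : 0 ≤ M := (norm_nonneg _).trans (hM t₀ ⟨le_rfl, ht₀.2⟩)
  set y : ℝ → L2R := fun τ => coord s (w (t₀ + τ)) with hy
  have hyc : ContinuousOn y (Icc 0 (T - t₀)) := by
    refine (coord s).continuous.comp_continuousOn (hw.continuousOn.comp (by fun_prop) ?_)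
    exact fun τ hτ => ⟨ht₀.1.le.trans (hmem hτ).1, (hmem hτ).2⟩
  have hyb : ∀ τ ∈ Icc 0 (T - t₀), y τ = smoothing (σ - s) (b (t₀ + τ)) := fun τ hτ =>
    hb _ (hmem hτ)
  have hbm : AEStronglyMeasurable (fun τ => b (t₀ + τ)) (volume.restrict (Ioc 0 (T - t₀))) := by
    refine aestronglyMeasurable_of_smoothing hθ
      ((hyc.mono Ioc_subset_Icc_self).aestronglyMeasurable measurableSet_Ioc) ?_
    exact (ae_restrict_iff' measurableSet_Ioc).2 (ae_of_all _ fun τ hτ =>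
      hyb τ (Ioc_subset_Icc_self hτ))
  have hgF : Forcing (T - t₀) 0 (‖prodOp hσ hκ‖ * (M * M)) g :=
    forcing_prodOp hσ hκ hbm hM0 fun τ hτ => hM _ (hmem (Ioc_subset_Icc_self hτ))
  obtain ⟨_, _, hC⟩ := h.exists_duhamel_bounded hp0 (ρ := κ) (γ' := 1 + κ) (by linarith) le_rfl
    (by linarith)
  obtain ⟨_, _, hC'⟩ := h.exists_duhamel_bounded hp0 (ρ := κ - (σ - s)) (γ' := 1 + κ)
    (by linarith) (by linarith) (by linarith)
  have hd := hC hT' (by positivity) hgF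
  have hd' := hC' hT' (by positivity) hgF
  refine ⟨hgF, ?_⟩
  obtain ⟨u, hu, -, hequ⟩ := hw.equation
  have hu' : ∀ t ∈ Icc t₀ T, 𝓕 (u t) = smoothing σ (b t) := fun t ht => by
    have h1 : Hs.toDist (w t) = Hs.toDist ((coord σ).symm (b t)) :=
      (toDist_eq_iff hsσ _ _).2 (by rw [(coord σ).apply_symm_apply, hb t ht])
    rw [hu t ⟨ht₀.1.trans_le ht.1, ht.2⟩, ← toDist_coord_symm_zero, toDist_eq_iff hσ,
      (coord σ).apply_symm_apply, (coord 0).apply_symm_apply, sub_zero] at h1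
    exact h1
  have hduh : ∀ t ∈ Icc 0 (T - t₀), y t = semi m 0 t (y 0) - duhamel m (κ - (σ - s)) g t := by
    refine h.duhamel_of_weak hp0 (polyGrowth_jb (-s))
      (fun ξ => Complex.ofReal_ne_zero.2 (jb_pos _ _).ne') hT0' hT' one_pos hgF
      (fun t ht => (hd'.1 t ht).1) hd'.2 hyc fun φ t ht => ?_
    have h1 := (hequ (𝓕 φ) t₀ (t₀ + t) ht₀.1 (by linarith [ht.1]) (hmem ht).2).2
    rw [toDist_apply, toDist_apply, schwartz_fourierInv_fourier] at h1
    have h2 : ∫ τ in t₀..t₀ + t, (pairDxxx (Hs.toDist (w τ)) (𝓕 φ) + η * pairL Φ (w τ) (𝓕 φ) +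
        pairDxSq (u τ) (𝓕 φ)) = -∫ τ in (0 : ℝ)..t,
          (pair (y τ) (testVec (fun ξ => m ξ * jb (-s) ξ) φ) -
          pair (g τ) (testVec (fun ξ => dSym ξ * jb (κ - (σ - s)) ξ * jb (-s) ξ) φ)) := by
      have h3 := intervalIntegral.integral_comp_add_left (a := 0) (b := t) (fun τ =>
        pairDxxx (Hs.toDist (w τ)) (𝓕 φ) + η * pairL Φ (w τ) (𝓕 φ) + pairDxSq (u τ) (𝓕 φ)) t₀
      rw [add_zero] at h3
      rw [← h3, ← intervalIntegral.integral_neg]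
      refine intervalIntegral.integral_congr fun τ hτ => ?_
      rw [uIcc_of_le ht.1] at hτ
      have hτ' := hmem ⟨hτ.1, hτ.2.trans ht.2⟩
      rw [pairDxxx_add_pairL h hη, pairDxSq_eq hσ hκ (ρ := κ - (σ - s)) (s := s) (by ring)
        (hu' _ hτ'), schwartz_fourierInv_fourier, neg_sub', sub_neg_eq_add]
    rw [h2] at h1
    simp only [hy, add_zero]
    exact sub_eq_zero.1 (by rw [sub_eq_add_neg]; exact h1)
  intro t ht
  refine smoothing_injective hθ ?_
  rw [map_sub, h.smoothing_semi_comm hθ ht.1 (ht.2.trans hT'),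
    h.smoothing_duhamel hp0 hθ ht.1 (ht.2.trans hT') (hd.1 t ht).1, ← hyb t ht, hduh t ht,
    hyb 0 ⟨le_rfl, hT0'⟩, add_zero]

/-! ### Uniqueness for the integral equation -/

theorem Forcing.shift {b A a : ℝ} {g : ℝ → L2R} (hg : Forcing T b A g) (hA : 0 ≤ A) (hb : 0 ≤ b)
    (ha : 0 ≤ a) : Forcing (T - a) b A fun τ => g (a + τ) := by
  refine ⟨?_, fun τ hτ => ?_⟩
  · have h1 : Measure.map (fun τ => a + τ) (volume.restrict (Ioc (0 : ℝ) (T - a))) =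
        volume.restrict (Ioc a T) := by
      have h2 := (measurePreserving_add_left (volume : Measure ℝ) a).restrict_preimage
        (measurableSet_Ioc (a := a) (b := T))
      rw [preimage_const_add_Ioc, sub_self] at h2
      exact h2.map_eq
    have h3 : AEStronglyMeasurable g (Measure.map (fun τ => a + τ)
        (volume.restrict (Ioc (0 : ℝ) (T - a)))) := by
      rw [h1]
      exact hg.meas.mono_measure (Measure.restrict_mono (Ioc_subset_Ioc_left ha) le_rfl)
    exact h3.comp_measurable (by fun_prop)
  · refine (hg.le (a + τ) ⟨by linarith [hτ.1], by linarith [hτ.2]⟩).trans ?_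
    gcongr ?_ * ?_
    exact Real.rpow_le_rpow_of_nonpos hτ.1 (by linarith) (neg_nonpos.2 hb)

theorem duhamel_shift {ρ a t : ℝ} {g : ℝ → L2R} (ha : 0 ≤ a)
    (hi : IntervalIntegrable (fun τ => dsemi m ρ (t - τ) (g τ)) volume 0 t) (hat : a ≤ t)
    (hg : ∀ τ ∈ Ioc 0 a, g τ = 0) :
    duhamel m ρ g t = duhamel m ρ (fun τ => g (a + τ)) (t - a) := by
  have h1 : ∀ {x y : ℝ}, 0 ≤ x → x ≤ y → y ≤ t →
      IntervalIntegrable (fun τ => dsemi m ρ (t - τ) (g τ)) volume x y := fun {x y} hx hxy hy =>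
    hi.mono_set (by
      rw [uIcc_of_le hxy, uIcc_of_le (ha.trans hat)]
      exact Icc_subset_Icc hx hy)
  have h2 : ∫ τ in (0 : ℝ)..a, dsemi m ρ (t - τ) (g τ) = 0 := by
    rw [intervalIntegral.integral_congr_ae (g := fun _ => 0), intervalIntegral.integral_zero]
    refine ae_of_all _ fun τ hτ => ?_
    rw [uIoc_of_le ha] at hτ
    rw [hg τ hτ, map_zero]
  have h3 := intervalIntegral.integral_comp_add_left (a := 0) (b := t - a)
    (fun τ => dsemi m ρ (t - τ) (g τ)) a
  rw [add_zero, add_sub_cancel] at h3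
  unfold duhamel
  rw [← intervalIntegral.integral_add_adjacent_intervals (h1 le_rfl ha hat) (h1 ha hat le_rfl), h2,
    zero_add, ← h3]
  simp only [sub_sub]

/-- A function controlled by a Duhamel integral over its own past vanishes, since it vanishes on
every interval of a fixed length beyond the ones where it is known to vanish. -/
theorem Exponents.eq_zero_of_duhamel (e : Exponents p s κ γ) (h : DissSymbol m p) (hT : T ≤ 1)
    {δ g : ℝ → L2R} {N L : ℝ} (hN : 0 ≤ N) (hL : 0 ≤ L)
    (hδ : ∀ t ∈ Ioc 0 T, t ^ (deficit s / p) * ‖δ t‖ ≤ N)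
    (hgm : AEStronglyMeasurable g (volume.restrict (Ioc 0 T)))
    (hg : ∀ t ∈ Ioc 0 T, ‖g t‖ ≤ L * t ^ (-(deficit s / p)) * ‖δ t‖)
    (heq : ∀ t ∈ Ioc 0 T, δ t = duhamel m κ g t) : ∀ t ∈ Ioc 0 T, δ t = 0 := by
  set β := deficit s / p with hβ
  have hβ0 : 0 ≤ β := e.weight_nonneg
  have hp0 := e.p_pos
  have hγ1 : 0 < 1 - γ := by linarith [e.hγ]
  obtain ⟨C, hC0, hC⟩ := e.exists_weighted_dsemi_le h
  have hexp : ∀ {t : ℝ}, 0 < t → t ^ (-(2 * β)) = t ^ (-β) * t ^ (-β) := fun {t} ht => by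
    rw [← Real.rpow_add ht]
    ring_nf
  have hinv : ∀ {t : ℝ}, 0 < t → t ^ (-β) * t ^ β = 1 := fun {t} ht => by
    rw [← Real.rpow_add ht, neg_add_cancel, Real.rpow_zero]
  have hforce : ∀ {t N' : ℝ}, t ∈ Ioc 0 T → t ^ β * ‖δ t‖ ≤ N' →
      ‖g t‖ ≤ L * N' * t ^ (-(2 * β)) := fun {t N'} ht hN' => by
    have h1 : 0 < t ^ (-β) := Real.rpow_pos_of_pos ht.1 _
    calc ‖g t‖ ≤ L * t ^ (-β) * ‖δ t‖ := hg t ht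
      _ = L * t ^ (-β) * ((t ^ (-β) * t ^ β) * ‖δ t‖) := by rw [hinv ht.1, one_mul]
      _ = L * t ^ (-β) * (t ^ (-β) * (t ^ β * ‖δ t‖)) := by ring
      _ ≤ L * t ^ (-β) * (t ^ (-β) * N') := by gcongr
      _ = _ := by rw [hexp ht.1]; ring
  have hgF : Forcing T (2 * β) (L * N) g := ⟨hgm, fun τ hτ => hforce hτ (hδ τ hτ)⟩
  obtain ⟨C', -, hC'⟩ := e.exists_duhamelBound h
  have hint := fun t ht => ((hC' hT (by positivity) hgF).2 t ht).integrable_top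
  -- the length of a step, for which the Duhamel operator is a contraction
  obtain ⟨ℓ, hℓ, hℓC⟩ : ∃ ℓ : ℝ, 0 < ℓ ∧ C * L * (2 * ℓ ^ (1 - γ) / (1 - γ)) ≤ 1 / 2 := by
    have hlim : Tendsto (fun ℓ : ℝ => C * L * (2 * ℓ ^ (1 - γ) / (1 - γ))) (𝓝[>] 0) (𝓝 0) := by
      have h1 : Tendsto (fun T : ℝ => T ^ (1 - γ)) (𝓝[>] 0) (𝓝 0) := by
        have := (Real.continuousAt_rpow_const 0 (1 - γ) (Or.inr hγ1.le)).tendsto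
        rw [Real.zero_rpow hγ1.ne'] at this
        exact this.mono_left nhdsWithin_le_nhds
      simpa using ((h1.const_mul 2).div_const (1 - γ)).const_mul (C * L)
    have hev := (hlim.eventually (eventually_le_nhds one_half_pos)).and self_mem_nhdsWithin
    obtain ⟨ℓ, hℓ, hℓ'⟩ := hev.exists
    exact ⟨ℓ, hℓ', hℓ⟩
  have hstep : ∀ a, 0 ≤ a → (∀ t ∈ Ioc 0 T, t ≤ a → δ t = 0) →
      ∀ t ∈ Ioc 0 T, t ≤ a + ℓ → δ t = 0 := by
    intro a ha h0
    have hhalf : ∀ n : ℕ, ∀ t ∈ Ioc 0 T, t ≤ a + ℓ → t ^ β * ‖δ t‖ ≤ N * (1 / 2) ^ n := by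
      intro n
      induction n with
      | zero =>
        intro t ht _
        simpa using hδ t ht
      | succ n ih =>
        intro t ht hta
        rcases le_or_gt t a with hle | hlt
        · rw [h0 t ht hle, norm_zero, mul_zero]
          positivity
        have htβ : 0 < t ^ β := Real.rpow_pos_of_pos ht.1 _
        have hg0 : ∀ τ ∈ Ioc 0 a, g τ = 0 := fun τ hτ => by
          have hτT : τ ∈ Ioc 0 T := ⟨hτ.1, hτ.2.trans (hlt.le.trans ht.2)⟩
          have := hg τ hτT
          rw [h0 τ hτT hτ.2, norm_zero, mul_zero] at this
          exact norm_le_zero_iff.1 this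
        have hbd := (h.intervalIntegrable_duhamel hp0 (ρ := κ)
          ((hgF.mono ht.2).shift (a := a) (by positivity) (by positivity) ha) (by linarith)
          (by linarith [ht.2]) e.hγ (D := (t ^ β)⁻¹ * (C * (L * (N * (1 / 2) ^ n))))
          fun τ hτ hτt => by
            have hτ' : a + τ ∈ Ioc 0 T := ⟨by linarith, by linarith [ht.2]⟩
            have h1 := hC t (a + τ) hτ'.1 (by linarith) (ht.2.trans hT) (g (a + τ))
            have h2 := hforce hτ' (ih (a + τ) hτ' (by linarith))
            have h3 : 0 < (a + τ) ^ (-(2 * β)) := Real.rpow_pos_of_pos hτ'.1 _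
            have h4 : ker γ t (a + τ) ≤ ker γ (t - a) τ := by
              unfold ker
              rw [sub_sub]
              exact add_le_add le_rfl
                (Real.rpow_le_rpow_of_nonpos hτ (by linarith) (neg_nonpos.2 e.γ_nonneg))
            have h5 := (ker_nonneg (γ := γ) hτ'.1 (show a + τ < t by linarith)).trans h4
            rw [sub_sub, mul_assoc, le_inv_mul_iff₀ htβ]
            refine le_of_mul_le_mul_left ?_ h3
            calc _ = t ^ β * ((a + τ) ^ (-(2 * β)) * ‖dsemi m κ (t - (a + τ)) (g (a + τ))‖) := by
                  ring
              _ ≤ C * ker γ t (a + τ) * ‖g (a + τ)‖ := h1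
              _ ≤ C * ker γ (t - a) τ * (L * (N * (1 / 2) ^ n) * (a + τ) ^ (-(2 * β))) := by gcongr
              _ = _ := by ring).2
        rw [heq t ht, duhamel_shift ha (hint t ⟨ht.1.le, ht.2⟩) hlt.le hg0]
        have h6 : (t - a) ^ (1 - γ) ≤ ℓ ^ (1 - γ) :=
          Real.rpow_le_rpow (by linarith) (by linarith) hγ1.le
        calc _ ≤ t ^ β * ((t ^ β)⁻¹ * (C * (L * (N * (1 / 2) ^ n))) *
              (2 * (t - a) ^ (1 - γ) / (1 - γ))) := by gcongr
          _ = (t ^ β * (t ^ β)⁻¹) * (C * L * (2 * (t - a) ^ (1 - γ) / (1 - γ))) *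
              (N * (1 / 2) ^ n) := by ring
          _ = (C * L * (2 * (t - a) ^ (1 - γ) / (1 - γ))) * (N * (1 / 2) ^ n) := by
            rw [mul_inv_cancel₀ htβ.ne', one_mul]
          _ ≤ (C * L * (2 * ℓ ^ (1 - γ) / (1 - γ))) * (N * (1 / 2) ^ n) := by gcongr
          _ ≤ 1 / 2 * (N * (1 / 2) ^ n) := by gcongr
          _ = _ := by ring
    intro t ht hta
    have hlim : Tendsto (fun n : ℕ => N * (1 / 2 : ℝ) ^ n) atTop (𝓝 0) := by
      simpa using (tendsto_pow_atTop_nhds_zero_of_lt_one (by norm_num : (0 : ℝ) ≤ 1 / 2)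
        (by norm_num)).const_mul N
    have h1 := ge_of_tendsto' hlim fun n => hhalf n t ht hta
    have htβ : 0 < t ^ β := Real.rpow_pos_of_pos ht.1 _
    have h2 : ‖δ t‖ ≤ 0 := by
      by_contra! hcon
      exact absurd h1 (not_le.2 (mul_pos htβ hcon))
    exact norm_le_zero_iff.1 h2
  have hall : ∀ n : ℕ, ∀ t ∈ Ioc 0 T, t ≤ n * ℓ → δ t = 0 := by
    intro n
    induction n with
    | zero =>
      intro t ht h0
      rw [Nat.cast_zero, zero_mul] at h0
      exact absurd ht.1 (not_lt.2 h0)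
    | succ n ih =>
      refine fun t ht htn => hstep (n * ℓ) (by positivity) ih t ht ?_
      push_cast at htn
      linarith
  intro t ht
  obtain ⟨n, hn⟩ := exists_nat_ge (T / ℓ)
  exact hall n t ht (ht.2.trans ((div_le_iff₀ hℓ).1 hn))

end

/-! ### Uniqueness for the initial value problem -/

section

variable {p s κ γ T η : ℝ} {Φ : ℝ → ℝ} {m : ℝ → ℂ}

/-- `w` is bounded in `H^σ` on `[ε, T]` for every `ε > 0` (for `s ≤ σ`). -/
def BoundedAwayFromZero (s σ T : ℝ) (w : ℝ → Hs s) : Prop :=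
  ∀ ε ∈ Ioc 0 T, ∃ M : ℝ, ∀ t ∈ Icc ε T, ∃ b, coord s (w t) = smoothing (σ - s) b ∧ ‖b‖ ≤ M

theorem BoundedAwayFromZero.exists_coord {σ : ℝ} {w : ℝ → Hs s}
    (hw : BoundedAwayFromZero s σ T w) {ε : ℝ} (hε : ε ∈ Ioc 0 T) :
    ∃ (b : ℝ → L2R) (M : ℝ), 0 ≤ M ∧ (∀ t ∈ Icc ε T, coord s (w t) = smoothing (σ - s) (b t)) ∧
      ∀ t ∈ Icc ε T, ‖b t‖ ≤ M := by
  obtain ⟨M, hM⟩ := hw ε hε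
  choose! b hb using hM
  exact ⟨b, M, (norm_nonneg _).trans (hb ε ⟨le_rfl, hε.2⟩).2, fun t ht => (hb t ht).1,
    fun t ht => (hb t ht).2⟩

theorem IsSolution.boundedAwayFromZero {v₀ : Hs s} {w : ℝ → Hs s}
    (hw : IsSolution η Φ s T v₀ w) : BoundedAwayFromZero s (max s 0) T w := by
  intro ε hε
  obtain ⟨u, hu, hub, -⟩ := hw.equation
  obtain ⟨M, hM⟩ := hub ε hε
  obtain ⟨M', hM'⟩ := isCompact_Icc.exists_bound_of_continuousOn hw.continuousOn
  refine ⟨max M' M, fun t ht => ?_⟩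
  have ht0 : t ∈ Ioc 0 T := ⟨hε.1.trans_le ht.1, ht.2⟩
  obtain ⟨b, hb, -, hbn⟩ := exists_coord_of_toDist_eq (hu t ht0)
  rw [max_sub_eq_deficit]
  exact ⟨b, hb, hbn.trans (max_le_max (hM' t (Ioc_subset_Icc_self ht0)) (hM t ht))⟩

/-- Restarted at a positive time, a solution agrees with the solution of the integral equation in
`XT`. -/
theorem IsSolution.eq_mild {e : Exponents p s κ γ} (h : DissSymbol (symbol η Φ) p) (hη : η ≠ 0)
    (hT : T ≤ 1) (hT0 : 0 ≤ T) {v₀ : Hs s} {w : ℝ → Hs s} (hw : IsSolution η Φ s T v₀ w) {t₀ : ℝ}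
    (ht₀ : t₀ ∈ Ioc 0 T) {V : XT p s T} (hV : IsMild (symbol η Φ) e (w t₀) V) {t : ℝ}
    (ht : t ∈ Ioc 0 (T - t₀)) : w (t₀ + t) = IccExtend hT0 (XT.toC V) t := by
  obtain ⟨b, M, hM0, hb, hM⟩ := hw.boundedAwayFromZero.exists_coord ht₀
  obtain ⟨hg₁, hduh⟩ := hw.duhamel_eq h hη e.hp e.hκ e.hκ1 hT (le_max_left s 0) (le_max_right s 0)
    ht₀ hb hM
  change Forcing (T - t₀) 0 (‖e.prod‖ * (M * M)) (fun τ => e.prod (b (t₀ + τ)) (b (t₀ + τ))) at hg₁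
  change ∀ t ∈ Icc 0 (T - t₀), b (t₀ + t) = semi (symbol η Φ) 0 t (b t₀) -
      duhamel (symbol η Φ) κ (fun τ => e.prod (b (t₀ + τ)) (b (t₀ + τ))) t at hduh
  rw [max_sub_eq_deficit] at hb
  set m := symbol η Φ with hm
  have hT' : T - t₀ ≤ 1 := by linarith [ht₀.1]
  have hsub : ∀ {τ : ℝ}, τ ∈ Ioc 0 (T - t₀) → τ ∈ Ioc 0 T := fun {τ} hτ =>
    ⟨hτ.1, by linarith [hτ.2, ht₀.1]⟩
  have hmem : ∀ {τ}, τ ∈ Ioc 0 (T - t₀) → t₀ + τ ∈ Icc t₀ T := fun {τ} hτ =>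
    ⟨by linarith [hτ.1], by linarith [hτ.2]⟩
  set g₁ : ℝ → L2R := fun τ => e.prod (b (t₀ + τ)) (b (t₀ + τ)) with hg₁'
  set g₂ : ℝ → L2R := fun τ => e.prod (V.rep τ) (V.rep τ) with hg₂'
  have hg₂ : Forcing T (2 * (deficit s / p)) (‖e.prod‖ * (‖V‖ * ‖V‖)) g₂ := e.forcing_rep hT0 V V
  obtain ⟨C, -, hC⟩ := e.exists_duhamelBound h
  have hd₂ := (hC hT (by positivity) hg₂).2
  obtain ⟨C', -, hC'⟩ := h.exists_duhamel_bounded e.p_pos (ρ := κ) (γ' := 1 + κ)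
    (by linarith [e.hκ]) le_rfl (by linarith [e.hp, e.hκ1])
  have hd₁ := (hC' hT' (by positivity) hg₁).1
  have hVt : ∀ {τ} (hτ : τ ∈ Ioc 0 (T - t₀)), V.rep τ = semi m 0 τ (b t₀) - duhamel m κ g₂ τ := by
    intro τ hτ
    have hτ1 : τ ≤ 1 := hτ.2.trans hT'
    refine V.rep_eq (hsub hτ) ?_
    rw [hV, map_sub, h.smoothing_semi_comm (deficit_nonneg s) hτ.1.le hτ1,
      ← hb t₀ ⟨le_rfl, ht₀.2⟩, ← (hd₂ τ (Ioc_subset_Icc_self (hsub hτ))).eq_smoothing]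
  have hone : ∀ {τ : ℝ}, τ ∈ Ioc 0 (T - t₀) → 1 ≤ τ ^ (-(deficit s / p)) := fun {τ} hτ =>
    Real.one_le_rpow_of_pos_of_le_one_of_nonpos hτ.1 (hτ.2.trans hT')
      (neg_nonpos.2 e.weight_nonneg)
  have hzero := e.eq_zero_of_duhamel h hT' (δ := fun τ => b (t₀ + τ) - V.rep τ)
    (g := fun τ => g₂ τ - g₁ τ) (N := M + ‖V‖) (L := ‖e.prod‖ * (M + ‖V‖)) (by positivity)
    (by positivity) (fun τ hτ => ?_) ((hg₂.mono (by linarith [ht₀.1])).meas.sub hg₁.meas)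
    (fun τ hτ => ?_) (fun τ hτ => ?_) t ht
  · rw [IccExtend_of_mem _ _ (Ioc_subset_Icc_self (hsub ht))]
    refine (coord s).injective ?_
    rw [V.rep_spec (hsub ht), hb _ (hmem ht), sub_eq_zero.1 hzero]
  · have h1 := V.norm_rep_le (hsub hτ)
    have h2 : τ ^ (deficit s / p) ≤ 1 :=
      Real.rpow_le_one hτ.1.le (hτ.2.trans hT') e.weight_nonneg
    have h3 : 0 ≤ τ ^ (deficit s / p) := Real.rpow_nonneg hτ.1.le _
    have h4 : τ ^ (deficit s / p) * τ ^ (-(deficit s / p)) = 1 := by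
      rw [← Real.rpow_add hτ.1, add_neg_cancel, Real.rpow_zero]
    calc _ ≤ τ ^ (deficit s / p) * (‖b (t₀ + τ)‖ + ‖V.rep τ‖) := by
          gcongr
          exact norm_sub_le _ _
      _ ≤ τ ^ (deficit s / p) * (M + ‖V‖ * τ ^ (-(deficit s / p))) := by
        gcongr
        exact hM _ (hmem hτ)
      _ = τ ^ (deficit s / p) * M + ‖V‖ := by linear_combination ‖V‖ * h4
      _ ≤ 1 * M + ‖V‖ := by gcongr
      _ = _ := by ring
  · have h1 : g₂ τ - g₁ τ = -(e.prod (b (t₀ + τ) - V.rep τ) (b (t₀ + τ)) +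
        e.prod (V.rep τ) (b (t₀ + τ) - V.rep τ)) := by
      simp only [hg₁', hg₂', map_sub, _root_.sub_apply]
      abel
    rw [h1, norm_neg]
    calc _ ≤ ‖e.prod‖ * ‖b (t₀ + τ) - V.rep τ‖ * ‖b (t₀ + τ)‖ +
          ‖e.prod‖ * ‖V.rep τ‖ * ‖b (t₀ + τ) - V.rep τ‖ :=
          (norm_add_le _ _).trans (add_le_add (e.prod.le_opNorm₂ _ _) (e.prod.le_opNorm₂ _ _))
      _ ≤ ‖e.prod‖ * ‖b (t₀ + τ) - V.rep τ‖ * (M * τ ^ (-(deficit s / p))) +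
          ‖e.prod‖ * (‖V‖ * τ ^ (-(deficit s / p))) * ‖b (t₀ + τ) - V.rep τ‖ := by
        gcongr
        · exact (hM _ (hmem hτ)).trans (le_mul_of_one_le_right hM0 (hone hτ))
        · exact V.norm_rep_le (hsub hτ)
      _ = _ := by ring
  · have h1 := (hd₂ τ (Ioc_subset_Icc_self (hsub hτ))).integrable_top
    have h2 := (hd₁ τ (Ioc_subset_Icc_self hτ)).1
    rw [hduh τ (Ioc_subset_Icc_self hτ), hVt hτ]
    have h3 : duhamel m κ (fun τ => g₂ τ - g₁ τ) τ = duhamel m κ g₂ τ - duhamel m κ g₁ τ := by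
      simp only [duhamel, map_sub]
      exact intervalIntegral.integral_sub h1 h2
    rw [h3]
    abel

/-- Solutions of the initial value problem are unique: restarted at a small time `t₀` they agree
with the solution map, which is continuous in the initial value, and `t₀` may tend to `0`. -/
theorem IsSolution.eq_solutionMap {e : Exponents p s κ γ} (h : DissSymbol (symbol η Φ) p)
    (hη : η ≠ 0) (hT : T ≤ 1) (hT0 : 0 < T) {R : ℝ} {S : Hs s → XT p s T}
    (hS : ∀ v₀, ‖v₀‖ < R → IsMild (symbol η Φ) e v₀ (S v₀))
    (hSc : ContinuousOn S (Metric.ball 0 R)) {v₀ : Hs s} (hv₀ : ‖v₀‖ < R) {w : ℝ → Hs s}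
    (hw : IsSolution η Φ s T v₀ w) {t : ℝ} (ht : t ∈ Icc 0 T) :
    w t = IccExtend hT0.le (XT.toC (S v₀)) t := by
  rcases ht.1.eq_or_lt with rfl | h0
  · rw [hw.initial, ((hS v₀ hv₀).isSolution h hη hT0 hT).initial]
  set v : ℝ → Hs s := IccExtend hT0.le (XT.toC (S v₀)) with hv
  have hvc : Continuous v := (XT.toC (S v₀)).continuous.Icc_extend'
  have hwt : Tendsto w (𝓝[>] 0) (𝓝 v₀) := by
    have h1 := hw.continuousOn 0 ⟨le_rfl, hT0.le⟩
    rw [ContinuousWithinAt, hw.initial] at h1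
    exact h1.mono_left (nhdsWithin_le_of_mem (mem_of_superset (Ioo_mem_nhdsGT hT0)
      Ioo_subset_Icc_self))
  have hball : Metric.ball (0 : Hs s) R ∈ 𝓝 v₀ :=
    Metric.isOpen_ball.mem_nhds (mem_ball_zero_iff.2 hv₀)
  have hSt : Tendsto (fun t₀ => S (w t₀) - S v₀) (𝓝[>] 0) (𝓝 0) := by
    have h1 := ((hSc.continuousAt hball).tendsto.comp hwt).sub_const (S v₀)
    rwa [sub_self] at h1
  have hvt : Tendsto (fun t₀ => v (t - t₀)) (𝓝[>] 0) (𝓝 (v t)) := by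
    have h1 : Continuous fun t₀ => v (t - t₀) := by fun_prop
    have h2 := h1.tendsto 0
    rw [sub_zero] at h2
    exact h2.mono_left nhdsWithin_le_nhds
  have hdiff : Tendsto (fun t₀ => IccExtend hT0.le (XT.toC (S (w t₀))) (t - t₀) - v (t - t₀))
      (𝓝[>] 0) (𝓝 0) := by
    refine squeeze_zero_norm (fun t₀ => ?_) (tendsto_zero_iff_norm_tendsto_zero.1 hSt)
    have h1 : IccExtend hT0.le (XT.toC (S (w t₀))) (t - t₀) - v (t - t₀) =
        XT.toC (S (w t₀) - S v₀) (projIcc 0 T hT0.le (t - t₀)) := by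
      rw [map_sub]
      rfl
    rw [h1]
    exact XT.norm_apply_le _ _
  have hlim : Tendsto (fun t₀ => IccExtend hT0.le (XT.toC (S (w t₀))) (t - t₀)) (𝓝[>] 0)
      (𝓝 (v t)) := by
    have h1 := hdiff.add hvt
    simpa using h1
  have hev : ∀ᶠ t₀ in 𝓝[>] 0, IccExtend hT0.le (XT.toC (S (w t₀))) (t - t₀) = w t := by
    filter_upwards [hwt.eventually_mem hball, Ioo_mem_nhdsGT h0] with t₀ h1 h2
    have h3 := hw.eq_mild (e := e) h hη hT hT0.le ⟨h2.1, h2.2.le.trans ht.2⟩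
      (hS _ (mem_ball_zero_iff.1 h1)) (t := t - t₀) ⟨by linarith [h2.2], by linarith [ht.2]⟩
    rw [add_sub_cancel] at h3
    exact h3.symm
  exact tendsto_nhds_unique (tendsto_const_nhds.congr' (hev.mono fun _ h => h.symm)) hlim

/-! ### Smoothing -/

theorem IsSolution.boundedAwayFromZero_add_one (h : DissSymbol (symbol η Φ) p) (hη : η ≠ 0)
    (hp : 3 < p) (hT : T ≤ 1) {v₀ : Hs s} {w : ℝ → Hs s} (hw : IsSolution η Φ s T v₀ w) {σ : ℝ}
    (hsσ : s ≤ σ) (hσ : 0 ≤ σ) (hb : BoundedAwayFromZero s σ T w) :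
    BoundedAwayFromZero s (σ + 1) T w := by
  intro ε hε
  have hp0 : 0 < p := by linarith
  obtain ⟨κ, hκ, hκ1⟩ := exists_between (show (1 : ℝ) / 2 < 1 by norm_num)
  have ht₀ : ε / 2 ∈ Ioc 0 T := ⟨by linarith [hε.1], by linarith [hε.1, hε.2]⟩
  obtain ⟨b, M, hM0, hb, hM⟩ := hb.exists_coord ht₀
  obtain ⟨hg, hduh⟩ := hw.duhamel_eq h hη hp hκ hκ1 hT hsσ hσ ht₀ hb hM
  set m := symbol η Φ with hm
  set A := ‖prodOp hσ hκ‖ * (M * M) with hA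
  set g : ℝ → L2R := fun τ => prodOp hσ hκ (b (ε / 2 + τ)) (b (ε / 2 + τ)) with hg'
  have hT' : T - ε / 2 ≤ 1 := by linarith [hε.1]
  obtain ⟨C₁, hC₁0, hC₁⟩ := h.exists_norm_semi_le hp0 1 (γ := 1) zero_le_one le_rfl
  obtain ⟨C₂, hC₂0, hC₂⟩ := h.exists_duhamel_bounded hp0 (ρ := κ + 1) (γ' := 1 + (κ + 1))
    (by linarith) le_rfl (by linarith)
  have hd := (hC₂ hT' (by positivity) hg).1
  refine ⟨C₁ * (ε / 2) ^ (-(1 / p)) * M + C₂ * A, fun t ht =>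
    ⟨semi m 1 (t - ε / 2) (b (ε / 2)) - duhamel m (κ + 1) g (t - ε / 2), ?_, ?_⟩⟩
  · have ht1 : 0 < t - ε / 2 := by linarith [ht.1, hε.1]
    have ht2 : t - ε / 2 ∈ Icc 0 (T - ε / 2) := ⟨ht1.le, by linarith [ht.2]⟩
    have h1 := hduh _ ht2
    rw [add_sub_cancel] at h1
    rw [hb t ⟨by linarith [ht.1, hε.1], ht.2⟩, h1, show σ + 1 - s = (σ - s) + 1 by ring,
      ← smoothing_smoothing (by linarith) zero_le_one, map_sub (smoothing 1),
      h.smoothing_semi hp0 zero_le_one _ ht1 (ht2.2.trans hT'),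
      h.smoothing_duhamel hp0 zero_le_one ht1.le (ht2.2.trans hT') (hd _ ht2).1, sub_self,
      add_sub_cancel_right]
  · have hε2 : 0 < ε / 2 := ht₀.1
    have ht1 : 0 < t - ε / 2 := by linarith [ht.1, hε.1]
    have ht2 : t - ε / 2 ∈ Icc 0 (T - ε / 2) := ⟨ht1.le, by linarith [ht.2]⟩
    have h1 := hC₁ _ ht1 (ht2.2.trans hT') (b (ε / 2))
    have h2 : (t - ε / 2) ^ (-(1 / p)) ≤ (ε / 2) ^ (-(1 / p)) :=
      Real.rpow_le_rpow_of_nonpos hε2 (by linarith [ht.1]) (neg_nonpos.2 (by positivity))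
    have h3 := hM (ε / 2) ⟨le_rfl, ht₀.2⟩
    refine (norm_sub_le _ _).trans (add_le_add (h1.trans ?_) (hd _ ht2).2)
    gcongr

theorem IsSolution.boundedAwayFromZero_add_nat (h : DissSymbol (symbol η Φ) p) (hη : η ≠ 0)
    (hp : 3 < p) (hT : T ≤ 1) {v₀ : Hs s} {w : ℝ → Hs s} (hw : IsSolution η Φ s T v₀ w) (n : ℕ) :
    BoundedAwayFromZero s (max s 0 + n) T w := by
  induction n with
  | zero =>
    rw [Nat.cast_zero, add_zero]
    exact hw.boundedAwayFromZero
  | succ n ih =>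
    have hn : (0 : ℝ) ≤ n := n.cast_nonneg
    rw [Nat.cast_succ, ← add_assoc]
    exact hw.boundedAwayFromZero_add_one h hη hp hT (by linarith [le_max_left s 0])
      (by linarith [le_max_right s 0]) ih

/-- Boundedness in `H^(s+2r)` and continuity in `H^s` give continuity in `H^(s+r)`. -/
theorem continuousOn_of_boundedAwayFromZero {r : ℝ} (hr : 0 ≤ r) {w : ℝ → Hs s}
    (hw : ContinuousOn w (Icc 0 T)) (hb : BoundedAwayFromZero s (s + (r + r)) T w) :
    ∃ y : ℝ → L2R, ContinuousOn y (Ioc 0 T) ∧ ∀ t ∈ Ioc 0 T, coord s (w t) = smoothing r (y t) := by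
  have hex : ∀ t, ∃ b, t ∈ Ioc 0 T → coord s (w t) = smoothing (r + r) b := fun t => by
    by_cases ht : t ∈ Ioc 0 T
    · obtain ⟨M, hM⟩ := hb t ht
      obtain ⟨b, hb, -⟩ := hM t ⟨le_rfl, ht.2⟩
      rw [add_sub_cancel_left] at hb
      exact ⟨b, fun _ => hb⟩
    · exact ⟨0, fun h => absurd h ht⟩
  choose b hbw using hex
  refine ⟨fun t => smoothing r (b t), fun t ht => ?_, fun t ht => ?_⟩
  · obtain ⟨M, hM⟩ := hb (t / 2) ⟨by linarith [ht.1], by linarith [ht.1, ht.2]⟩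
    have hM' : ∀ τ ∈ Icc (t / 2) T, ‖b τ‖ ≤ M := fun τ hτ => by
      obtain ⟨b', hb', hbM⟩ := hM τ hτ
      have hτ0 : τ ∈ Ioc 0 T := ⟨by linarith [hτ.1, ht.1], hτ.2⟩
      rw [add_sub_cancel_left, hbw τ hτ0] at hb'
      rwa [smoothing_injective (add_nonneg hr hr) hb']
    have htt : t ∈ Icc (t / 2) T := ⟨by linarith [ht.1], ht.2⟩
    have hlim : Tendsto (fun τ => Real.sqrt (2 * M * ‖coord s (w τ) - coord s (w t)‖))
        (𝓝[Ioc 0 T] t) (𝓝 0) := by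
      have h1 : Tendsto (fun τ => coord s (w τ)) (𝓝[Ioc 0 T] t) (𝓝 (coord s (w t))) :=
        ((coord s).continuous.tendsto _).comp ((hw t (Ioc_subset_Icc_self ht)).mono
          Ioc_subset_Icc_self)
      have h2 := ((tendsto_iff_norm_sub_tendsto_zero.1 h1).const_mul (2 * M)).sqrt
      simpa using h2
    refine tendsto_iff_norm_sub_tendsto_zero.2 (squeeze_zero' (Eventually.of_forall fun _ =>
      norm_nonneg _) ?_ hlim)
    have hev : ∀ᶠ τ in 𝓝[Ioc 0 T] t, t / 2 < τ :=
      nhdsWithin_le_nhds (lt_mem_nhds (by linarith [ht.1]))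
    filter_upwards [hev, self_mem_nhdsWithin] with τ hτ hτ'
    refine Real.le_sqrt_of_sq_le ?_
    rw [← map_sub, hbw τ hτ', hbw t ht, ← map_sub]
    refine (norm_smoothing_sq_le hr _).trans ?_
    rw [smoothing_smoothing hr hr]
    gcongr
    refine (norm_sub_le _ _).trans ?_
    linarith [hM' τ ⟨hτ.le, hτ'.2⟩, hM' t htt]
  · simp only
    rw [hbw t ht, smoothing_smoothing hr hr]

theorem IsSolution.smoothAfterZero (h : DissSymbol (symbol η Φ) p) (hη : η ≠ 0)
    (hp : 3 < p) (hT : T ≤ 1) {v₀ : Hs s} {w : ℝ → Hs s} (hw : IsSolution η Φ s T v₀ w) :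
    SmoothAfterZero T w := by
  intro σ
  obtain ⟨n, hn⟩ := exists_nat_ge (2 * (σ - s))
  have hn0 : (0 : ℝ) ≤ n := n.cast_nonneg
  have hd := deficit_nonneg s
  set r : ℝ := (deficit s + n) / 2 with hr
  have hr0 : 0 ≤ r := by positivity
  have hb := hw.boundedAwayFromZero_add_nat h hη hp hT n
  rw [show max s 0 + (n : ℝ) = s + (r + r) by rw [hr]; linarith [max_sub_eq_deficit s]] at hb
  obtain ⟨y, hy, hwy⟩ := continuousOn_of_boundedAwayFromZero hr0 hw.continuousOn hb
  have hσ : σ ≤ s + r := by linarith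
  refine ⟨fun t => (coord σ).symm (smoothing (s + r - σ) (y t)), ?_, fun t ht => ?_⟩
  · exact ((coord σ).symm.continuous.comp (smoothing _).continuous).comp_continuousOn hy
  · have h1 : Hs.toDist (w t) = Hs.toDist ((coord (s + r)).symm (y t)) :=
      (toDist_eq_iff (by linarith) _ _).2 (by
        rw [hwy t ht, (coord (s + r)).apply_symm_apply, add_sub_cancel_left])
    rw [h1, toDist_eq_iff hσ, (coord σ).apply_symm_apply, (coord (s + r)).apply_symm_apply]

end

/-! ### Real-valued solutions -/

section

variable {p s κ γ T η : ℝ} {Φ : ℝ → ℝ} {m : ℝ → ℂ}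

/-- The conjugate reflection `ξ ↦ conj (a (-ξ))`, which is complex conjugation on the Fourier
side. -/
def conjReflect : L2R →L[ℝ] L2R :=
  ((Complex.conjCLE : ℂ →L[ℝ] ℂ).compLpL 2 volume).comp
    ((reflectAt 0).toContinuousLinearMap.restrictScalars ℝ)

theorem coeFn_conjReflect (a : L2R) :
    conjReflect a =ᵐ[volume] fun ξ => (starRingEnd ℂ) (a (-ξ)) := by
  filter_upwards [(Complex.conjCLE : ℂ →L[ℝ] ℂ).coeFn_compLpL (reflectAt 0 a),
    coeFn_reflectAt 0 a] with ξ h1 h2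
  rw [zero_sub] at h2
  rw [← h2]
  exact h1

theorem ae_neg {P : ℝ → Prop} (h : ∀ᵐ ξ, P ξ) : ∀ᵐ ξ, P (-ξ) :=
  (Measure.measurePreserving_neg (volume : Measure ℝ)).quasiMeasurePreserving.ae h

theorem norm_conjReflect_le (a : L2R) : ‖conjReflect a‖ ≤ ‖a‖ := by
  have h1 := (Complex.conjCLE : ℂ →L[ℝ] ℂ).norm_compLp_le (reflectAt 0 a)
  rw [Complex.conjCLE_norm, one_mul, (reflectAt 0).norm_map] at h1
  exact h1

theorem conjReflect_mulOp {φ : ℝ → ℂ} (h : IsSymbol φ)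
    (hφ : ∀ ξ, φ (-ξ) = (starRingEnd ℂ) (φ ξ)) (a : L2R) :
    conjReflect (mulOp φ a) = mulOp φ (conjReflect a) := by
  refine Lp.ext ?_
  filter_upwards [coeFn_conjReflect (mulOp φ a), coeFn_mulOp h (conjReflect a),
    coeFn_conjReflect a, ae_neg (coeFn_mulOp h a)] with ξ h1 h2 h3 h4
  rw [h1, h2, h3, h4, hφ, map_mul, Complex.conj_conj]

theorem conjReflect_smoothing {θ : ℝ} (hθ : 0 ≤ θ) (a : L2R) :
    conjReflect (smoothing θ a) = smoothing θ (conjReflect a) :=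
  conjReflect_mulOp (isSymbol_jb (neg_nonpos.2 hθ))
    (fun ξ => by rw [jb_neg_arg, Complex.conj_ofReal]) a

theorem dSym_neg (ξ : ℝ) : dSym (-ξ) = (starRingEnd ℂ) (dSym ξ) := by
  simp only [dSym, map_mul, map_ofNat, Complex.conj_ofReal, Complex.conj_I]
  push_cast
  ring

theorem symbol_neg (hΦ : ∀ ξ, Φ (-ξ) = Φ ξ) (ξ : ℝ) :
    symbol η Φ (-ξ) = (starRingEnd ℂ) (symbol η Φ ξ) := by
  unfold symbol
  rw [dSym_neg, mul_neg, hΦ]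
  simp [Complex.conj_ofReal]

theorem eSym_neg (hm : ∀ ξ, m (-ξ) = (starRingEnd ℂ) (m ξ)) (ρ r ξ : ℝ) :
    eSym m ρ r (-ξ) = (starRingEnd ℂ) (eSym m ρ r ξ) := by
  simp only [eSym, jb_neg_arg, hm, map_mul, Complex.conj_ofReal, ← Complex.exp_conj]

theorem DissSymbol.conjReflect_semi (h : DissSymbol m p)
    (hm : ∀ ξ, m (-ξ) = (starRingEnd ℂ) (m ξ)) {r : ℝ} (hr : 0 ≤ r) (hr1 : r ≤ 1) (a : L2R) :
    conjReflect (semi m 0 r a) = semi m 0 r (conjReflect a) :=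
  conjReflect_mulOp (h.isSymbol_exp hr hr1) (eSym_neg hm 0 r) a

theorem DissSymbol.conjReflect_dsemi (h : DissSymbol m p) (hp : 0 < p)
    (hm : ∀ ξ, m (-ξ) = (starRingEnd ℂ) (m ξ)) (ρ : ℝ) {r : ℝ} (hr : 0 < r) (hr1 : r ≤ 1)
    (a : L2R) : conjReflect (dsemi m ρ r a) = dsemi m ρ r (conjReflect a) :=
  conjReflect_mulOp (h.isSymbol_kSym hp ρ hr hr1)
    (fun ξ => by rw [kSym, dSym_neg, eSym_neg hm, kSym, map_mul]) a

theorem DissSymbol.conjReflect_duhamel (h : DissSymbol m p) (hp : 0 < p)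
    (hm : ∀ ξ, m (-ξ) = (starRingEnd ℂ) (m ξ)) {ρ t : ℝ} {g : ℝ → L2R} (ht0 : 0 ≤ t) (ht : t ≤ 1)
    (hi : IntervalIntegrable (fun τ => dsemi m ρ (t - τ) (g τ)) volume 0 t) :
    conjReflect (duhamel m ρ g t) = duhamel m ρ (fun τ => conjReflect (g τ)) t := by
  unfold duhamel
  rw [← conjReflect.intervalIntegral_comp_comm hi]
  refine intervalIntegral.integral_congr_ae ?_
  have hne : ∀ᵐ τ : ℝ, τ ≠ t := by simp [ae_iff]
  filter_upwards [hne] with τ hτt hτ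
  rw [uIoc_of_le ht0] at hτ
  exact h.conjReflect_dsemi hp hm ρ (sub_pos.2 (lt_of_le_of_ne hτ.2 hτt))
    (by linarith [hτ.1]) _

theorem conv_conjReflect (a b : L2R) (ξ : ℝ) :
    conv (conjReflect a) (conjReflect b) ξ = (starRingEnd ℂ) (conv a b (-ξ)) := by
  rw [conv_eq_integral, conv_eq_integral, ← integral_conj,
    ← integral_neg_eq_self (fun ζ => (starRingEnd ℂ) (a (-ξ - ζ) * b ζ))]
  refine integral_congr_ae ?_
  filter_upwards [coeFn_conjReflect b, (Measure.measurePreserving_sub_left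
    (volume : Measure ℝ) ξ).quasiMeasurePreserving.ae (coeFn_conjReflect a)] with ζ h1 h2
  rw [h1, h2, map_mul, neg_sub, show -ξ - -ζ = ζ - ξ by ring]

theorem conjReflect_prodOp {σ : ℝ} (hσ : 0 ≤ σ) (hκ : 1 / 2 < κ) (a b : L2R) :
    conjReflect (prodOp hσ hκ a b) = prodOp hσ hκ (conjReflect a) (conjReflect b) := by
  refine Lp.ext ?_
  filter_upwards [coeFn_conjReflect (prodOp hσ hκ a b), ae_neg (coeFn_prodOp hσ hκ a b),
    coeFn_prodOp hσ hκ (conjReflect a) (conjReflect b)] with ξ h1 h2 h3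
  rw [h1, h2, h3, ← conjReflect_smoothing hσ, ← conjReflect_smoothing hσ, conv_conjReflect, map_mul,
    jb_neg_arg, Complex.conj_ofReal]

/-- If the initial value is invariant under conjugation, then so is the solution: the conjugate
solution is a solution with the same initial value. -/
theorem Exponents.conjReflect_solution (e : Exponents p s κ γ) (h : DissSymbol (symbol η Φ) p)
    (hη : η ≠ 0) (hT : T ≤ 1) (hT0 : 0 < T) {R : ℝ} {S : Hs s → XT p s T}
    (hS : ∀ v₀, ‖v₀‖ < R → IsMild (symbol η Φ) e v₀ (S v₀))
    (hSc : ContinuousOn S (Metric.ball 0 R)) (hΦ : ∀ ξ, Φ (-ξ) = Φ ξ) {v₀ : Hs s} (hv₀ : ‖v₀‖ < R)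
    (hreal : conjReflect (coord s v₀) = coord s v₀) (t : Icc (0 : ℝ) T) :
    conjReflect (coord s (XT.toC (S v₀) t)) = coord s (XT.toC (S v₀) t) := by
  set m := symbol η Φ with hm
  have hms : ∀ ξ, m (-ξ) = (starRingEnd ℂ) (m ξ) := symbol_neg hΦ
  set V := S v₀ with hV
  set f : C(Icc (0 : ℝ) T, Hs s) :=
    ⟨fun t => (coord s).symm (conjReflect (coord s (XT.toC V t))),
      (coord s).symm.continuous.comp (conjReflect.continuous.comp
        ((coord s).continuous.comp (XT.toC V).continuous))⟩ with hf
  have hfc : ∀ t, coord s (f t) = conjReflect (coord s (XT.toC V t)) := fun t =>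
    (coord s).apply_symm_apply _
  have hfin : xENorm p s T f < ⊤ := by
    refine (xENorm_le e.p_pos hT (A₁ := ‖V‖) (A₂ := ‖V‖) (fun t => ?_) (norm_nonneg _)
      (norm_nonneg _) fun t ht => ?_).trans_lt ENNReal.ofReal_lt_top
    · rw [← (coord s).norm_map, hfc]
      refine (norm_conjReflect_le _).trans ?_
      rw [(coord s).norm_map]
      exact V.norm_apply_le t
    · obtain ⟨b, hb, hbV⟩ := V.exists_coord t ht
      refine ⟨conjReflect b, by rw [hfc, hb, conjReflect_smoothing (deficit_nonneg s)], ?_⟩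
      refine le_trans ?_ hbV
      have := norm_conjReflect_le b
      have h0 : 0 ≤ (t : ℝ) ^ (deficit s / p) := Real.rpow_nonneg t.2.1 _
      gcongr
  set W : XT p s T := XT.mk f hfin with hW
  have hWt : ∀ t, coord s (XT.toC W t) = conjReflect (coord s (XT.toC V t)) := hfc
  have hrep : ∀ τ ∈ Ioc 0 T, W.rep τ = conjReflect (V.rep τ) := fun τ hτ => by
    refine W.rep_eq hτ ?_
    rw [hWt, V.rep_spec hτ, conjReflect_smoothing (deficit_nonneg s)]
  obtain ⟨C, -, hC⟩ := e.exists_duhamelBound h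
  have hWm : IsMild m e v₀ W := by
    intro t
    have hi := ((hC hT (by positivity) (e.forcing_rep hT0.le V V)).2 t t.2).integrable
    rw [hWt, hS v₀ hv₀ t, map_sub, h.conjReflect_semi hms t.2.1 (t.2.2.trans hT), hreal,
      h.conjReflect_duhamel e.p_pos hms t.2.1 (t.2.2.trans hT) hi]
    congr 1
    refine duhamel_congr t.2.1 fun τ hτ => ?_
    rw [hrep τ ⟨hτ.1, hτ.2.trans t.2.2⟩]
    exact conjReflect_prodOp _ _ _ _
  have h1 := (hWm.isSolution h hη hT0 hT).eq_solutionMap h hη hT hT0 hS hSc hv₀ t.2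
  rw [IccExtend_of_mem _ _ t.2, IccExtend_of_mem _ _ t.2] at h1
  rw [← hWt]
  exact congrArg (coord s) h1

/-- The complex conjugate of a Schwartz function. -/
def conjSchwartz (ψ : 𝓢(ℝ, ℂ)) : 𝓢(ℝ, ℂ) :=
  SchwartzMap.postcompCLM (Complex.conjCLE : ℂ →L[ℝ] ℂ) ψ

theorem conjSchwartz_apply (ψ : 𝓢(ℝ, ℂ)) (x : ℝ) :
    conjSchwartz ψ x = (starRingEnd ℂ) (ψ x) := rfl

theorem isRealValued_iff (f : 𝓢'(ℝ, ℂ)) :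
    IsRealValued f ↔ ∀ ψ, (starRingEnd ℂ) (f (conjSchwartz ψ)) = f ψ := by
  constructor
  · intro h ψ
    have h1 := h (ψ + conjSchwartz ψ) fun x => by
      simp [conjSchwartz_apply]
    have h2 := h (Complex.I • (ψ - conjSchwartz ψ)) fun x => by
      simp [conjSchwartz_apply]
    rw [map_add, Complex.add_im] at h1
    rw [map_smul, map_sub, smul_eq_mul, Complex.I_mul_im, Complex.sub_re] at h2
    refine Complex.ext ?_ ?_
    · rw [Complex.conj_re]
      linarith
    · rw [Complex.conj_im]
      linarith
  · intro h ψ hψ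
    have h1 : conjSchwartz ψ = ψ := by
      ext x
      rw [conjSchwartz_apply, Complex.conj_eq_iff_im]
      exact hψ x
    have h2 := h ψ
    rw [h1, Complex.conj_eq_iff_im] at h2
    exact h2

theorem fourierInv_conjSchwartz (ψ : 𝓢(ℝ, ℂ)) (ξ : ℝ) :
    (𝓕⁻ (conjSchwartz ψ) : 𝓢(ℝ, ℂ)) ξ = (starRingEnd ℂ) ((𝓕⁻ ψ : 𝓢(ℝ, ℂ)) (-ξ)) := by
  rw [SchwartzMap.fourierInv_coe, SchwartzMap.fourierInv_coe, Real.fourierInv_eq',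
    Real.fourierInv_eq', ← integral_conj]
  refine integral_congr_ae (ae_of_all _ fun x => ?_)
  simp only [smul_eq_mul, map_mul, ← Complex.exp_conj, conjSchwartz_apply]
  congr 2
  simp [map_ofNat]

theorem conj_toDist_conjSchwartz (f : Hs s) (ψ : 𝓢(ℝ, ℂ)) :
    (starRingEnd ℂ) (Hs.toDist f (conjSchwartz ψ)) =
      pair (conjReflect (coord s f)) (testVec (fun ξ => (jb (-s) ξ : ℂ)) (𝓕⁻ ψ)) := by
  rw [toDist_apply, (polyGrowth_jb (-s)).pair_testVec, (polyGrowth_jb (-s)).pair_testVec,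
    ← integral_conj, ← integral_neg_eq_self]
  refine integral_congr_ae ?_
  filter_upwards [coeFn_conjReflect (coord s f)] with ξ h1
  rw [h1, fourierInv_conjSchwartz, neg_neg, jb_neg_arg, map_mul, map_mul, Complex.conj_conj,
    Complex.conj_ofReal]

theorem isRealValued_toDist_iff (f : Hs s) :
    IsRealValued (Hs.toDist f) ↔ conjReflect (coord s f) = coord s f := by
  rw [isRealValued_iff]
  constructor
  · intro h
    have h1 := eq_of_pair_testVec_eq (polyGrowth_jb (-s)) (polyGrowth_jb (-s))
      (a := conjReflect (coord s f)) (b := coord s f) fun φ => by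
        have h2 := h (𝓕 φ)
        rwa [conj_toDist_conjSchwartz, toDist_apply, schwartz_fourierInv_fourier] at h2
    refine Lp.ext ?_
    filter_upwards [h1] with ξ hξ
    exact mul_right_cancel₀ (Complex.ofReal_ne_zero.2 (jb_pos _ _).ne') hξ
  · intro h ψ
    rw [conj_toDist_conjSchwartz, h, toDist_apply]

end

end DissipativeKdV

end

theorem theorem1p1 (η : ℝ) (hη : 0 < η)
    (p q C : ℝ) (hp : 3 < p) (hq : 0 ≤ q) (hqp : q < p)
    (Φ Φ₁ : ℝ → ℝ) (hΦ₁meas : Measurable Φ₁)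
    (hΦ₁ : ∀ ξ : ℝ, |Φ₁ ξ| ≤ C * (1 + |ξ| ^ q))
    (hΦ : ∀ ξ : ℝ, Φ ξ = -|ξ| ^ p + Φ₁ ξ)
    (s : ℝ) (hs : -p / 2 < s) (R : ℝ) (hR : 0 < R) :
    ∃ (T : ℝ) (hT : 0 < T) (S : DissipativeKdV.Hs s → DissipativeKdV.XT p s T),
      T ≤ 1 ∧
      (∀ v₀ : DissipativeKdV.Hs s, ‖v₀‖ < R →
        ∃ v : ℝ → DissipativeKdV.Hs s,
          v = Set.IccExtend hT.le (DissipativeKdV.XT.toC (S v₀)) ∧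
          DissipativeKdV.IsSolution η Φ s T v₀ v ∧
          (∀ w : ℝ → DissipativeKdV.Hs s, DissipativeKdV.IsSolution η Φ s T v₀ w →
            ∀ t ∈ Set.Icc 0 T, w t = v t) ∧
          DissipativeKdV.SmoothAfterZero T v ∧
          ((∀ ξ : ℝ, Φ (-ξ) = Φ ξ) → DissipativeKdV.IsRealValued (DissipativeKdV.Hs.toDist v₀) →
            ∀ t ∈ Set.Icc 0 T, DissipativeKdV.IsRealValued (DissipativeKdV.Hs.toDist (v t)))) ∧
      ContDiffOn ℂ ∞ S (Metric.ball 0 R) := by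
  have h := DissipativeKdV.dissSymbol_symbol hη hp hq hqp hΦ₁meas hΦ₁ hΦ
  obtain ⟨κ, γ, e⟩ := DissipativeKdV.exists_exponents hp hs
  obtain ⟨T, hT0, S, hT, hS, hSmooth⟩ := e.exists_solutionMap h hR
  refine ⟨T, hT0, S, hT, fun v₀ hv₀ => ⟨_, rfl, (hS v₀ hv₀).isSolution h hη.ne' hT0 hT,
    fun w hw t ht => hw.eq_solutionMap h hη.ne' hT hT0 hS hSmooth.continuousOn hv₀ ht,
    ((hS v₀ hv₀).isSolution h hη.ne' hT0 hT).smoothAfterZero h hη.ne' hp hT,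
    fun heven hreal t ht => ?_⟩, hSmooth⟩
  rw [DissipativeKdV.isRealValued_toDist_iff] at hreal ⊢
  rw [Set.IccExtend_of_mem _ _ ht]
  exact e.conjReflect_solution h hη.ne' hT hT0 hS hSmooth.continuousOn heven hv₀ hreal ⟨t, ht⟩
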